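/- **Setting.** Let $H_0,H_1,H_2:\{0,1\}^*\to\{0,1\}^\kappa$ be independent random oracles. Let $T=2^\tau$ with $\tau\ge 1$, let $k\ge 1$ with $k\tau\le\kappa$, and let $J=J_1J_2$. For a message $M$ let $x_1(M),\dots,x_k(M)\in\{0,\dots,T-1\}$ be the numbers written by the first $k$ consecutive $\tau$-bit substrings of $H_0(M)$. *HORS.* The secret key consists of $T$ independent uniform strings $s_0,\dots,s_{T-1}\in\{0,1\}^\kappa$ and the public key of $v_i=H_2(s_i)$. The signature of $M$ is $(s_{x_1(M)},\dots,s_{x_k(M)})$; $(s'_1,\dots,s'_k)$ is valid for $M$ if $H_2(s'_\ell)=v_{x_\ell(M)}$ for all $\ell$. In the EU-CMA experiment the adversary gets the public key, the random oracles and a signing oracle, and wins if it outputs a valid pair $(M^*,\sigma^*)$ such that $M^*$ was not submitted to the signing oracle. *PQ-HASES.* The master key $msk\in\{0,1\}^\kappa$ is uniform. The user $ID$, from a list of registered identities, has the private keys $sk_1=H_0(msk\,\|\,ID)$ and $sk_{j+1}=H_1(sk_j)$; those with index $j_1J_2+1$ are precomputed for the commitment oracle, which derives the others from them. The commitment for epoch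 $1\le j\le J$ is $C_j=(v_0,\dots,v_{T-1})$ with $v_i=H_2(H_1(sk_j\,\|\,i))$, where $i$ is written with $\tau$ bits. The signature of $M$ in epoch $j$ consists of the strings $s_\ell=H_1(sk_j\,\|\,x_\ell(M))$, $\ell=1,\dots,k$, of $j$ and of $ID$; afterwards $sk_j$ is replaced by $sk_{j+1}$. A signature is valid if $ID$ is registered, $1\le j\le J$, and $H_2(s_\ell)$ is the entry of $C_j$ with index $x_\ell(M)$ for all $\ell$. *F-EU-CMA experiment.* The adversary chooses a registered user $ID$ and gets the random oracles; a signing oracle for that user, which signs in epochs $1,2,\dots$ and refuses after $J$ signatures and after a break-in; a commitment-construct oracle, which returns $C_j$ for any requested $1\le j\le J$; and a break-in oracle, which after $n<J$ signing queries returns $sk_{n+1}$ (and refuses if $n\ge J$). It wins if it outputs a message $M^*$ never submitted to the signing oracle and a valid signature of $M^*$ by $ID$ for an epoch $j^*$ whose key was not exposed, that is, $j^*\le n$ if a break-in took place after $n$ signing queries. *Resources.* Adversaries are probabilistic oracle programs on a random access machine whose registers and memory cells hold bit strings; each operation is charged by the number of bits it handles, and an oracle call by the lengths of question and answer. Time complexity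 means running time plus program size. Resource bounds hold for all coins and all oracle answers of the prescribed lengths. $\mathrm{Adv}^{F\text{-}EU\text{-}CMA}_{PQ\text{-}HASES}(t,q_s,q_h,1)$ is the supremum of the winning probabilities over adversaries with time complexity at most $t$, at most $q_s$ signing and commitment queries in total, at most $q_h$ random oracle queries, and at most one break-in query. $\mathrm{Adv}^{EU\text{-}CMA}_{HORS}(t',q,q')$ is the supremum for time complexity at most $t'$, at most $q$ signing queries and at most $q'$ random oracle queries. Let $H=1+(\kappa+\tau)+\kappa$ be the time of one hash evaluation on a key and an index. **Theorem.** There is a universal constant $C$ such that for all parameters as above, every list of registered identities and all $t,q_s,q_h$, with $$t'=C\,(t+k\cdot H),\qquad q'=q_h+q_s+1,\qquad \varepsilon=\frac{C\,(q_s+q_h+J\,T+k)^2}{2^{\kappa}},$$ the following holds. For every F-EU-CMA adversary $\mathcal A$ against PQ-HASES with resources $(t,q_s,q_h,1)$ there is an EU-CMA adversary $\mathcal F$ against HORS with time complexity at most $t'$, at most $\min(q_s,1)$ signing queries and at most $q'$ random oracle queries such that $$\Pr[\mathcal A\text{ wins}]\le J\cdot\big(\Pr[\mathcal F\text{ wins}]+\varepsilon\big).$$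 In particular $$\mathrm{Adv}^{F\text{-}EU\text{-}CMA}_{PQ\text{-}HASES}(t,q_s,q_h,1)\;\le\; J\cdot\Big(\mathrm{Adv}^{EU\text{-}CMA}_{HORS}\big(t',\min(q_s,1),q'\big)+\varepsilon\Big).$$ -/

import Mathlib

open MeasureTheory
open scoped ENNReal

namespace PQHases

/-! ### Binary strings and numbers -/

/-- Bit strings of arbitrary finite length. -/
abbrev Str := List Bool

/-- The number written by a bit string, least significant bit first. -/
def val : Str → ℕ
  | [] => 0
  | b :: x => b.toNat + 2 * val x

/-- The `n`-bit string that writes `i` (for `i < 2 ^ n`), least significant bit first. -/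
def enc (n i : ℕ) : Str := List.ofFn fun b : Fin n => i.testBit b

/-- Binary increment, least significant bit first. -/
def incr : Str → Str
  | [] => [true]
  | false :: x => true :: x
  | true :: x => false :: incr x

/-- The first `k` consecutive blocks of `n` bits of a string. -/
def blocks (n k : ℕ) (x : Str) : List Str :=
  (List.range k).map fun l => (x.drop (l * n)).take n

/-! ### Machine model

Adversaries are probabilistic oracle programs on a random access machine. The machine has
registers and a random access memory addressed by bit strings; both hold bit strings, and all of
them are empty unless an input is loaded. Every elementary operation is charged in proportion to
the number of bits it handles, and an oracle call is charged the length of the question plus the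
length of the answer. -/

/-- Elementary deterministic operations. A register is a string with access to both ends, so
removing bits on the left and appending bits on the right are charged by the number of bits moved.
-/
inductive Op
  /-- register `r` becomes the constant `w` -/
  | const (r : ℕ) (w : Str)
  /-- register `r` becomes a copy of register `s` -/
  | copy (r s : ℕ)
  /-- append a copy of register `s` to the right of register `r` -/
  | cat (r s : ℕ)
  /-- register `d` becomes the prefix of register `r` that is as long as register `s` -/
  | take (d r s : ℕ)
  /-- remove from register `r` a prefix as long as register `s` -/
  | drop (r s : ℕ)
  /-- binary increment of register `r` -/
  | inc (r : ℕ)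
  /-- register `r` becomes the memory cell whose address is the content of register `a` -/
  | load (r a : ℕ)
  /-- the memory cell whose address is the content of register `a` becomes register `r` -/
  | store (a r : ℕ)

/-- Programs that can call the oracles named by `Q`. -/
inductive Prog (Q : Type) : Type
  | skip : Prog Q
  | op : Op → Prog Q
  /-- register `r` becomes one fresh random bit -/
  | flip (r : ℕ) : Prog Q
  /-- call oracle `q` on the content of register `x`, and put the answer in register `y` -/
  | query (q : Q) (x y : ℕ) : Prog Q
  | seq : Prog Q → Prog Q → Prog Q
  /-- branch on equality of the strings in registers `r` and `s` -/
  | ifEq (r s : ℕ) : Prog Q → Prog Q → Prog Q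
  /-- branch on `<` between the numbers in registers `r` and `s` -/
  | ifLt (r s : ℕ) : Prog Q → Prog Q → Prog Q
  /-- repeat the body as long as registers `r` and `s` differ -/
  | loop (r s : ℕ) : Prog Q → Prog Q

/-- Size of the description of an operation. -/
def Op.size : Op → ℕ
  | .const _ w => 1 + w.length
  | _ => 1

/-- Size of the description of a program. -/
def Prog.size {Q : Type} : Prog Q → ℕ
  | .skip => 1
  | .op o => o.size
  | .flip _ => 1
  | .query _ _ _ => 1
  | .seq p q => 1 + p.size + q.size
  | .ifEq _ _ p q => 1 + p.size + q.size
  | .ifLt _ _ p q => 1 + p.size + q.size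
  | .loop _ _ p => 1 + p.size

/-- A configuration of the machine: registers, memory, number of random bits used so far, and all
oracle calls made so far with their questions, the latest one first. -/
structure Config (Q : Type) where
  reg : ℕ → Str
  mem : Str → Str
  coins : ℕ
  log : List (Q × Str)

/-- Write a register. -/
def Config.setReg {Q : Type} (c : Config Q) (r : ℕ) (w : Str) : Config Q :=
  { c with reg := Function.update c.reg r w }

/-- Effect of an elementary operation. -/
def Op.apply {Q : Type} (c : Config Q) : Op → Config Q
  | .const r w => c.setReg r w
  | .copy r s => c.setReg r (c.reg s)
  | .cat r s => c.setReg r (c.reg r ++ c.reg s)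
  | .take d r s => c.setReg d ((c.reg r).take (c.reg s).length)
  | .drop r s => c.setReg r ((c.reg r).drop (c.reg s).length)
  | .inc r => c.setReg r (incr (c.reg r))
  | .load r a => c.setReg r (c.mem (c.reg a))
  | .store a r => { c with mem := Function.update c.mem (c.reg a) (c.reg r) }

/-- Time taken by an elementary operation. -/
def Op.cost {Q : Type} (c : Config Q) : Op → ℕ
  | .const _ w => 1 + w.length
  | .copy _ s => 1 + (c.reg s).length
  | .cat _ s => 1 + (c.reg s).length
  | .take _ _ s => 1 + (c.reg s).length
  | .drop _ s => 1 + (c.reg s).length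
  | .inc r => 1 + (c.reg r).length
  | .load _ a => 1 + (c.reg a).length + (c.mem (c.reg a)).length
  | .store a r => 1 + (c.reg a).length + (c.reg r).length

/-- The answer of the oracles to a question, given the earlier calls (the latest one first). -/
abbrev Oracle (Q : Type) := List (Q × Str) → Q → Str → Str

/-- `Exec coin orc p c c' n`: with the random bits `coin` and the oracles `orc`, program `p`
started in configuration `c` halts in configuration `c'` after time `n`. -/
inductive Exec {Q : Type} (coin : ℕ → Bool) (orc : Oracle Q) :
    Prog Q → Config Q → Config Q → ℕ → Prop
  | skip (c : Config Q) : Exec coin orc .skip c c 1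
  | op (o : Op) (c : Config Q) : Exec coin orc (.op o) c (o.apply c) (o.cost c)
  | flip (r : ℕ) (c : Config Q) :
      Exec coin orc (.flip r) c { c.setReg r [coin c.coins] with coins := c.coins + 1 } 1
  | query (q : Q) (x y : ℕ) (c : Config Q) :
      Exec coin orc (.query q x y) c
        { c.setReg y (orc c.log q (c.reg x)) with log := (q, c.reg x) :: c.log }
        (1 + (c.reg x).length + (orc c.log q (c.reg x)).length)
  | seq {p p' : Prog Q} {c c' c'' : Config Q} {n n' : ℕ} :
      Exec coin orc p c c' n → Exec coin orc p' c' c'' n' →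
      Exec coin orc (.seq p p') c c'' (n + n')
  | ifEq_true {r s : ℕ} {p p' : Prog Q} {c c' : Config Q} {n : ℕ} :
      c.reg r = c.reg s → Exec coin orc p c c' n →
      Exec coin orc (.ifEq r s p p') c c' (1 + min (c.reg r).length (c.reg s).length + n)
  | ifEq_false {r s : ℕ} {p p' : Prog Q} {c c' : Config Q} {n : ℕ} :
      c.reg r ≠ c.reg s → Exec coin orc p' c c' n →
      Exec coin orc (.ifEq r s p p') c c' (1 + min (c.reg r).length (c.reg s).length + n)
  | ifLt_true {r s : ℕ} {p p' : Prog Q} {c c' : Config Q} {n : ℕ} :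
      val (c.reg r) < val (c.reg s) → Exec coin orc p c c' n →
      Exec coin orc (.ifLt r s p p') c c' (1 + (c.reg r).length + (c.reg s).length + n)
  | ifLt_false {r s : ℕ} {p p' : Prog Q} {c c' : Config Q} {n : ℕ} :
      ¬ val (c.reg r) < val (c.reg s) → Exec coin orc p' c c' n →
      Exec coin orc (.ifLt r s p p') c c' (1 + (c.reg r).length + (c.reg s).length + n)
  | loop_done {r s : ℕ} {p : Prog Q} {c : Config Q} :
      c.reg r = c.reg s →
      Exec coin orc (.loop r s p) c c (1 + min (c.reg r).length (c.reg s).length)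
  | loop_step {r s : ℕ} {p : Prog Q} {c c' c'' : Config Q} {n n' : ℕ} :
      c.reg r ≠ c.reg s → Exec coin orc p c c' n → Exec coin orc (.loop r s p) c' c'' n' →
      Exec coin orc (.loop r s p) c c'' (1 + min (c.reg r).length (c.reg s).length + n + n')

/-- The start configuration with the given input in register `0`. -/
def Config.start (Q : Type) (input : Str) : Config Q where
  reg := Function.update (fun _ => []) 0 input
  mem := fun _ => []
  coins := 0
  log := []

/-- Program `p` on `input` has time complexity `t` (running time plus size of the description) and
its oracle calls obey the budget `B`. As usual, this is required in the worst case: for all random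
bits and for all oracle answers that have one of the admissible lengths `len`. -/
def Prog.Bounded {Q : Type} (p : Prog Q) (input : Str) (len : Q → ℕ → Prop) (t : ℕ)
    (B : List (Q × Str) → Prop) : Prop :=
  ∀ (coin : ℕ → Bool) (orc : Oracle Q), (∀ h q x, len q (orc h q x).length) →
    ∃ c n, Exec coin orc p (Config.start Q input) c n ∧ p.size + n ≤ t ∧ B c.log

/-! ### Randomness -/

/-- The law of a family of independent uniform bits. -/
noncomputable def fairBits (ι : Type) : Measure (ι → Bool) :=
  Measure.infinitePi fun _ => (PMF.uniformOfFintype Bool).toMeasure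

/-- The three hash functions `H 0`, `H 1`, `H 2`. -/
abbrev Hash := Fin 3 → Str → Str

/-! ### Parameters -/

/-- Hash values, keys and secret strings have `κ` bits; a HORS key has `T = 2 ^ τ` secret strings,
so `τ = log₂ T`, of which a signature reveals `k`. There are at most `J = J₁ J₂` signatures, `J₁`
being the number of key blocks kept by the commitment oracle and `J₂` their length. -/
structure Params where
  κ : ℕ
  τ : ℕ
  k : ℕ
  J₁ : ℕ
  J₂ : ℕ
  τ_pos : 0 < τ
  k_pos : 0 < k
  /-- a hash value is long enough to be split into `k` substrings of `τ` bits -/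
  k_mul_τ_le : k * τ ≤ κ

/-- The number `T` of secret strings of a HORS key. -/
def Params.T (P : Params) : ℕ := 2 ^ P.τ

/-- The maximum number of signatures. -/
def Params.J (P : Params) : ℕ := P.J₁ * P.J₂

/-- The time of one hash evaluation on a key together with an index: the `κ + τ` bits of the
question, the `κ` bits of the answer, and one unit for the call. -/
def Params.hashTime (P : Params) : ℕ := 1 + (P.κ + P.τ) + P.κ

/-- The indices `x₁, …, x_k < T` selected by a message: `H 0 M` is split into `k` substrings of
`τ` bits, which are read as numbers. -/
def msgIndices (P : Params) (H : Hash) (M : Str) : List ℕ :=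
  (blocks P.τ P.k (H 0 M)).map val

/-! ### HORS, with `H 2` as the one-way function -/

namespace HORS

/-- The public key `(v_i)` for the secret strings `(s_i)`, `i < T`. -/
def publicKey (P : Params) (H : Hash) (s : ℕ → Str) : List Str :=
  (List.range P.T).map fun i => H 2 (s i)

/-- Signing. -/
def sign (P : Params) (H : Hash) (s : ℕ → Str) (M : Str) : List Str :=
  (msgIndices P H M).map s

/-- Verification: `σ = (s'₁, …, s'_k)` and `H 2 (s'_l) = v_{x_l}` for all `l`. -/
def Ver (P : Params) (H : Hash) (pk : List Str) (M : Str) (σ : List Str) : Prop :=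
  σ.map (H 2) = (msgIndices P H M).map fun i => pk.getD i []

/-- Oracles of the EU-CMA experiment: the random oracles and the signing oracle. -/
inductive Query
  | ro (i : Fin 3)
  | sig
  deriving DecidableEq

/-- Names of the random bits of the experiment: bits of the random oracles, bits of the secret
strings `s_i` (for `i < T`), coins of the adversary. -/
inductive Bits (κ : ℕ)
  | ro (i : Fin 3) (x : Str) (b : Fin κ)
  | key (i : ℕ) (b : Fin κ)
  | coin (n : ℕ)

/-- Sample point of the experiment. -/
abbrev Sample (P : Params) := Bits P.κ → Bool

/-- The random oracles. -/
def hash {P : Params} (ω : Sample P) : Hash :=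
  fun i x => List.ofFn fun b : Fin P.κ => ω (.ro i x b)

/-- The secret key: `T` random strings of `κ` bits. -/
def secretKey {P : Params} (ω : Sample P) : ℕ → Str :=
  fun i => List.ofFn fun b : Fin P.κ => ω (.key i b)

/-- The oracles of the experiment. A signature is given as the concatenation of its components. -/
def oracle {P : Params} (ω : Sample P) : Oracle Query
  | _, .ro i, x => hash ω i x
  | _, .sig, M => (sign P (hash ω) (secretKey ω) M).flatten

/-- The lengths of oracle answers. -/
def AnswerLength (P : Params) : Query → ℕ → Prop
  | .ro _, n => n = P.κ
  | .sig, n => n = P.k * P.κ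

/-- At most `qs` signing queries and at most `qh` random oracle queries. -/
def Budget (qs qh : ℕ) (log : List (Query × Str)) : Prop :=
  log.countP (fun e => e.1 = .sig) ≤ qs ∧ log.countP (fun e => ∃ i, e.1 = .ro i) ≤ qh

/-- Adversaries with time complexity `t`, at most `qs` signing queries and `qh` random oracle
queries. Their input is the public key, a string of `T κ` bits. -/
def Admissible (P : Params) (t qs qh : ℕ) (F : Prog Query) : Prop :=
  ∀ pk : Str, pk.length = P.T * P.κ → F.Bounded pk (AnswerLength P) t (Budget qs qh)

/-- The adversary wins if it halts with a message `M` in register `0`, which it did not submit to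
the signing oracle, and a valid signature of `M` in register `1`. -/
def Wins (P : Params) (F : Prog Query) (ω : Sample P) : Prop :=
  let pk := publicKey P (hash ω) (secretKey ω)
  ∃ c n, Exec (fun i => ω (.coin i)) (oracle ω) F (Config.start Query pk.flatten) c n ∧
    (Query.sig, c.reg 0) ∉ c.log ∧
    (c.reg 1).length = P.k * P.κ ∧ Ver P (hash ω) pk (c.reg 0) (blocks P.κ P.k (c.reg 1))

/-- The EU-CMA advantage of one adversary. -/
noncomputable def advantage (P : Params) (F : Prog Query) : ℝ≥0∞ :=
  fairBits (Bits P.κ) {ω | Wins P F ω}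

/-- The EU-CMA advantage for given resources. -/
noncomputable def Adv (P : Params) (t qs qh : ℕ) : ℝ≥0∞ :=
  ⨆ (F : Prog Query) (_ : Admissible P t qs qh F), advantage P F

end HORS

/-! ### PQ-HASES -/

namespace Scheme

/-- The initial private key `sk₁` of a user. -/
def initialKey (H : Hash) (msk ID : Str) : Str := H 0 (msk ++ ID)

/-- The precomputed private key with index `j₁ J₂ + 1` of a user. -/
def precomputedKey (P : Params) (H : Hash) (msk ID : Str) : ℕ → Str
  | 0 => initialKey H msk ID
  | j₁ + 1 => (H 1)^[P.J₂] (precomputedKey P H msk ID j₁)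

/-- The update of the private key. -/
def update (H : Hash) (sk : Str) : Str := H 1 sk

/-- The one-time secret strings `s_i`, `i < T`, that belong to a private key. -/
def secrets (P : Params) (H : Hash) (sk : Str) (i : ℕ) : Str := H 1 (sk ++ enc P.τ i)

/-- The commitment `C_j` of a user for epoch `1 ≤ j ≤ J`, computed by the commitment oracle from
the master key and the precomputed keys. -/
def comConstr (P : Params) (H : Hash) (msk ID : Str) (j : ℕ) : List Str :=
  let j₁ := (j - 1) / P.J₂
  let j₂ := (j - 1) % P.J₂
  let sk := (H 1)^[j₂] (precomputedKey P H msk ID j₁)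
  (List.range P.T).map fun i => H 2 (secrets P H sk i)

/-- A signature: `k` secret strings, the epoch, the identity of the signer. -/
structure Signature where
  s : List Str
  epoch : ℕ
  id : Str

/-- Signing in epoch `j` with the private key `sk = sk_j`; returns the signature and the private key
of the next epoch. -/
def sign (P : Params) (H : Hash) (ID : Str) (j : ℕ) (sk M : Str) : Signature × Str :=
  (⟨(msgIndices P H M).map (secrets P H sk), j, ID⟩, update H sk)

/-- Verification, for the list `IDs` of registered identities. -/
def Ver (P : Params) (H : Hash) (msk : Str) (IDs : List Str) (M : Str) (σ : Signature) : Prop :=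
  σ.id ∈ IDs ∧ 1 ≤ σ.epoch ∧ σ.epoch ≤ P.J ∧
    σ.s.map (H 2) =
      (msgIndices P H M).map fun i => (comConstr P H msk σ.id σ.epoch).getD i []

/-- The private key `sk_{n+1}` that the signer holds after `n` signatures. -/
def signerKey (H : Hash) (msk ID : Str) (n : ℕ) : Str := (update H)^[n] (initialKey H msk ID)

/-- Oracles of the forward security experiment: random oracles, signing, commitment construct,
break-in. -/
inductive Query
  | ro (i : Fin 3)
  | sig
  | com
  | brk
  deriving DecidableEq

/-- Names of the random bits of the experiment: bits of the random oracles, bits of the master key,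
coins of the adversary. -/
inductive Bits (κ : ℕ)
  | ro (i : Fin 3) (x : Str) (b : Fin κ)
  | msk (b : Fin κ)
  | coin (n : ℕ)

/-- Sample point of the experiment. -/
abbrev Sample (P : Params) := Bits P.κ → Bool

/-- The random oracles. -/
def hash {P : Params} (ω : Sample P) : Hash :=
  fun i x => List.ofFn fun b : Fin P.κ => ω (.ro i x b)

/-- The master key. -/
def masterKey {P : Params} (ω : Sample P) : Str :=
  List.ofFn fun b : Fin P.κ => ω (.msk b)

/-- The number of signing queries among the given calls. -/
def sigCount (log : List (Query × Str)) : ℕ := log.countP fun e => e.1 = .sig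

/-- The oracles of the experiment against the user `ID`. A refused query is answered by the empty
string.
* Signing: the next epoch is used; refused after `J` signatures and after a break-in. The secret
  strings of the signature are given as one concatenated string; its other components, the epoch
  and `ID`, are known to the adversary.
* Commitment: the question is an epoch, written in binary; refused unless it lies in `[1, J]`.
* Break-in: the current private key, `sk_{n+1}` after `n` signatures; refused if `n ≥ J`. -/
def oracle {P : Params} (ID : Str) (ω : Sample P) : Oracle Query
  | _, .ro i, x => hash ω i x
  | log, .sig, M =>
      if sigCount log < P.J ∧ ∀ e ∈ log, e.1 ≠ .brk then
        let n := sigCount log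
        (sign P (hash ω) ID (n + 1) (signerKey (hash ω) (masterKey ω) ID n) M).1.s.flatten
      else []
  | _, .com, j =>
      if 1 ≤ val j ∧ val j ≤ P.J then
        (comConstr P (hash ω) (masterKey ω) ID (val j)).flatten
      else []
  | log, .brk, _ =>
      if sigCount log < P.J then signerKey (hash ω) (masterKey ω) ID (sigCount log) else []

/-- The lengths of oracle answers. -/
def AnswerLength (P : Params) : Query → ℕ → Prop
  | .ro _, n => n = P.κ
  | .sig, n => n = P.k * P.κ ∨ n = 0
  | .com, n => n = P.T * P.κ ∨ n = 0
  | .brk, n => n = P.κ ∨ n = 0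

/-- At most `qs` signing and commitment queries, `qh` random oracle queries and `qb` break-in
queries. -/
def Budget (qs qh qb : ℕ) (log : List (Query × Str)) : Prop :=
  log.countP (fun e => e.1 = .sig ∨ e.1 = .com) ≤ qs ∧
  log.countP (fun e => ∃ i, e.1 = .ro i) ≤ qh ∧
  log.countP (fun e => e.1 = .brk) ≤ qb

/-- Adversaries with time complexity `t` and the given numbers of queries. -/
def Admissible (P : Params) (t qs qh qb : ℕ) (A : Prog Query) : Prop :=
  A.Bounded [] (AnswerLength P) t (Budget qs qh qb)

/-- The private key of epoch `j` was revealed by, or follows in the key chain a key revealed by, a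
break-in: the break-in came after fewer than `j` signing queries. -/
def Exposed (log : List (Query × Str)) (j : ℕ) : Prop :=
  ∃ later x earlier, log = later ++ (Query.brk, x) :: earlier ∧ sigCount earlier < j

/-- The adversary against the user `ID` wins if it halts with a message `M` in register `0`, which
it did not submit to the signing oracle, and a valid signature of `M` by `ID`, for an epoch whose
private key is not exposed: its secret strings in register `1`, its epoch, in binary, in register
`2`. -/
def Wins (P : Params) (IDs : List Str) (ID : Str) (A : Prog Query) (ω : Sample P) : Prop :=
  ∃ c n, Exec (fun i => ω (.coin i)) (oracle ID ω) A (Config.start Query []) c n ∧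
    (Query.sig, c.reg 0) ∉ c.log ∧
    ¬ Exposed c.log (val (c.reg 2)) ∧
    (c.reg 1).length = P.k * P.κ ∧
    Ver P (hash ω) (masterKey ω) IDs (c.reg 0)
      ⟨blocks P.κ P.k (c.reg 1), val (c.reg 2), ID⟩

/-- The F-EU-CMA advantage of one adversary against the user `ID`. -/
noncomputable def advantage (P : Params) (IDs : List Str) (ID : Str) (A : Prog Query) : ℝ≥0∞ :=
  fairBits (Bits P.κ) {ω | Wins P IDs ID A ω}

/-- The F-EU-CMA advantage for given resources; the adversary chooses the user it attacks. -/
noncomputable def Adv (P : Params) (IDs : List Str) (t qs qh qb : ℕ) : ℝ≥0∞ :=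
  ⨆ (ID : Str) (_ : ID ∈ IDs) (A : Prog Query) (_ : Admissible P t qs qh qb A),
    advantage P IDs ID A

end Scheme

end PQHases

namespace PQHases

/-! ### Fair bits -/

/-! Fix the epoch `j` in which the forgery will lie. The HORS adversary `reduction P j A` runs `A`
and plays its oracles: the commitment of epoch `j` is the given HORS public key, and the `j`-th
signing query is passed to the HORS signing oracle. All other private keys and secret strings are
sampled on first use, together with their images under `H 2`, and the random oracles are answered so
as to fit them. The keys `sk_1, …, sk_j` are never sampled: the adversary could learn them only by
guessing or by a break-in that exposes epoch `j`, and a run with such a break-in does not win at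
`j`. The signature counter passes `j` at most once, so at most one HORS signature is requested.

Probabilities are compared through an intermediate space, `NamedBit`, in which every sampled string
has bits of its own, named by the address of the string. Three comparisons are made. (a) In the real
experiment the strings are random oracle values along the key chain. If they are pairwise distinct,
so are the questions that produce them, and moving bits from questions to addresses is an injective
renaming. The renaming depends on the sample point but can be recovered from the result, so it does
not increase probabilities (`fairBits_relabel`, used in `winsAt_le_program`). (b) For the same named
bits the simulated and the real run coincide, unless a string was asked before it was sampled, or
the master key occurred in an oracle call, or epoch `j` was exposed, or there were two break-ins
(`simulation`). If they coincide, the forgery is valid for HORS, up to collisions of images and a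
use of the master key in the forged message (`namedWins_of_winsAt`). (c) The reduction has a tape of
coins instead of named bits; given the history of events, one is an injective renaming of the other
(`namedWins_le_advantage`).

Each bad event is a union of events in which `κ` fair bits hit a short list that does not depend on
them, so `fairBits_block_mem_le` and a union bound give the error term (`winsAt_le_advantage`). A
sum over the epochs and the choice of the best `j` give the factor `J`.

For the resources, every step of `A` is compiled into a program whose cost is at most a constant
times the cost of the step (`compile_runs`); in particular an oracle answer is simulated in time
proportional to the lengths of question and answer. The worst-case bound on `A` applies in the
simulation because a stateful environment can be replayed as an ordinary oracle
(`Prog.Bounded.exists_envExec`). Measurability comes from local constancy: a halting run reads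
finitely many bits. -/

instance instIsProbabilityMeasureFairBits (ι : Type) : IsProbabilityMeasure (fairBits ι) := by
  unfold fairBits; infer_instance

/-- A product measure is determined by its values on finite boxes, and the preimage of such a box
under an injective reindexing is again a finite box with the same factors. -/
theorem fairBits_map_comp {ι ι' : Type} (f : ι' → ι) (hf : f.Injective) :
    (fairBits ι).map (fun ω => ω ∘ f) = fairBits ι' := by
  refine Measure.eq_infinitePi _ fun s t ht => ?_
  have hm : Measurable fun ω : ι → Bool => ω ∘ f := by
    rw [measurable_pi_iff]; intro i; exact measurable_pi_apply (f i)
  rw [Measure.map_apply hm (.pi s.countable_toSet fun i _ => ht i)]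
  classical
  rcases isEmpty_or_nonempty ι' with h | h
  · have : s = ∅ := Finset.eq_empty_of_isEmpty s
    subst this
    simp
  -- `Function.invFun f` finds the coordinate of `ι'` that belongs to a coordinate in the range of
  -- `f`; it needs `ι'` nonempty, hence the preceding case split.
  have : (fun ω : ι → Bool => ω ∘ f) ⁻¹' (Set.pi s t) =
      Set.pi (s.map ⟨f, hf⟩ : Finset ι) fun i => t (Function.invFun f i) := by
    ext ω
    simp [Set.mem_pi, Function.leftInverse_invFun hf _]
  rw [this, fairBits, Measure.infinitePi_pi _ (fun i _ => ht _)]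
  simp [Function.leftInverse_invFun hf _]

/-- Only an inequality, because `B` need not be measurable and its value is then an outer measure.
In this way winning events can be compared without showing all of them measurable. -/
theorem fairBits_preimage_comp_le {ι ι' : Type} (f : ι' → ι) (hf : f.Injective)
    (B : Set (ι' → Bool)) : fairBits ι {ω | ω ∘ f ∈ B} ≤ fairBits ι' B := by
  have hm : Measurable fun ω : ι → Bool => ω ∘ f := by
    rw [measurable_pi_iff]; intro i; exact measurable_pi_apply (f i)
  rw [← fairBits_map_comp f hf]
  exact Measure.le_map_apply hm.aemeasurable B

/-- Reading the bits of a sample point under other names, where the renaming may depend on the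
sample point in a way that can be recovered from the result, does not increase probabilities. -/
theorem fairBits_relabel {ι ι' K : Type} [Countable K] (e : K → ι' → ι) (k : (ι → Bool) → K)
    (k' : (ι' → Bool) → K) (hk' : ∀ a, MeasurableSet {ω | k' ω = a})
    (A : Set (ι → Bool)) (B : Set (ι' → Bool)) (he : ∀ ω ∈ A, (e (k ω)).Injective)
    (hB : ∀ ω ∈ A, ω ∘ e (k ω) ∈ B) (hk : ∀ ω ∈ A, k' (ω ∘ e (k ω)) = k ω) :
    fairBits ι A ≤ fairBits ι' B := by
  -- Split `A` by the value of `k`. On one piece the renaming is a fixed injection, and the piece is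
  -- sent into `B ∩ {k' = a}`. These targets are disjoint for different `a`, so their measures add
  -- up to at most that of `B`.
  have h1 : A ⊆ ⋃ a, {ω | ω ∈ A ∧ k ω = a} := fun ω hω => Set.mem_iUnion.2 ⟨k ω, hω, rfl⟩
  have h2 : ∀ a, fairBits ι {ω | ω ∈ A ∧ k ω = a} ≤
      ((fairBits ι').restrict B) {ω | k' ω = a} := by
    intro a
    rw [Measure.restrict_apply (hk' a)]
    by_cases hne : ∃ ω ∈ A, k ω = a
    · obtain ⟨ω₀, hω₀, rfl⟩ := hne
      refine le_trans (measure_mono ?_) (fairBits_preimage_comp_le _ (he ω₀ hω₀) _)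
      rintro ω ⟨hω, hkω⟩
      refine ⟨?_, ?_⟩
      · rw [← hkω]; exact hk ω hω
      · rw [← hkω]; exact hB ω hω
    · have : {ω | ω ∈ A ∧ k ω = a} = ∅ := by
        ext ω; simp only [Set.mem_ofPred_eq, Set.mem_empty_iff_false, iff_false]
        rintro ⟨h, h'⟩; exact hne ⟨ω, h, h'⟩
      rw [this, measure_empty]; exact zero_le
  calc fairBits ι A ≤ ∑' a, fairBits ι {ω | ω ∈ A ∧ k ω = a} :=
        (measure_mono h1).trans (measure_iUnion_le _)
    _ ≤ ∑' a, ((fairBits ι').restrict B) {ω | k' ω = a} := ENNReal.tsum_le_tsum h2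
    _ = ((fairBits ι').restrict B) (⋃ a, {ω | k' ω = a}) := by
        rw [measure_iUnion _ hk']
        intro a b hab
        refine Set.disjoint_left.2 fun ω h h' => hab ?_
        exact h.symm.trans h'
    _ ≤ ((fairBits ι').restrict B) Set.univ := measure_mono (Set.subset_univ _)
    _ = fairBits ι' B := by rw [Measure.restrict_apply_univ]

/-- Flipping a fixed set of coins exchanges equally likely values in each factor of the product. -/
theorem fairBits_map_xor {ι : Type} (m : ι → Bool) :
    (fairBits ι).map (fun ω i => xor (ω i) (m i)) = fairBits ι := by
  unfold fairBits
  rw [Measure.infinitePi_map_pi (fun _ : ι => (PMF.uniformOfFintype Bool).toMeasure)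
    (f := fun i b => xor b (m i))]
  · congr 1; funext i
    refine Measure.ext_of_singleton fun b => ?_
    rw [Measure.map_apply (measurable_of_countable _) (measurableSet_singleton b)]
    have : (fun b => xor b (m i)) ⁻¹' {b} = {xor b (m i)} := by
      ext c; cases b <;> cases c <;> cases m i <;> simp
    rw [this, PMF.toMeasure_apply_singleton _ _ (measurableSet_singleton _),
      PMF.toMeasure_apply_singleton _ _ (measurableSet_singleton _)]
    simp
  · intro i; exact measurable_of_countable _

/-- A string of `n` fair bits lies in a list of at most `N` strings that does not depend on these
bits with probability at most `N / 2 ^ n`. -/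
theorem fairBits_block_mem_le {ι : Type} {n : ℕ} (p : Fin n → ι) (hp : p.Injective)
    (f : (ι → Bool) → List Str) (N : ℕ) (hN : ∀ ω, (f ω).length ≤ N)
    (hf : ∀ ω ω', (∀ i, (∀ b, i ≠ p b) → ω i = ω' i) → f ω = f ω')
    (hm : MeasurableSet {ω | List.ofFn (fun b => ω (p b)) ∈ f ω}) :
    fairBits ι {ω | List.ofFn (fun b => ω (p b)) ∈ f ω} ≤ N / 2 ^ n := by
  classical
  set B := {ω : ι → Bool | List.ofFn (fun b => ω (p b)) ∈ f ω} with hB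
  -- Average over the `2 ^ n` masks that flip bits of the block only. Every mask preserves the law
  -- and the list `f`; for a fixed sample point different masks give different blocks, so at most
  -- `N` masks put the block into the list.
  let mask : (Fin n → Bool) → ι → Bool := fun u i => if h : ∃ b, p b = i then u h.choose else false
  have hmask : ∀ u b, mask u (p b) = u b := by
    intro u b
    have h : ∃ b', p b' = p b := ⟨b, rfl⟩
    simp only [mask, dif_pos h]
    rw [hp h.choose_spec]
  have hmask' : ∀ u i, (∀ b, i ≠ p b) → mask u i = false := by
    intro u i hi
    have h : ¬ ∃ b', p b' = i := by rintro ⟨b, rfl⟩; exact hi b rfl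
    simp only [mask, dif_neg h]
  let τ : (Fin n → Bool) → (ι → Bool) → ι → Bool := fun u ω i => xor (ω i) (mask u i)
  have hτm : ∀ u, Measurable (τ u) := by
    intro u; rw [measurable_pi_iff]; intro i
    exact (measurable_of_countable (fun b => xor b (mask u i))).comp (measurable_pi_apply i)
  have hτ : ∀ u, fairBits ι (τ u ⁻¹' B) = fairBits ι B := by
    intro u
    rw [← Measure.map_apply (hτm u) hm]
    exact congrArg (fun μ : Measure (ι → Bool) => μ B) (fairBits_map_xor (mask u))
  have hsum : ∑ u : Fin n → Bool, fairBits ι (τ u ⁻¹' B) ≤ N := by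
    calc ∑ u : Fin n → Bool, fairBits ι (τ u ⁻¹' B)
        = ∑ u : Fin n → Bool, ∫⁻ ω, (τ u ⁻¹' B).indicator 1 ω ∂(fairBits ι) := by
          refine Finset.sum_congr rfl fun u _ => ?_
          rw [lintegral_indicator_one ((hτm u) hm)]
      _ = ∫⁻ ω, ∑ u : Fin n → Bool, (τ u ⁻¹' B).indicator 1 ω ∂(fairBits ι) := by
          rw [lintegral_finsetSum]
          intro u _
          exact (measurable_one.indicator ((hτm u) hm))
      _ ≤ ∫⁻ ω, (N : ℝ≥0∞) ∂(fairBits ι) := by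
          refine lintegral_mono fun ω => ?_
          have h1 : ∑ u : Fin n → Bool, (τ u ⁻¹' B).indicator (1 : (ι → Bool) → ℝ≥0∞) ω =
              ((Finset.univ.filter fun u => τ u ω ∈ B).card : ℝ≥0∞) := by
            rw [Finset.card_filter]
            push_cast
            refine Finset.sum_congr rfl fun u _ => ?_
            simp [Set.indicator_apply]
          rw [h1]
          have h2 : (Finset.univ.filter fun u => τ u ω ∈ B).card ≤ (f ω).toFinset.card := by
            refine Finset.card_le_card_of_injOn
              (fun u => List.ofFn fun b => xor (ω (p b)) (u b)) ?_ ?_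
            · intro u hu
              simp only [Finset.coe_filter, Finset.mem_univ, true_and, Set.mem_ofPred_eq, hB] at hu
              have hfe : f (τ u ω) = f ω := by
                refine hf _ _ fun i hi => ?_
                simp [τ, hmask' u i hi]
              rw [hfe] at hu
              simp only [τ, hmask] at hu
              simpa using hu
            · intro u _ v _ huv
              have := List.ofFn_injective huv
              funext b
              have hb := congrFun this b
              simpa using hb
          exact Nat.cast_le.2 (h2.trans ((List.toFinset_card_le _).trans (hN ω)))
      _ = N := by simp
  simp only [hτ, Finset.sum_const, Finset.card_univ, Fintype.card_fun, Fintype.card_bool,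
    Fintype.card_fin, nsmul_eq_mul] at hsum
  rw [ENNReal.le_div_iff_mul_le (by simp) (by simp), mul_comm]
  exact_mod_cast hsum

/-! ### Numbers and bit strings -/

@[simp] theorem length_enc (n i : ℕ) : (enc n i).length = n := by simp [enc]

@[simp] theorem enc_zero_left (i : ℕ) : enc 0 i = [] := rfl

theorem enc_succ (n i : ℕ) : enc (n + 1) i = (i.testBit 0) :: enc n (i / 2) := by
  simp [enc, List.ofFn_succ, Nat.testBit_succ]

theorem enc_zero (n : ℕ) : enc n 0 = List.replicate n false := by
  induction n with
  | zero => rfl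
  | succ n ih => rw [enc_succ]; simp [ih, List.replicate_succ]

theorem val_lt (x : Str) : val x < 2 ^ x.length := by
  induction x with
  | nil => simp [val]
  | cons b x ih =>
    rw [val, List.length_cons, pow_succ]
    have := Bool.toNat_le b
    omega

theorem val_enc (n i : ℕ) (h : i < 2 ^ n) : val (enc n i) = i := by
  induction n generalizing i with
  | zero => simp at h; simp [h, val]
  | succ n ih =>
    rw [enc_succ, val, ih _ (by rw [pow_succ] at h; omega)]
    rw [Nat.testBit_zero]
    rcases Nat.mod_two_eq_zero_or_one i with h | h <;> simp [h] <;> omega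

/-- Zeros appended on the most significant side, and bits cut off beyond position `n`, do not change
a number below `2 ^ n`. The reduction brings an epoch written by the adversary to the fixed length
of a code in this way. -/
theorem enc_val_append (x : Str) (n : ℕ) (h : val x < 2 ^ n) :
    (x ++ List.replicate n false).take n = enc n (val x) := by
  induction n generalizing x with
  | zero => simp
  | succ n ih =>
    cases x with
    | nil => simp [val, enc_zero]
    | cons b x =>
      rw [val] at h ⊢
      have h1 : (b.toNat + 2 * val x) / 2 = val x := by have := Bool.toNat_lt b; omega
      rw [enc_succ, h1, ← ih x (by rw [pow_succ] at h; omega), List.cons_append, List.take_succ_cons]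
      congr 1
      · rw [Nat.testBit_zero]; cases b <;> simp
      · rw [List.replicate_succ', ← List.append_assoc, List.take_append_of_le_length]
        simp

theorem enc_val (x : Str) : enc x.length (val x) = x := by
  rw [← enc_val_append _ _ (val_lt x), List.take_append_of_le_length le_rfl, List.take_length]

theorem enc_inj {n i j : ℕ} (hi : i < 2 ^ n) (hj : j < 2 ^ n) (h : enc n i = enc n j) : i = j := by
  rw [← val_enc n i hi, h, val_enc n j hj]

theorem incr_enc (n i : ℕ) (h : i + 1 < 2 ^ n) : incr (enc n i) = enc n (i + 1) := by
  induction n generalizing i with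
  | zero => simp at h
  | succ n ih =>
    rw [enc_succ, enc_succ, Nat.testBit_zero, Nat.testBit_zero]
    rcases Nat.mod_two_eq_zero_or_one i with h' | h'
    · have : (i + 1) % 2 = 1 := by omega
      have h2 : (i + 1) / 2 = i / 2 := by omega
      simp [h', this, h2, incr]
    · have : (i + 1) % 2 = 0 := by omega
      have h2 : (i + 1) / 2 = i / 2 + 1 := by omega
      simp [h', this, h2, incr, ih (i / 2) (by rw [pow_succ] at h; omega)]

/-- Overflow of the counter. The loop over the `T` indices recognises its end by this string of `n +
1` bits. -/
theorem incr_enc_last (n i : ℕ) (h : i + 1 = 2 ^ n) :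
    incr (enc n i) = List.replicate n false ++ [true] := by
  induction n generalizing i with
  | zero => simp [incr]
  | succ n ih =>
    rw [pow_succ] at h
    rw [enc_succ, Nat.testBit_zero]
    have : i % 2 = 1 := by omega
    simp [this, incr, ih (i / 2) (by omega), List.replicate_succ]

theorem length_incr_le (x : Str) : (incr x).length ≤ x.length + 1 := by
  induction x with
  | nil => simp [incr]
  | cons b x ih => cases b <;> simp [incr, ih]

/-! ### Determinism of the machine -/

theorem Exec.det {Q : Type} {coin : ℕ → Bool} {orc : Oracle Q} {p : Prog Q} {c c₁ c₂ : Config Q}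
    {n₁ n₂ : ℕ} (h₁ : Exec coin orc p c c₁ n₁) (h₂ : Exec coin orc p c c₂ n₂) :
    c₁ = c₂ ∧ n₁ = n₂ := by
  induction h₁ generalizing c₂ n₂ with
  | skip | op | flip | query => cases h₂; exact ⟨rfl, rfl⟩
  | seq _ _ ih ih' =>
    cases h₂ with
    | seq a b =>
      obtain ⟨rfl, rfl⟩ := ih a
      obtain ⟨rfl, rfl⟩ := ih' b
      exact ⟨rfl, rfl⟩
  | ifEq_true hc _ ih | ifEq_false hc _ ih =>
    cases h₂ with
    | ifEq_true hc' a | ifEq_false hc' a =>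
      first
      | (obtain ⟨rfl, rfl⟩ := ih a; exact ⟨rfl, rfl⟩)
      | exact absurd hc hc'
      | exact absurd hc' hc
  | ifLt_true hc _ ih | ifLt_false hc _ ih =>
    cases h₂ with
    | ifLt_true hc' a | ifLt_false hc' a =>
      first
      | (obtain ⟨rfl, rfl⟩ := ih a; exact ⟨rfl, rfl⟩)
      | exact absurd hc hc'
      | exact absurd hc' hc
  | loop_done hc =>
    cases h₂ with
    | loop_done => exact ⟨rfl, rfl⟩
    | loop_step hc' => exact absurd hc hc'
  | loop_step hc _ _ ih ih' =>
    cases h₂ with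
    | loop_done hc' => exact absurd hc' hc
    | loop_step _ a b =>
      obtain ⟨rfl, rfl⟩ := ih a
      obtain ⟨rfl, rfl⟩ := ih' b
      exact ⟨rfl, rfl⟩

/-! ### Programs in a stateful environment -/

/-- A stateful environment that answers the coin flips and the oracle calls of a program. -/
structure Env (Q E : Type) where
  flip : ℕ → E → Bool × E
  query : Q → Str → E → Str × E

/-- Execution of a program in an environment. -/
inductive EnvExec {Q E : Type} (env : Env Q E) :
    Prog Q → Config Q → E → Config Q → E → ℕ → Prop
  | skip (c : Config Q) (e : E) : EnvExec env .skip c e c e 1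
  | op (o : Op) (c : Config Q) (e : E) : EnvExec env (.op o) c e (o.apply c) e (o.cost c)
  | flip (r : ℕ) (c : Config Q) (e : E) :
      EnvExec env (.flip r) c e
        { c.setReg r [(env.flip c.coins e).1] with coins := c.coins + 1 } (env.flip c.coins e).2 1
  | query (q : Q) (x y : ℕ) (c : Config Q) (e : E) :
      EnvExec env (.query q x y) c e
        { c.setReg y (env.query q (c.reg x) e).1 with log := (q, c.reg x) :: c.log }
        (env.query q (c.reg x) e).2
        (1 + (c.reg x).length + (env.query q (c.reg x) e).1.length)
  | seq {p p' : Prog Q} {c c' c'' : Config Q} {e e' e'' : E} {n n' : ℕ} :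
      EnvExec env p c e c' e' n → EnvExec env p' c' e' c'' e'' n' →
      EnvExec env (.seq p p') c e c'' e'' (n + n')
  | ifEq_true {r s : ℕ} {p p' : Prog Q} {c c' : Config Q} {e e' : E} {n : ℕ} :
      c.reg r = c.reg s → EnvExec env p c e c' e' n →
      EnvExec env (.ifEq r s p p') c e c' e' (1 + min (c.reg r).length (c.reg s).length + n)
  | ifEq_false {r s : ℕ} {p p' : Prog Q} {c c' : Config Q} {e e' : E} {n : ℕ} :
      c.reg r ≠ c.reg s → EnvExec env p' c e c' e' n →
      EnvExec env (.ifEq r s p p') c e c' e' (1 + min (c.reg r).length (c.reg s).length + n)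
  | ifLt_true {r s : ℕ} {p p' : Prog Q} {c c' : Config Q} {e e' : E} {n : ℕ} :
      val (c.reg r) < val (c.reg s) → EnvExec env p c e c' e' n →
      EnvExec env (.ifLt r s p p') c e c' e' (1 + (c.reg r).length + (c.reg s).length + n)
  | ifLt_false {r s : ℕ} {p p' : Prog Q} {c c' : Config Q} {e e' : E} {n : ℕ} :
      ¬ val (c.reg r) < val (c.reg s) → EnvExec env p' c e c' e' n →
      EnvExec env (.ifLt r s p p') c e c' e' (1 + (c.reg r).length + (c.reg s).length + n)
  | loop_done {r s : ℕ} {p : Prog Q} {c : Config Q} {e : E} :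
      c.reg r = c.reg s →
      EnvExec env (.loop r s p) c e c e (1 + min (c.reg r).length (c.reg s).length)
  | loop_step {r s : ℕ} {p : Prog Q} {c c' c'' : Config Q} {e e' e'' : E} {n n' : ℕ} :
      c.reg r ≠ c.reg s → EnvExec env p c e c' e' n → EnvExec env (.loop r s p) c' e' c'' e'' n' →
      EnvExec env (.loop r s p) c e c'' e''
        (1 + min (c.reg r).length (c.reg s).length + n + n')

/-- A relation that is preserved by operations, coin flips and queries is preserved by programs. -/
theorem EnvExec.rel {Q E : Type} {env : Env Q E} {R : Config Q → E → Config Q → E → Prop}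
    (hrefl : ∀ c e, R c e c e)
    (htrans : ∀ {c e c' e' c'' e''}, R c e c' e' → R c' e' c'' e'' → R c e c'' e'')
    (hop : ∀ (o : Op) c e, R c e (o.apply c) e)
    (hflip : ∀ r c e, R c e { c.setReg r [(env.flip c.coins e).1] with coins := c.coins + 1 }
      (env.flip c.coins e).2)
    (hquery : ∀ q x y c e, R c e
      { c.setReg y (env.query q (c.reg x) e).1 with log := (q, c.reg x) :: c.log }
        (env.query q (c.reg x) e).2)
    {p : Prog Q} {c c' : Config Q} {e e' : E} {n : ℕ} (h : EnvExec env p c e c' e' n) :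
    R c e c' e' := by
  induction h with
  | skip | loop_done => exact hrefl _ _
  | op => exact hop _ _ _
  | flip => exact hflip _ _ _
  | query => exact hquery _ _ _ _ _
  | seq _ _ ih ih' => exact htrans ih ih'
  | ifEq_true _ _ ih | ifEq_false _ _ ih | ifLt_true _ _ ih | ifLt_false _ _ ih => exact ih
  | loop_step _ _ _ ih ih' => exact htrans ih ih'

/-- An invariant of configurations and environments. -/
theorem EnvExec.inv {Q E : Type} {env : Env Q E} {R : Config Q → E → Prop}
    (hop : ∀ (o : Op) c e, R c e → R (o.apply c) e)
    (hflip : ∀ r c e, R c e → R { c.setReg r [(env.flip c.coins e).1] with coins := c.coins + 1 }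
      (env.flip c.coins e).2)
    (hquery : ∀ q x y c e, R c e → R
      { c.setReg y (env.query q (c.reg x) e).1 with log := (q, c.reg x) :: c.log }
        (env.query q (c.reg x) e).2)
    {p : Prog Q} {c c' : Config Q} {e e' : E} {n : ℕ} (h : EnvExec env p c e c' e' n) :
    R c e → R c' e' :=
  EnvExec.rel (R := fun c e c' e' => R c e → R c' e') (fun _ _ h => h) (fun h h' x => h' (h x))
    hop hflip hquery h

/-- Two environments with a relation `R` between their states that is preserved until a relation `D`
holds, which says that the states have diverged. -/
theorem EnvExec.couple {Q E F : Type} {env₁ : Env Q E} {env₂ : Env Q F} {R D : E → F → Prop}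
    (hflip : ∀ i e f, R e f → ((env₁.flip i e).1 = (env₂.flip i f).1 ∧
      R (env₁.flip i e).2 (env₂.flip i f).2) ∨ D (env₁.flip i e).2 (env₂.flip i f).2)
    (hquery : ∀ q x e f, R e f → ((env₁.query q x e).1 = (env₂.query q x f).1 ∧
      R (env₁.query q x e).2 (env₂.query q x f).2) ∨ D (env₁.query q x e).2 (env₂.query q x f).2)
    (hl : ∀ {p c e c' e' n f}, EnvExec env₁ p c e c' e' n → D e f → D e' f)
    (hr : ∀ {p c e c' e' n f}, EnvExec env₂ p c e c' e' n → D f e → D f e')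
    {p : Prog Q} {c c₁ c₂ : Config Q} {e e₁ : E} {f f₂ : F} {n₁ n₂ : ℕ}
    (h₁ : EnvExec env₁ p c e c₁ e₁ n₁) (h₂ : EnvExec env₂ p c f c₂ f₂ n₂) (hR : R e f) :
    (c₁ = c₂ ∧ n₁ = n₂ ∧ R e₁ f₂) ∨ D e₁ f₂ := by
  induction h₁ generalizing c₂ f f₂ n₂ with
  | skip | op => cases h₂; exact .inl ⟨rfl, rfl, hR⟩
  | flip r c e =>
    cases h₂
    rcases hflip c.coins e f hR with ⟨h, h'⟩ | h
    · exact .inl ⟨by rw [h], rfl, h'⟩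
    · exact .inr h
  | query q x y c e =>
    cases h₂
    rcases hquery q (c.reg x) e f hR with ⟨h, h'⟩ | h
    · exact .inl ⟨by rw [h], by rw [h], h'⟩
    · exact .inr h
  | seq _ h₁' ih ih' =>
    cases h₂ with
    | seq a b =>
      rcases ih a hR with ⟨rfl, rfl, h⟩ | h
      · rcases ih' b h with ⟨rfl, rfl, h⟩ | h
        · exact .inl ⟨rfl, rfl, h⟩
        · exact .inr h
      -- After a divergence the remaining runs are unrelated; `D` survives each of them separately.
      · exact .inr (hl h₁' (hr b h))
  | ifEq_true hc _ ih | ifEq_false hc _ ih =>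
    cases h₂ with
    | ifEq_true hc' a | ifEq_false hc' a =>
      first
      | exact absurd hc hc'
      | exact absurd hc' hc
      | (rcases ih a hR with ⟨rfl, rfl, h⟩ | h
         · exact .inl ⟨rfl, rfl, h⟩
         · exact .inr h)
  | ifLt_true hc _ ih | ifLt_false hc _ ih =>
    cases h₂ with
    | ifLt_true hc' a | ifLt_false hc' a =>
      first
      | exact absurd hc hc'
      | exact absurd hc' hc
      | (rcases ih a hR with ⟨rfl, rfl, h⟩ | h
         · exact .inl ⟨rfl, rfl, h⟩
         · exact .inr h)
  | loop_done hc =>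
    cases h₂ with
    | loop_done => exact .inl ⟨rfl, rfl, hR⟩
    | loop_step hc' => exact absurd hc hc'
  | loop_step hc _ h₁' ih ih' =>
    cases h₂ with
    | loop_done hc' => exact absurd hc' hc
    | loop_step _ a b =>
      rcases ih a hR with ⟨rfl, rfl, h⟩ | h
      · rcases ih' b h with ⟨rfl, rfl, h⟩ | h
        · exact .inl ⟨rfl, rfl, h⟩
        · exact .inr h
      · exact .inr (hl h₁' (hr b h))

/-- The environment of the oracles of an experiment; its state is the list of calls. -/
def oracleEnv {Q : Type} (coin : ℕ → Bool) (orc : Oracle Q) : Env Q (List (Q × Str)) where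
  flip i l := (coin i, l)
  query q x l := (orc l q x, (q, x) :: l)

/-- The answers of an experiment depend on nothing but the earlier calls, so it is a stateful
environment too, and can be coupled with the simulator. -/
theorem Exec.envExec {Q : Type} {coin : ℕ → Bool} {orc : Oracle Q} {p : Prog Q} {c c' : Config Q}
    {n : ℕ} (h : Exec coin orc p c c' n) :
    EnvExec (oracleEnv coin orc) p c c.log c' c'.log n := by
  induction h with
  | skip => exact .skip _ _
  | op o c =>
    have : (o.apply c).log = c.log := by cases o <;> rfl
    rw [this]; exact .op _ _ _
  | flip r c => exact .flip (env := oracleEnv coin orc) r c c.log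
  | query q x y c => exact .query (env := oracleEnv coin orc) q x y c c.log
  | seq _ _ ih ih' => exact .seq ih ih'
  | ifEq_true h _ ih => exact .ifEq_true h ih
  | ifEq_false h _ ih => exact .ifEq_false h ih
  | ifLt_true h _ ih => exact .ifLt_true h ih
  | ifLt_false h _ ih => exact .ifLt_false h ih
  | loop_done h => exact .loop_done h
  | loop_step h _ _ ih ih' => exact .loop_step h ih ih'

/-! Small steps, with the programs that remain to be executed on a stack. -/

open Classical in
/-- One step of a program in an environment. -/
noncomputable def envStep {Q E : Type} (env : Env Q E) :
    List (Prog Q) × Config Q × E → List (Prog Q) × Config Q × E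
  | ([], c, e) => ([], c, e)
  | (.skip :: K, c, e) => (K, c, e)
  | (.op o :: K, c, e) => (K, o.apply c, e)
  | (.flip r :: K, c, e) =>
      (K, { c.setReg r [(env.flip c.coins e).1] with coins := c.coins + 1 },
        (env.flip c.coins e).2)
  | (.query q x y :: K, c, e) =>
      (K, { c.setReg y (env.query q (c.reg x) e).1 with log := (q, c.reg x) :: c.log },
        (env.query q (c.reg x) e).2)
  | (.seq p p' :: K, c, e) => (p :: p' :: K, c, e)
  | (.ifEq r s p p' :: K, c, e) => if c.reg r = c.reg s then (p :: K, c, e) else (p' :: K, c, e)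
  | (.ifLt r s p p' :: K, c, e) =>
      if val (c.reg r) < val (c.reg s) then (p :: K, c, e) else (p' :: K, c, e)
  | (.loop r s p :: K, c, e) =>
      if c.reg r = c.reg s then (K, c, e) else (p :: .loop r s p :: K, c, e)

theorem Op.apply_coins_log {Q : Type} (o : Op) (c : Config Q) :
    (o.apply c).coins = c.coins ∧ (o.apply c).log = c.log := by
  cases o <;> exact ⟨rfl, rfl⟩

theorem envStep_mono {Q E : Type} (env : Env Q E) (s : List (Prog Q) × Config Q × E) :
    s.2.1.coins ≤ (envStep env s).2.1.coins ∧
      s.2.1.log.length ≤ (envStep env s).2.1.log.length := by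
  obtain ⟨K, c, e⟩ := s
  rcases K with _ | ⟨p, K⟩
  · simp [envStep]
  · cases p with
    | op o => simp [envStep, Op.apply_coins_log]
    | ifEq | ifLt | loop => simp only [envStep]; split_ifs <;> simp
    | _ => simp [envStep, Config.setReg]

theorem envStep_iterate_mono {Q E : Type} (env : Env Q E) (s : List (Prog Q) × Config Q × E)
    {m m' : ℕ} (h : m ≤ m') :
    ((envStep env)^[m] s).2.1.coins ≤ ((envStep env)^[m'] s).2.1.coins ∧
      ((envStep env)^[m] s).2.1.log.length ≤ ((envStep env)^[m'] s).2.1.log.length := by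
  induction h with
  | refl => exact ⟨le_rfl, le_rfl⟩
  | step _ ih =>
    rw [Function.iterate_succ_apply']
    exact ⟨ih.1.trans (envStep_mono _ _).1, ih.2.trans (envStep_mono _ _).2⟩

/-- A program with bounded time complexity halts in every environment whose answers have admissible
lengths. -/
theorem Prog.Bounded.exists_envExec {Q E : Type} {p : Prog Q} {input : Str} {len : Q → ℕ → Prop}
    {t : ℕ} {B : List (Q × Str) → Prop} (hp : p.Bounded input len t B) (env : Env Q E)
    (Inv : Config Q → E → Prop) (dflt : Q → Str) (hd : ∀ q, len q (dflt q).length)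
    (hop : ∀ (o : Op) c e, Inv c e → Inv (o.apply c) e)
    (hflip : ∀ r c e, Inv c e →
      Inv { c.setReg r [(env.flip c.coins e).1] with coins := c.coins + 1 } (env.flip c.coins e).2)
    (hquery : ∀ q x y c e, Inv c e → Inv
      { c.setReg y (env.query q (c.reg x) e).1 with log := (q, c.reg x) :: c.log }
        (env.query q (c.reg x) e).2)
    (hlen : ∀ q x c e, Inv c e → len q (env.query q x e).1.length)
    (e : E) (he : Inv (Config.start Q input) e) :
    ∃ c e' n, EnvExec env p (Config.start Q input) e c e' n ∧ p.size + n ≤ t ∧ B c.log := by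
  classical
  -- The resource bound speaks of oracles that see only the earlier calls, while `env` has a state.
  -- Along the orbit `o` of small steps, the coin with index `i` is flipped at most once and the
  -- query preceded by `l` calls occurs at most once. The answers of `env` can therefore be read off
  -- the orbit as functions of `i` and of `l`; with these coins and this oracle the program halts,
  -- and its run follows the orbit.
  set o : ℕ → List (Prog Q) × Config Q × E :=
    fun m => (envStep env)^[m] ([p], Config.start Q input, e) with ho
  have hsucc : ∀ m, o (m + 1) = envStep env (o m) := fun m => Function.iterate_succ_apply' _ _ _
  have hmono : ∀ {m m'}, m ≤ m' → (o m).2.1.coins ≤ (o m').2.1.coins ∧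
      (o m).2.1.log.length ≤ (o m').2.1.log.length := fun h => envStep_iterate_mono _ _ h
  have hinv : ∀ m, Inv (o m).2.1 (o m).2.2 := by
    intro m
    induction m with
    | zero => exact he
    | succ m ih =>
      rw [hsucc]
      generalize o m = s at ih
      obtain ⟨K, c, e⟩ := s
      rcases K with _ | ⟨p, K⟩
      · exact ih
      · cases p with
        | ifEq | ifLt | loop => simp only [envStep]; split_ifs <;> exact ih
        | op => exact hop _ _ _ ih
        | flip => exact hflip _ _ _ ih
        | query => exact hquery _ _ _ _ _ ih
        | _ => exact ih
  let Fl : ℕ → ℕ → Prop := fun i m => ∃ r K, (o m).1 = .flip r :: K ∧ (o m).2.1.coins = i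
  let Qu : ℕ → ℕ → Prop := fun l m => ∃ q x y K, (o m).1 = .query q x y :: K ∧
    (o m).2.1.log.length = l
  have hFl : ∀ i m m', Fl i m → Fl i m' → m = m' := by
    have key : ∀ i m m', Fl i m → Fl i m' → ¬ m < m' := by
      rintro i m m' ⟨r, K, h1, h2⟩ ⟨r', K', h3, h4⟩ hlt
      have := (hmono (Nat.succ_le_of_lt hlt)).1
      rw [Nat.succ_eq_add_one, hsucc, h4] at this
      obtain ⟨⟨K1, c1, e1⟩, h⟩ : ∃ s, s = o m := ⟨_, rfl⟩
      rw [← h] at this h1 h2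
      simp only at h1 h2
      subst h1
      simp only [envStep] at this
      omega
    intro i m m' h h'
    rcases lt_trichotomy m m' with hl | hl | hl
    · exact absurd hl (key _ _ _ h h')
    · exact hl
    · exact absurd hl (key _ _ _ h' h)
  have hQu : ∀ i m m', Qu i m → Qu i m' → m = m' := by
    have key : ∀ i m m', Qu i m → Qu i m' → ¬ m < m' := by
      rintro i m m' ⟨q, x, y, K, h1, h2⟩ ⟨q', x', y', K', h3, h4⟩ hlt
      have := (hmono (Nat.succ_le_of_lt hlt)).2
      rw [Nat.succ_eq_add_one, hsucc, h4] at this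
      obtain ⟨⟨K1, c1, e1⟩, h⟩ : ∃ s, s = o m := ⟨_, rfl⟩
      rw [← h] at this h1 h2
      simp only at h1 h2
      subst h1
      simp only [envStep, List.length_cons] at this
      omega
    intro i m m' h h'
    rcases lt_trichotomy m m' with hl | hl | hl
    · exact absurd hl (key _ _ _ h h')
    · exact hl
    · exact absurd hl (key _ _ _ h' h)
  let coin : ℕ → Bool := fun i => if h : ∃ m, Fl i m then (env.flip i (o h.choose).2.2).1 else false
  -- Positions that the orbit never reaches get a default answer, since the bound is granted only
  -- for oracles all of whose answers have admissible lengths.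
  let orc : Oracle Q := fun l q x =>
    if h : ∃ m, Qu l.length m then (env.query q x (o h.choose).2.2).1 else dflt q
  have horc : ∀ l q x, len q (orc l q x).length := by
    intro l q x
    simp only [orc]
    split_ifs with h
    · exact hlen _ _ _ _ (hinv _)
    · exact hd q
  have main : ∀ {p' c c' n}, Exec coin orc p' c c' n → ∀ m K e, o m = (p' :: K, c, e) →
      ∃ m' e', o m' = (K, c', e') ∧ EnvExec env p' c e c' e' n := by
    intro p' c c' n h
    induction h with
    | skip c => intro m K e h; exact ⟨m + 1, e, by rw [hsucc, h]; rfl, .skip _ _⟩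
    | op _ c => intro m K e h; exact ⟨m + 1, e, by rw [hsucc, h]; rfl, .op _ _ _⟩
    | flip r c =>
      intro m K e h
      have hm : Fl c.coins m := ⟨r, K, by rw [h], by rw [h]⟩
      have hex : ∃ m, Fl c.coins m := ⟨m, hm⟩
      have hc : coin c.coins = (env.flip c.coins e).1 := by
        simp only [coin, dif_pos hex, hFl _ _ _ hex.choose_spec hm, h]
      refine ⟨m + 1, (env.flip c.coins e).2, ?_, ?_⟩
      · rw [hsucc, h, hc]; rfl
      · rw [hc]; exact .flip r c e
    | query q x y c =>
      intro m K e h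
      have hm : Qu c.log.length m := ⟨q, x, y, K, by rw [h], by rw [h]⟩
      have hex : ∃ m, Qu c.log.length m := ⟨m, hm⟩
      have hc : orc c.log q (c.reg x) = (env.query q (c.reg x) e).1 := by
        simp only [orc, dif_pos hex, hQu _ _ _ hex.choose_spec hm, h]
      refine ⟨m + 1, (env.query q (c.reg x) e).2, ?_, ?_⟩
      · rw [hsucc, h, hc]; rfl
      · rw [hc]; exact .query q x y c e
    | seq _ _ ih ih' =>
      intro m K e h
      obtain ⟨m₁, e₁, h₁, h₁'⟩ := ih (m + 1) (_ :: K) e (by rw [hsucc, h]; rfl)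
      obtain ⟨m₂, e₂, h₂, h₂'⟩ := ih' m₁ K e₁ h₁
      exact ⟨m₂, e₂, h₂, .seq h₁' h₂'⟩
    | ifEq_true hc _ ih =>
      intro m K e h
      obtain ⟨m₁, e₁, h₁, h₁'⟩ := ih (m + 1) K e (by rw [hsucc, h]; simp [envStep, hc])
      exact ⟨m₁, e₁, h₁, .ifEq_true hc h₁'⟩
    | ifEq_false hc _ ih =>
      intro m K e h
      obtain ⟨m₁, e₁, h₁, h₁'⟩ := ih (m + 1) K e (by rw [hsucc, h]; simp [envStep, hc])
      exact ⟨m₁, e₁, h₁, .ifEq_false hc h₁'⟩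
    | ifLt_true hc _ ih =>
      intro m K e h
      obtain ⟨m₁, e₁, h₁, h₁'⟩ := ih (m + 1) K e (by rw [hsucc, h]; simp only [envStep, if_pos hc])
      exact ⟨m₁, e₁, h₁, .ifLt_true hc h₁'⟩
    | ifLt_false hc _ ih =>
      intro m K e h
      obtain ⟨m₁, e₁, h₁, h₁'⟩ := ih (m + 1) K e (by rw [hsucc, h]; simp only [envStep, if_neg hc])
      exact ⟨m₁, e₁, h₁, .ifLt_false hc h₁'⟩
    | loop_done hc =>
      intro m K e h
      exact ⟨m + 1, e, by rw [hsucc, h]; simp [envStep, hc], .loop_done hc⟩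
    | loop_step hc _ _ ih ih' =>
      intro m K e h
      obtain ⟨m₁, e₁, h₁, h₁'⟩ := ih (m + 1) (_ :: K) e (by rw [hsucc, h]; simp [envStep, hc]; rfl)
      obtain ⟨m₂, e₂, h₂, h₂'⟩ := ih' m₁ K e₁ h₁
      exact ⟨m₂, e₂, h₂, .loop_step hc h₁' h₂'⟩
  obtain ⟨c, n, hex, hn, hB⟩ := hp coin orc horc
  obtain ⟨_, e', _, hE⟩ := main hex 0 [] e rfl
  exact ⟨c, e', n, hE, hn, hB⟩

/-! ### The simulator of the forward security experiment -/

theorem Params.τ_le_κ (P : Params) : P.τ ≤ P.κ :=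
  (Nat.le_mul_of_pos_left _ P.k_pos).trans P.k_mul_τ_le

theorem Params.k_le_κ (P : Params) : P.k ≤ P.κ :=
  (Nat.le_mul_of_pos_right _ P.τ_pos).trans P.k_mul_τ_le

theorem Params.κ_pos (P : Params) : 0 < P.κ := P.τ_pos.trans_le P.τ_le_κ

/-- The string of fixed length that writes an epoch number. -/
def Params.code (P : Params) (n : ℕ) : Str := enc P.J.size n

@[simp] theorem Params.length_code (P : Params) (n : ℕ) : (P.code n).length = P.J.size :=
  length_enc _ _

theorem Params.code_inj (P : Params) {m n : ℕ} (hm : m ≤ P.J) (hn : n ≤ P.J)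
    (h : P.code m = P.code n) : m = n :=
  enc_inj (hm.trans_lt (Nat.lt_size_self _)) (hn.trans_lt (Nat.lt_size_self _)) h

theorem Params.incr_code (P : Params) {n : ℕ} (hn : n < P.J) :
    incr (P.code n) = P.code (n + 1) :=
  incr_enc _ _ (lt_of_le_of_lt hn (Nat.lt_size_self _))

theorem Params.code_ne_nil (P : Params) {n m : ℕ} (hn : n ≤ P.J) (hn' : m < n) : P.code n ≠ [] := by
  intro h
  have := congrArg List.length h
  rw [P.length_code, List.length_nil, Nat.size_eq_zero] at this
  omega

/-- Events in the life of the simulator: a question of the adversary to a random oracle, the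
sampling of the table entry with a given address, a coin flip of the adversary. -/
inductive Event
  | ask (x : Str)
  | samp (a : Str)
  | flip (i : ℕ)
  deriving DecidableEq

/-- The part of the state that records events and oracle calls, the latest ones first. -/
structure Record where
  hist : List Event
  log : List (HORS.Query × Str)

/-- The source of the random strings and bits of the simulator. It may depend on the events so far.
-/
structure Source where
  pair : List Event → Str → Str × Str
  bit : List Event → ℕ → Bool

/-- Computations that sample table entries and call the oracles of the EU-CMA experiment. -/
inductive Handler (α : Type) : Type
  | ret (r : α)
  | samp (a : Str) (f : Str → Str → Handler α)
  | call (q : HORS.Query) (x : Str) (f : Str → Handler α)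

namespace Handler

variable {α β : Type}

def bind : Handler α → (α → Handler β) → Handler β
  | ret r, g => g r
  | samp a f, g => samp a fun s v => (f s v).bind g
  | call q x f, g => call q x fun y => (f y).bind g

def run (src : Source) (orc : Oracle HORS.Query) : Handler α → Record → α × Record
  | ret r, w => (r, w)
  | samp a f, w =>
      (f (src.pair w.hist a).1 (src.pair w.hist a).2).run src orc ⟨.samp a :: w.hist, w.log⟩
  | call q x f, w => (f (orc w.log q x)).run src orc ⟨w.hist, (q, x) :: w.log⟩

theorem run_bind (src : Source) (orc : Oracle HORS.Query) (h : Handler α) (g : α → Handler β)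
    (w : Record) :
    (h.bind g).run src orc w = (g (h.run src orc w).1).run src orc (h.run src orc w).2 := by
  induction h generalizing w with
  | ret r => rfl
  | samp a f ih => exact ih _ _ _
  | call q x f ih => exact ih _ _

theorem suffix_run (src : Source) (orc : Oracle HORS.Query) (h : Handler α) (w : Record) :
    w.hist <:+ (h.run src orc w).2.hist := by
  induction h generalizing w with
  | ret r => exact List.suffix_rfl
  | samp a f ih =>
    exact (List.suffix_cons (Event.samp a) w.hist).trans (ih _ _ ⟨.samp a :: w.hist, w.log⟩)
  | call q x f ih => exact ih (orc w.log q x) ⟨w.hist, (q, x) :: w.log⟩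

/-- `h.Spec V W w Q`: every result of `h`, started with the record `w`, satisfies `Q`, provided that
samples satisfy `V` and oracle answers satisfy `W`. -/
def Spec (V : Str → Str → Str → Prop) (W : List (HORS.Query × Str) → HORS.Query → Str → Str → Prop) :
    Handler α → Record → (α → Record → Prop) → Prop
  | ret r, w, Q => Q r w
  | samp a f, w, Q => ∀ s v, V a s v → (f s v).Spec V W ⟨.samp a :: w.hist, w.log⟩ Q
  | call q x f, w, Q => ∀ y, W w.log q x y → (f y).Spec V W ⟨w.hist, (q, x) :: w.log⟩ Q

variable {V : Str → Str → Str → Prop} {W : List (HORS.Query × Str) → HORS.Query → Str → Str → Prop}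

theorem Spec.mono {h : Handler α} {w : Record} {Q Q' : α → Record → Prop} (hh : h.Spec V W w Q)
    (hQ : ∀ r w, Q r w → Q' r w) : h.Spec V W w Q' := by
  induction h generalizing w with
  | ret r => exact hQ _ _ hh
  | samp a f ih => exact fun s v hV => ih _ _ (hh s v hV)
  | call q x f ih => exact fun y hW => ih _ (hh y hW)

theorem Spec.bind {h : Handler α} {w : Record} {g : α → Handler β} {Q : β → Record → Prop}
    (hh : h.Spec V W w fun r w' => (g r).Spec V W w' Q) : (h.bind g).Spec V W w Q := by
  induction h generalizing w with
  | ret r => exact hh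
  | samp a f ih => exact fun s v hV => ih _ _ (hh s v hV)
  | call q x f ih => exact fun y hW => ih _ (hh y hW)

theorem Spec.run {h : Handler α} {w : Record} {Q : α → Record → Prop} (hh : h.Spec V W w Q)
    {src : Source} {orc : Oracle HORS.Query}
    (hs : ∀ l a, V a (src.pair l a).1 (src.pair l a).2) (ho : ∀ l q x, W l q x (orc l q x)) :
    Q (h.run src orc w).1 (h.run src orc w).2 := by
  induction h generalizing w with
  | ret r => exact hh
  | samp a f ih => exact ih _ _ (hh _ _ (hs _ _))
  | call q x f ih => exact ih _ (hh _ (ho _ _ _))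

end Handler

/-- Two sources answer the request after some events differently. -/
def Source.Differ (src src' : Source) (h : List Event) : Event → Prop
  | .ask _ => False
  | .samp a => src.pair h a ≠ src'.pair h a
  | .flip i => src.bit h i ≠ src'.bit h i

/-- Two lists of events have a common part after which the sources differ. -/
def Source.Diverge (src src' : Source) (h h' : List Event) : Prop :=
  ∃ ev l, (ev :: l) <:+ h ∧ (ev :: l) <:+ h' ∧ src.Differ src' l ev

/-- Both runs pass through the same records up to the first sample on which the sources disagree.
Histories only grow, so that sample and everything before it remain a common suffix of both final
histories. -/
theorem Handler.run_diverge {α : Type} (src src' : Source) (orc : Oracle HORS.Query)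
    (h : Handler α) (w : Record) :
    h.run src orc w = h.run src' orc w ∨
      src.Diverge src' (h.run src orc w).2.hist (h.run src' orc w).2.hist := by
  induction h generalizing w with
  | ret r => exact .inl rfl
  | samp a f ih =>
    by_cases hd : src.pair w.hist a = src'.pair w.hist a
    · simp only [run, hd]
      exact ih _ _ _
    · exact .inr ⟨.samp a, w.hist, suffix_run src orc (f _ _) ⟨_, _⟩,
        suffix_run src' orc (f _ _) ⟨_, _⟩, hd⟩
  | call q x f ih => exact ih _ _

/-- The tables of the simulator, where the empty string means that there is no entry: the number of
signatures given, whether signing is closed, the epochs of the private keys known to the adversary,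
the strings sampled for the addresses, the programmed values of `H 2`. -/
structure Tab where
  cnt : Str
  closed : Bool
  sk : Str → Str
  cell : Str → Str
  h2 : Str → Str

def Tab.put (T : Tab) (a s v : Str) : Tab :=
  { T with cell := Function.update T.cell a s, h2 := Function.update T.h2 s v }

/-- Sample the entry with address `a` unless it is present. -/
def ensure (T : Tab) (a : Str) : Handler Tab :=
  if T.cell a = [] then .samp a fun s v => .ret (T.put a s v) else .ret T

def ensureAll (out : Tab → Str → Str) : List Str → Str → Tab → Handler (Str × Tab)
  | [], acc, T => .ret (acc, T)
  | a :: l, acc, T => (ensure T a).bind fun T' => ensureAll out l (acc ++ out T' a) T'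

/-- The private key with the given address, which becomes known to the adversary. -/
def nextKey (T : Tab) (c : Str) : Handler (Str × Tab) :=
  (ensure T c).bind fun T' =>
    .ret (T'.cell c, { T' with sk := Function.update T'.sk (T'.cell c) (incr c) })

def forward (q : HORS.Query) (x : Str) (T : Tab) : Handler (Str × Tab) :=
  .call q x fun y => .ret (y, T)

/-- The simulation of the random oracles. -/
def handleRo (P : Params) (x : Str) (T : Tab) : Fin 3 → Handler (Str × Tab)
  | 0 => forward (.ro 0) x T
  | 1 =>
      if T.sk (x.take P.κ) = [] then forward (.ro 1) x T
      else if x.drop P.κ = [] then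
        if T.sk (x.take P.κ) = P.code P.J then forward (.ro 1) x T
        else nextKey T (T.sk (x.take P.κ))
      else if (x.drop P.κ).length = P.τ then
        (ensure T (T.sk (x.take P.κ) ++ x.drop P.κ)).bind fun T' =>
          .ret (T'.cell (T.sk (x.take P.κ) ++ x.drop P.κ), T')
      else forward (.ro 1) x T
  | 2 => if T.h2 x = [] then forward (.ro 2) x T else .ret (T.h2 x, T)

/-- The table entries of a signature. -/
def signCells (P : Params) (T : Tab) (h : Str) : Handler (Str × Tab) :=
  ensureAll (fun T a => T.cell a) ((blocks P.τ P.k h).map (T.cnt ++ ·)) [] T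

/-- The flag `closed` serves for two reasons of refusal: here it is set when the `J`-th signature is
given, and a break-in sets it as well. -/
def Tab.advance (P : Params) (T : Tab) : Tab :=
  { T with cnt := incr T.cnt, closed := decide (incr T.cnt = P.code P.J) }

/-- The simulation of the signing oracle; epoch `j` is left to the signing oracle of HORS. -/
def handleSig (P : Params) (j : ℕ) (M : Str) (T : Tab) : Handler (Str × Tab) :=
  if T.closed then .ret ([], T)
  else if incr T.cnt = P.code j then forward .sig M (T.advance P)
  else .call (.ro 0) M fun h => signCells P (T.advance P) h

def comCells (P : Params) (T : Tab) (c : Str) : Handler (Str × Tab) :=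
  ensureAll (fun T a => T.h2 (T.cell a)) ((List.range P.T).map fun i => c ++ enc P.τ i) [] T

/-- The simulation of the commitment oracle; the commitment of epoch `j` is the HORS key. -/
def handleCom (P : Params) (j : ℕ) (pk q : Str) (T : Tab) : Handler (Str × Tab) :=
  if 1 ≤ val q ∧ val q ≤ P.J then
    if P.code (val q) = P.code j then .ret (pk, T) else comCells P T (P.code (val q))
  else .ret ([], T)

/-- The simulation of the break-in oracle. -/
def handleBrk (T : Tab) : Handler (Str × Tab) :=
  if T.closed then .ret ([], T)
  else (nextKey T T.cnt).bind fun r => .ret (r.1, { r.2 with closed := true })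

def handle (P : Params) (j : ℕ) (pk : Str) : Scheme.Query → Str → Tab → Handler (Str × Tab)
  | .ro i, x, T => handleRo P x T i
  | .sig, x, T => handleSig P j x T
  | .com, x, T => handleCom P j pk x T
  | .brk, _, T => handleBrk T

/-- The strings of a question that are compared with secret strings. -/
def asks (P : Params) : Scheme.Query → Str → List Event
  | .ro 1, x => [.ask (x.take P.κ)]
  | .ro 2, x => [.ask x]
  | _, _ => []

/-! ### The simulator as a stateful environment -/

structure Sim where
  tab : Tab
  rcd : Record

def simEnv (P : Params) (j : ℕ) (pk : Str) (src : Source) (orc : Oracle HORS.Query) :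
    Env Scheme.Query Sim where
  flip i e := (src.bit e.rcd.hist i, ⟨e.tab, ⟨.flip i :: e.rcd.hist, e.rcd.log⟩⟩)
  query q x e :=
    let r := (handle P j pk q x e.tab).run src orc ⟨asks P q x ++ e.rcd.hist, e.rcd.log⟩
    (r.1.1, ⟨r.1.2, r.2⟩)

def Sim.start (P : Params) : Sim where
  tab := ⟨P.code 0, false, fun _ => [], fun _ => [], fun _ => []⟩
  rcd := ⟨[], []⟩

theorem simEnv_suffix {P : Params} {j : ℕ} {pk : Str} {src : Source} {orc : Oracle HORS.Query}
    {p : Prog Scheme.Query} {c c' : Config Scheme.Query} {e e' : Sim} {n : ℕ}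
    (h : EnvExec (simEnv P j pk src orc) p c e c' e' n) : e.rcd.hist <:+ e'.rcd.hist := by
  refine EnvExec.rel (R := fun _ e _ e' => e.rcd.hist <:+ e'.rcd.hist) (fun _ _ => List.suffix_rfl)
    ?_ (fun _ _ _ => List.suffix_rfl) ?_ ?_ h
  · intro c e c' e' c'' e'' h h'; exact h.trans h'
  · intro r c e; exact List.suffix_cons _ _
  · intro q x y c e
    exact (List.suffix_append _ _).trans (Handler.suffix_run src orc _ ⟨_, _⟩)

/-- The tool for every change of randomness: either the runs are equal, or their histories share a
request that the two sources answer differently. It yields uniqueness of runs, the passage from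
named bits to a tape, and the independence of the asked strings from the bits of one entry. -/
theorem simEnv_diverge {P : Params} {j : ℕ} {pk : Str} {src src' : Source}
    {orc : Oracle HORS.Query} {p : Prog Scheme.Query} {c c₁ c₂ : Config Scheme.Query}
    {e e₁ e₂ : Sim} {n₁ n₂ : ℕ} (h₁ : EnvExec (simEnv P j pk src orc) p c e c₁ e₁ n₁)
    (h₂ : EnvExec (simEnv P j pk src' orc) p c e c₂ e₂ n₂) :
    (c₁ = c₂ ∧ n₁ = n₂ ∧ e₁ = e₂) ∨ src.Diverge src' e₁.rcd.hist e₂.rcd.hist := by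
  refine EnvExec.couple (D := fun e e' => src.Diverge src' e.rcd.hist e'.rcd.hist)
    ?_ ?_ ?_ ?_ h₁ h₂ rfl
  · rintro i e _ rfl
    by_cases hd : src.bit e.rcd.hist i = src'.bit e.rcd.hist i
    · left; simp only [simEnv, hd, and_self]
    · exact .inr ⟨.flip i, e.rcd.hist, List.suffix_rfl, List.suffix_rfl, hd⟩
  · rintro q x e _ rfl
    rcases Handler.run_diverge src src' orc (handle P j pk q x e.tab)
      ⟨asks P q x ++ e.rcd.hist, e.rcd.log⟩ with h | h
    · left; simp only [simEnv, h, and_self]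
    · exact .inr h
  · rintro p c e c' e' n f h ⟨ev, l, h1, h2, h3⟩
    exact ⟨ev, l, h1.trans (simEnv_suffix h), h2, h3⟩
  · rintro p c e c' e' n f h ⟨ev, l, h1, h2, h3⟩
    exact ⟨ev, l, h1, h2.trans (simEnv_suffix h), h3⟩

/-! ### Invariants of the simulator -/

/-- No table entry is sampled twice and no coin is flipped twice. -/
def FreshEvents : List Event → Prop
  | [] => True
  | .ask _ :: h => FreshEvents h
  | ev :: h => ev ∉ h ∧ FreshEvents h

def Event.isAsk : Event → Bool
  | .ask _ => true
  | _ => false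

def askCount (h : List Event) : ℕ := h.countP Event.isAsk

def roCount (l : List (HORS.Query × Str)) : ℕ := l.countP fun e => ∃ i, e.1 = .ro i

def sigCount (l : List (HORS.Query × Str)) : ℕ := l.countP fun e => e.1 = .sig

/-- Invariant of the tables: lengths of entries, and consistency with the events. -/
structure Tab.Valid (P : Params) (T : Tab) (h : List Event) : Prop where
  cnt : ∃ n ≤ P.J, T.cnt = P.code n ∧ (T.closed = false → n < P.J)
  sk : ∀ p, T.sk p = [] ∨ ∃ m, 1 ≤ m ∧ m ≤ P.J ∧ T.sk p = P.code m
  cell : ∀ a, T.cell a = [] ∨ (T.cell a).length = P.κ ∧ (T.h2 (T.cell a)).length = P.κ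
  h2 : ∀ x, T.h2 x = [] ∨ (T.h2 x).length = P.κ
  samp : ∀ a, Event.samp a ∈ h ↔ T.cell a ≠ []
  fresh : FreshEvents h

/-- Samples are pairs of strings of length `κ`. -/
def SampleLength (P : Params) (_ s v : Str) : Prop := s.length = P.κ ∧ v.length = P.κ

def AnswerValid (P : Params) (_ : List (HORS.Query × Str)) (q : HORS.Query) (_ y : Str) : Prop :=
  HORS.AnswerLength P q y.length

/-- The later record differs from the earlier one by samples only. -/
structure Record.Samples (w w' : Record) : Prop where
  log : w'.log = w.log
  ask : askCount w'.hist = askCount w.hist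
  flip : ∀ i, Event.flip i ∈ w'.hist → Event.flip i ∈ w.hist

theorem Record.Samples.refl (w : Record) : w.Samples w := ⟨rfl, rfl, fun _ h => h⟩

theorem Record.Samples.trans {w w' w'' : Record} (h : w.Samples w') (h' : w'.Samples w'') :
    w.Samples w'' :=
  ⟨h'.log.trans h.log, h'.ask.trans h.ask, fun i hi => h.flip i (h'.flip i hi)⟩

theorem ne_nil_of_length {P : Params} {x : Str} (h : x.length = P.κ) : x ≠ [] := by
  rintro rfl; have := P.κ_pos; simp at h; omega

theorem Tab.Valid.put {P : Params} {T : Tab} {h : List Event} (hT : T.Valid P h) {a s v : Str}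
    (ha : T.cell a = []) (hs : s.length = P.κ) (hv : v.length = P.κ) :
    (T.put a s v).Valid P (.samp a :: h) := by
  refine ⟨hT.cnt, hT.sk, ?_, ?_, ?_, ⟨?_, hT.fresh⟩⟩
  · intro b
    simp only [Tab.put, Function.update_apply]
    by_cases hb : b = a
    · simp [hb, hs, hv]
    · simp only [hb, if_false]
      rcases hT.cell b with h | h
      · exact .inl h
      · right; split_ifs <;> simp [h, hv]
  · intro x
    simp only [Tab.put, Function.update_apply]
    split_ifs
    · exact .inr hv
    · exact hT.h2 x
  · intro b
    simp only [Tab.put, Function.update_apply, List.mem_cons, Event.samp.injEq, hT.samp b]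
    by_cases hb : b = a
    · simp [hb, ne_nil_of_length hs]
    · simp [hb]
  · rw [hT.samp]; simpa using ha

/-- The table after an entry has been ensured. -/
structure Tab.Ensured (P : Params) (T : Tab) (w : Record) (a : Str) (T' : Tab) (w' : Record) :
    Prop where
  valid : T'.Valid P w'.hist
  samples : w.Samples w'
  length : (T'.cell a).length = P.κ
  cnt : T'.cnt = T.cnt
  closed : T'.closed = T.closed
  sk : T'.sk = T.sk

theorem ensure_spec {P : Params} {W : List (HORS.Query × Str) → HORS.Query → Str → Str → Prop}
    {T : Tab} {w : Record} (hT : T.Valid P w.hist) (a : Str) :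
    (ensure T a).Spec (SampleLength P) W w (T.Ensured P w a) := by
  unfold ensure
  split_ifs with ha
  · rintro s v ⟨hs, hv⟩
    refine ⟨hT.put ha hs hv, ⟨rfl, ?_, ?_⟩, ?_, rfl, rfl, rfl⟩
    · simp [askCount, Event.isAsk]
    · intro i hi; simpa using hi
    · simp [Tab.put, hs]
  · refine ⟨hT, .refl w, ?_, rfl, rfl, rfl⟩
    rcases hT.cell a with h | h
    · exact absurd h ha
    · exact h.1

theorem ensureAll_spec {P : Params} {W : List (HORS.Query × Str) → HORS.Query → Str → Str → Prop}
    {out : Tab → Str → Str}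
    (hout : ∀ (T : Tab) h a, T.Valid P h → (T.cell a).length = P.κ → (out T a).length = P.κ)
    (l : List Str) (acc : Str) {T : Tab} {w : Record} (hT : T.Valid P w.hist) :
    (ensureAll out l acc T).Spec (SampleLength P) W w fun r w' =>
      r.2.Valid P w'.hist ∧ w.Samples w' ∧ r.1.length = acc.length + l.length * P.κ ∧
      r.2.cnt = T.cnt ∧ r.2.closed = T.closed ∧ r.2.sk = T.sk := by
  induction l generalizing acc T w with
  | nil => exact ⟨hT, .refl w, by simp, rfl, rfl, rfl⟩
  | cons a l ih =>
    refine Handler.Spec.bind ((ensure_spec hT a).mono fun T' w' h => ?_)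
    refine (ih (acc ++ out T' a) h.valid).mono fun r w'' h' => ?_
    refine ⟨h'.1, h.samples.trans h'.2.1, ?_, h'.2.2.2.1.trans h.cnt, h'.2.2.2.2.1.trans h.closed,
      h'.2.2.2.2.2.trans h.sk⟩
    rw [h'.2.2.1, List.length_append, hout T' _ a h.valid h.length, List.length_cons]
    ring

theorem nextKey_spec {P : Params} {W : List (HORS.Query × Str) → HORS.Query → Str → Str → Prop}
    {T : Tab} {w : Record} (hT : T.Valid P w.hist) {n : ℕ} (hn : n < P.J) :
    (nextKey T (P.code n)).Spec (SampleLength P) W w fun r w' =>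
      r.2.Valid P w'.hist ∧ w.Samples w' ∧ r.1.length = P.κ ∧ r.2.cnt = T.cnt ∧
        r.2.closed = T.closed := by
  refine Handler.Spec.bind ((ensure_spec hT _).mono fun T' w' h => ?_)
  refine ⟨⟨h.valid.cnt, ?_, h.valid.cell, h.valid.h2, h.valid.samp, h.valid.fresh⟩, h.samples,
    h.length, h.cnt, h.closed⟩
  intro p
  simp only [Function.update_apply]
  split_ifs
  · exact .inr ⟨n + 1, by omega, hn, P.incr_code hn⟩
  · exact h.valid.sk p

theorem blocks_length {n k : ℕ} (x : Str) : (blocks n k x).length = k := by simp [blocks]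

/-- The number of oracle calls needed for a query. -/
def callCount : Scheme.Query → ℕ
  | .ro _ => 1
  | .sig => 1
  | _ => 0

/-- The effect of answering a query. -/
structure Handled (P : Params) (j : ℕ) (q : Scheme.Query) (x : Str) (T : Tab) (w : Record)
    (r : Str × Tab) (w' : Record) : Prop where
  valid : r.2.Valid P w'.hist
  length : Scheme.AnswerLength P q r.1.length
  roCount_le : roCount w'.log ≤ roCount w.log + callCount q
  sig_mem : ∀ M, (HORS.Query.sig, M) ∈ w'.log → (HORS.Query.sig, M) ∈ w.log ∨ q = .sig ∧ M = x
  sigCount_le : sigCount w'.log ≤ sigCount w.log + if q = .sig then 1 else 0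
  cnt : r.2.cnt = T.cnt ∧ sigCount w'.log = sigCount w.log ∧ (T.closed → r.2.closed) ∨
    T.closed = false ∧ r.2.cnt = incr T.cnt ∧
      sigCount w'.log = sigCount w.log + if incr T.cnt = P.code j then 1 else 0
  ask : askCount w'.hist = askCount w.hist
  flip : ∀ i, Event.flip i ∈ w'.hist → Event.flip i ∈ w.hist

theorem Handled.of_samples {P : Params} {j : ℕ} {q : Scheme.Query} {x : Str} {T : Tab}
    {w w' : Record} {r : Str × Tab} (hv : r.2.Valid P w'.hist) (hw : w.Samples w')
    (hl : Scheme.AnswerLength P q r.1.length) (hc : r.2.cnt = T.cnt)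
    (hcl : T.closed → r.2.closed) : Handled P j q x T w r w' where
  valid := hv
  length := hl
  roCount_le := by rw [hw.log]; omega
  sig_mem := by rw [hw.log]; exact fun _ h => .inl h
  sigCount_le := by rw [hw.log]; omega
  cnt := .inl ⟨hc, by rw [hw.log], hcl⟩
  ask := hw.ask
  flip := hw.flip

theorem forward_ro_spec {P : Params} {j : ℕ} {x : Str} {T : Tab} {w : Record}
    (hT : T.Valid P w.hist) (i : Fin 3) :
    (forward (.ro i) x T).Spec (SampleLength P) (AnswerValid P) w
      (Handled P j (.ro i) x T w) := by
  intro y hy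
  refine ⟨hT, hy, ?_, ?_, ?_, .inl ⟨rfl, ?_, id⟩, rfl, fun _ h => h⟩
  · simp [roCount, callCount]
  · intro M hM; left; simpa using hM
  · simp [sigCount]
  · simp [sigCount]

theorem handleRo_spec {P : Params} {j : ℕ} {x : Str} {T : Tab} {w : Record}
    (hT : T.Valid P w.hist) (i : Fin 3) :
    (handleRo P x T i).Spec (SampleLength P) (AnswerValid P) w (Handled P j (.ro i) x T w) := by
  match i with
  | 0 => exact forward_ro_spec hT 0
  | 1 =>
    rw [handleRo]
    split_ifs with h1 h2 h3 h4
    · exact forward_ro_spec hT 1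
    · exact forward_ro_spec hT 1
    · obtain ⟨m, hm1, hm2, hm⟩ := (hT.sk (x.take P.κ)).resolve_left h1
      rw [hm] at h3 ⊢
      have hlt : m < P.J := lt_of_le_of_ne hm2 fun h => h3 (by rw [h])
      refine (nextKey_spec hT hlt).mono fun r w' h => ?_
      exact .of_samples h.1 h.2.1 h.2.2.1 h.2.2.2.1 (by rw [h.2.2.2.2]; exact id)
    · refine Handler.Spec.bind ((ensure_spec hT _).mono fun T' w' h => ?_)
      exact .of_samples h.valid h.samples h.length h.cnt (by rw [h.closed]; exact id)
    · exact forward_ro_spec hT 1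
  | 2 =>
    rw [handleRo]
    split_ifs with h1
    · exact forward_ro_spec hT 2
    · exact .of_samples hT (.refl w) ((hT.h2 x).resolve_left h1) rfl id

theorem Tab.Valid.advance {P : Params} {T : Tab} {h : List Event} (hT : T.Valid P h)
    (hc : T.closed = false) : (T.advance P).Valid P h := by
  obtain ⟨n, hn, hn', hn''⟩ := hT.cnt
  have hlt := hn'' hc
  refine ⟨⟨n + 1, hlt, ?_, ?_⟩, hT.sk, hT.cell, hT.h2, hT.samp, hT.fresh⟩
  · simp [Tab.advance, hn', P.incr_code hlt]
  · simp only [Tab.advance, hn', P.incr_code hlt, decide_eq_false_iff_not]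
    intro h
    exact lt_of_le_of_ne hlt fun h' => h (by rw [h'])

/-- Only the signing query that brings the counter to `j` reaches the HORS signing oracle; a random
oracle or signing query makes at most one random oracle call, and the rest is sampling. Only the
lengths of samples and answers matter here, so the resulting query bounds hold in the worst case. -/
theorem handle_spec {P : Params} {j : ℕ} {pk : Str} (hpk : pk.length = P.T * P.κ)
    (q : Scheme.Query) (x : Str) {T : Tab} {w : Record} (hT : T.Valid P w.hist) :
    (handle P j pk q x T).Spec (SampleLength P) (AnswerValid P) w (Handled P j q x T w) := by
  cases q with
  | ro i => exact handleRo_spec hT i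
  | sig =>
    rw [handle, handleSig]
    split_ifs with h1 h2
    · exact .of_samples hT (.refl w) (.inr rfl) rfl id
    · have hc : T.closed = false := by simpa using h1
      intro y hy
      refine ⟨hT.advance hc, .inl hy, ?_, ?_, ?_, .inr ⟨hc, rfl, ?_⟩, rfl, fun _ h => h⟩
      · simp [roCount]
      · intro M hM
        simp only [List.mem_cons, Prod.mk.injEq, true_and] at hM
        rcases hM with rfl | hM
        · exact .inr ⟨rfl, rfl⟩
        · exact .inl hM
      · simp [sigCount]
      · simp [sigCount, h2]
    · have hc : T.closed = false := by simpa using h1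
      intro y hy
      refine Handler.Spec.mono (h := signCells P (T.advance P) y)
        (ensureAll_spec (fun _ _ _ _ h => h) _ _ (hT.advance hc)) fun r w' h => ?_
      obtain ⟨h3, h4, h5, h6, h7, h8⟩ := h
      refine ⟨h3, .inl ?_, ?_, ?_, ?_, .inr ⟨hc, h6, ?_⟩, h4.ask, h4.flip⟩
      · rw [h5]; simp [blocks]
      · rw [h4.log]; simp [roCount, callCount]
      · rw [h4.log]; intro M hM; left; simpa using hM
      · rw [h4.log]; simp [sigCount]
      · rw [h4.log]; simp [sigCount, h2]
  | com =>
    rw [handle, handleCom]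
    split_ifs with h1 h2
    · exact .of_samples hT (.refl w) (.inl hpk) rfl id
    · refine (ensureAll_spec ?_ _ _ hT).mono fun r w' h => ?_
      · intro T' l a hT' ha
        rcases hT'.cell a with h | h
        · rw [h] at ha; have := P.κ_pos; simp at ha; omega
        · exact h.2
      obtain ⟨h3, h4, h5, h6, h7, h8⟩ := h
      refine .of_samples h3 h4 (.inl ?_) h6 (by rw [h7]; exact id)
      rw [h5]; simp
    · exact .of_samples hT (.refl w) (.inr rfl) rfl id
  | brk =>
    rw [handle, handleBrk]
    split_ifs with h1
    · exact .of_samples hT (.refl w) (.inr rfl) rfl id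
    · have hc : T.closed = false := by simpa using h1
      obtain ⟨n, hn, hn', hn''⟩ := hT.cnt
      rw [hn']
      refine Handler.Spec.bind ((nextKey_spec hT (hn'' hc)).mono fun r w' h => ?_)
      refine .of_samples ?_ h.2.1 (.inl h.2.2.1) h.2.2.2.1 (fun _ => rfl)
      refine ⟨?_, h.1.sk, h.1.cell, h.1.h2, h.1.samp, h.1.fresh⟩
      obtain ⟨m, hm, hm', hm''⟩ := h.1.cnt
      exact ⟨m, hm, hm', by simp⟩

/-- The sources considered here give strings of length `κ`. -/
def Source.Valid (P : Params) (src : Source) : Prop :=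
  ∀ h a, SampleLength P a (src.pair h a).1 (src.pair h a).2

/-- Invariant of the state of the simulator, with respect to the questions of the adversary. -/
structure Sim.Valid (P : Params) (j : ℕ) (e : Sim) : Prop where
  tab : e.tab.Valid P e.rcd.hist
  sig : ∃ n ≤ P.J, e.tab.cnt = P.code n ∧ sigCount e.rcd.log = if j ≤ n then 1 else 0

theorem askCount_asks (P : Params) (q : Scheme.Query) (x : Str) (h : List Event) :
    askCount (asks P q x ++ h) ≤ askCount h + if ∃ i, q = .ro i then 1 else 0 := by
  unfold asks
  split <;> simp [askCount, Event.isAsk, List.countP_cons]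

theorem Tab.Valid.asks {P : Params} {T : Tab} {h : List Event} (hT : T.Valid P h)
    (q : Scheme.Query) (x : Str) : T.Valid P (asks P q x ++ h) := by
  refine ⟨hT.cnt, hT.sk, hT.cell, hT.h2, ?_, ?_⟩
  · intro a
    rw [← hT.samp a]
    unfold PQHases.asks
    split <;> simp
  · have := hT.fresh
    unfold PQHases.asks
    split <;> simpa [FreshEvents] using this

/-! ### Preservation of the invariants, query bounds and termination -/

section

variable {P : Params} {j : ℕ} {pk : Str} {src : Source} {orc : Oracle HORS.Query}

theorem simEnv_handled (hpk : pk.length = P.T * P.κ) (hsrc : src.Valid P)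
    (horc : ∀ l q x, HORS.AnswerLength P q (orc l q x).length) (q : Scheme.Query) (x : Str)
    {e : Sim} (he : e.tab.Valid P e.rcd.hist) :
    Handled P j q x e.tab ⟨asks P q x ++ e.rcd.hist, e.rcd.log⟩
      (((simEnv P j pk src orc).query q x e).1, ((simEnv P j pk src orc).query q x e).2.tab)
      ((simEnv P j pk src orc).query q x e).2.rcd :=
  (handle_spec hpk q x (w := ⟨asks P q x ++ e.rcd.hist, e.rcd.log⟩) (he.asks q x)).run
    hsrc horc

/-- The counter only increases and codes of numbers up to `J` are distinct, so it reaches `j` at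
most once; that step accounts for the single HORS signature. -/
theorem Sim.Valid.query (hpk : pk.length = P.T * P.κ) (hsrc : src.Valid P)
    (horc : ∀ l q x, HORS.AnswerLength P q (orc l q x).length) (hj : j ≤ P.J) (q : Scheme.Query)
    (x : Str) {e : Sim} (he : e.Valid P j) : ((simEnv P j pk src orc).query q x e).2.Valid P j := by
  have H := simEnv_handled (j := j) hpk hsrc horc q x he.tab
  refine ⟨H.valid, ?_⟩
  obtain ⟨n, hn, hn', hs⟩ := he.sig
  rcases H.cnt with ⟨h1, h2, _⟩ | ⟨h0, h1, h2⟩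
  · exact ⟨n, hn, h1.trans hn', h2.trans hs⟩
  · obtain ⟨m, hm, hm', hm''⟩ := he.tab.cnt
    have hmn : m = n := P.code_inj hm hn (hm'.symm.trans hn')
    subst hmn
    have hlt := hm'' h0
    refine ⟨m + 1, hlt, ?_, ?_⟩
    · rw [h1, hm', P.incr_code hlt]
    · rw [h2, hm', P.incr_code hlt, hs]
      by_cases hj' : j ≤ m
      · have : P.code (m + 1) ≠ P.code j := fun h => by
          have := P.code_inj hlt hj h; omega
        simp [this, hj', hj'.trans (Nat.le_succ m)]
      · by_cases hj'' : m + 1 = j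
        · simp [hj'']; omega
        · have : P.code (m + 1) ≠ P.code j := fun h => hj'' (P.code_inj hlt hj h)
          simp [this, hj']; omega

theorem Sim.Valid.flip (i : ℕ) {e : Sim} (he : e.Valid P j) (hi : Event.flip i ∉ e.rcd.hist) :
    ((simEnv P j pk src orc).flip i e).2.Valid P j :=
  ⟨⟨he.tab.cnt, he.tab.sk, he.tab.cell, he.tab.h2, fun a => by simp [simEnv, he.tab.samp a],
    ⟨hi, he.tab.fresh⟩⟩, he.sig⟩

theorem Sim.start_valid (hJ : 0 < P.J) (hj : 0 < j) : (Sim.start P).Valid P j := by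
  refine ⟨⟨⟨0, by omega, rfl, fun _ => hJ⟩, fun _ => .inl rfl, fun _ => .inl rfl, fun _ => .inl rfl,
    fun a => by simp [Sim.start], trivial⟩, ⟨0, by omega, rfl, ?_⟩⟩
  have : ¬ j ≤ 0 := by omega
  simp [Sim.start, sigCount, this]

/-- Invariant of the adversary together with the simulator. -/
structure JointValid (P : Params) (j : ℕ) (c : Config Scheme.Query) (e : Sim) : Prop where
  sim : e.Valid P j
  flip : ∀ i, Event.flip i ∈ e.rcd.hist → i < c.coins
  ask : askCount e.rcd.hist ≤ c.log.countP fun e => ∃ i, e.1 = .ro i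
  roCount_le : roCount e.rcd.log ≤ (c.log.countP fun e => ∃ i, e.1 = .ro i) +
    c.log.countP fun e => e.1 = .sig ∨ e.1 = .com
  sigCount_le : sigCount e.rcd.log ≤ c.log.countP fun e => e.1 = .sig ∨ e.1 = .com
  sig_mem : ∀ M, (HORS.Query.sig, M) ∈ e.rcd.log → (Scheme.Query.sig, M) ∈ c.log

theorem JointValid.query (hpk : pk.length = P.T * P.κ) (hsrc : src.Valid P)
    (horc : ∀ l q x, HORS.AnswerLength P q (orc l q x).length) (hj : j ≤ P.J) (q : Scheme.Query)
    (x y : ℕ) {c : Config Scheme.Query} {e : Sim} (h : JointValid P j c e) :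
    JointValid P j
      { c.setReg y ((simEnv P j pk src orc).query q (c.reg x) e).1 with
        log := (q, c.reg x) :: c.log } ((simEnv P j pk src orc).query q (c.reg x) e).2 := by
  have H := simEnv_handled (j := j) hpk hsrc horc q (c.reg x) h.sim.tab
  refine ⟨h.sim.query hpk hsrc horc hj q _, ?_, ?_, ?_, ?_, ?_⟩
  · intro i hi
    refine h.flip i ?_
    have := H.flip i hi
    unfold asks at this
    split at this <;> simpa using this
  · rw [H.ask]
    refine (askCount_asks P q _ _).trans ?_
    have := h.ask
    simp only [List.countP_cons, decide_eq_true_eq]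
    split_ifs <;> omega
  · have h1 := H.roCount_le
    have h2 := h.roCount_le
    cases q <;> simp [callCount] at h1 h2 ⊢ <;> omega
  · have h1 := H.sigCount_le
    have h2 := h.sigCount_le
    cases q <;> simp at h1 h2 ⊢ <;> omega
  · intro M hM
    rcases H.sig_mem M hM with h' | ⟨rfl, rfl⟩
    · exact List.mem_cons_of_mem _ (h.sig_mem M h')
    · exact List.mem_cons_self

/-- The coin counter of the machine exceeds the index of every flip in the history, so the new flip
is a fresh event. -/
theorem JointValid.flipBit (r : ℕ) {c : Config Scheme.Query} {e : Sim} (h : JointValid P j c e) :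
    JointValid P j
      { c.setReg r [((simEnv P j pk src orc).flip c.coins e).1] with coins := c.coins + 1 }
      ((simEnv P j pk src orc).flip c.coins e).2 := by
  refine ⟨h.sim.flip _ fun h' => absurd (h.flip _ h') (lt_irrefl _), ?_, ?_, h.roCount_le,
    h.sigCount_le, h.sig_mem⟩
  · intro i hi
    simp only [simEnv, List.mem_cons, Event.flip.injEq] at hi
    rcases hi with rfl | hi
    · exact Nat.lt_succ_self _
    · exact (h.flip i hi).trans (Nat.lt_succ_self _)
  · simpa [simEnv, askCount, Config.setReg, Event.isAsk] using h.ask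

theorem JointValid.op (o : Op) {c : Config Scheme.Query} {e : Sim} (h : JointValid P j c e) :
    JointValid P j (o.apply c) e := by
  obtain ⟨h1, h2⟩ := o.apply_coins_log c
  exact ⟨h.sim, by rw [h1]; exact h.flip, by rw [h2]; exact h.ask, by rw [h2]; exact h.roCount_le,
    by rw [h2]; exact h.sigCount_le, by rw [h2]; exact h.sig_mem⟩

theorem JointValid.envExec {c : Config Scheme.Query} {e : Sim} (hc : JointValid P j c e)
    (hpk : pk.length = P.T * P.κ) (hsrc : src.Valid P)
    (horc : ∀ l q x, HORS.AnswerLength P q (orc l q x).length) (hj : j ≤ P.J)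
    {p : Prog Scheme.Query} {c' : Config Scheme.Query} {e' : Sim} {n : ℕ}
    (h : EnvExec (simEnv P j pk src orc) p c e c' e' n) :
    JointValid P j c' e' :=
  EnvExec.inv (fun o _ _ h => h.op o) (fun r _ _ h => h.flipBit r)
    (fun q x y _ _ h => h.query hpk hsrc horc hj q x y) h hc

theorem JointValid.start (hJ : 0 < P.J) (hj : 0 < j) :
    JointValid P j (Config.start Scheme.Query []) (Sim.start P) :=
  ⟨Sim.start_valid hJ hj, by simp [Sim.start], by simp [Sim.start, askCount],
    by simp [Sim.start, roCount], by simp [Sim.start, sigCount], by simp [Sim.start]⟩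

/-- The adversary halts when it runs with the simulator. -/
theorem exists_simEnv_exec (hpk : pk.length = P.T * P.κ) (hsrc : src.Valid P)
    (horc : ∀ l q x, HORS.AnswerLength P q (orc l q x).length) (hJ : 0 < P.J) (hj' : 0 < j)
    (hj : j ≤ P.J) {A : Prog Scheme.Query} {t qs qh qb : ℕ} (hA : Scheme.Admissible P t qs qh qb A) :
    ∃ c e n, EnvExec (simEnv P j pk src orc) A (Config.start _ []) (Sim.start P) c e n ∧
      JointValid P j c e ∧ A.size + n ≤ t ∧ Scheme.Budget qs qh qb c.log := by
  obtain ⟨c, e, n, h⟩ := Prog.Bounded.exists_envExec hA (simEnv P j pk src orc) (JointValid P j)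
    -- Default answers: `κ` zeros for a hash value, and the empty string, which is an admissible
    -- refusal, for the other oracles.
    (fun q => match q with | .ro _ => List.replicate P.κ false | _ => [])
    (fun q => by cases q <;> simp [Scheme.AnswerLength]) (fun o _ _ h => h.op o)
    (fun r _ _ h => h.flipBit r) (fun q x y _ _ h => h.query hpk hsrc horc hj q x y)
    (fun q x _ _ h => (simEnv_handled (j := j) hpk hsrc horc q x h.sim.tab).length) _
    (JointValid.start hJ hj')
  exact ⟨c, e, n, h.1, (JointValid.start hJ hj').envExec hpk hsrc horc hj h.1, h.2⟩

end

/-! ### Straight-line programs -/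

def applyOps {Q : Type} : List Op → Config Q → Config Q
  | [], c => c
  | o :: l, c => applyOps l (o.apply c)

def opsCost {Q : Type} : List Op → Config Q → ℕ
  | [], _ => 1
  | o :: l, c => o.cost c + opsCost l (o.apply c)

def Prog.ops {Q : Type} : List Op → Prog Q
  | [] => .skip
  | o :: l => .seq (.op o) (.ops l)

theorem Exec.ops {Q : Type} {coin : ℕ → Bool} {orc : Oracle Q} (l : List Op) (c : Config Q) :
    Exec coin orc (.ops l) c (applyOps l c) (opsCost l c) := by
  induction l generalizing c with
  | nil => exact .skip c
  | cons o l ih => exact .seq (.op o c) (ih _)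

/-- The register written by an operation. -/
def Op.target : Op → Option ℕ
  | .const r _ | .copy r _ | .cat r _ | .take r _ _ | .drop r _ | .inc r | .load r _ => some r
  | .store _ _ => none

theorem applyOps_reg {Q : Type} {r : ℕ} {l : List Op} (c : Config Q)
    (h : ∀ o ∈ l, o.target ≠ some r) : (applyOps l c).reg r = c.reg r := by
  induction l generalizing c with
  | nil => rfl
  | cons o l ih =>
    rw [applyOps, ih _ fun o' ho' => h o' (List.mem_cons_of_mem _ ho')]
    have := h o List.mem_cons_self
    cases o with
    | store => rfl
    | _ =>
      simp only [Op.target, ne_eq, Option.some.injEq] at this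
      simp [Op.apply, Config.setReg, Function.update_of_ne (Ne.symm this)]

/-! ### Layout of the registers and of the memory of the reduction -/

namespace Reg

abbrev pk : ℕ := 0
abbrev zerosκ : ℕ := 1
abbrev zerosτ : ℕ := 2
abbrev full : ℕ := 3
abbrev zerosL : ℕ := 4
abbrev last : ℕ := 5
abbrev target : ℕ := 6
abbrev zerosk : ℕ := 7
abbrev one : ℕ := 8
abbrev empty : ℕ := 9
abbrev cnt : ℕ := 10
abbrev closed : ℕ := 11
abbrev addr : ℕ := 12
abbrev ans : ℕ := 13
abbrev code : ℕ := 14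
abbrev iter : ℕ := 15
abbrev rest : ℕ := 16
abbrev secret : ℕ := 17
abbrev image : ℕ := 18
abbrev tmp : ℕ := 19
abbrev tmp' : ℕ := 20
abbrev bit : ℕ := 21
abbrev ctr : ℕ := 22
abbrev flag : ℕ := 23

end Reg

/-- Contents of the registers `0, …, 11`: constants and the scalar part of the tables. -/
def fixedReg (P : Params) (j : ℕ) (pk : Str) (T : Tab) : ℕ → Str
  | 0 => pk
  | 1 => List.replicate P.κ false
  | 2 => List.replicate P.τ false
  | 3 => List.replicate P.τ false ++ [true]
  | 4 => List.replicate P.J.size false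
  | 5 => P.code P.J
  | 6 => P.code j
  | 7 => List.replicate P.k false
  | 8 => [true]
  | 9 => []
  | 10 => T.cnt
  | 11 => if T.closed then [true] else []
  | _ => []

/-- Contents of the memory: the memory of the adversary, and the tables. -/
def memOf (m : Str → Str) (T : Tab) : Str → Str
  | true :: a => m a
  | false :: true :: p => T.sk p
  | false :: false :: true :: a => T.cell a
  | false :: false :: false :: x => T.h2 x
  | _ => []

/-- The tags `1`, `01`, `001`, `000` form a prefix code, so a write to the memory of the adversary
leaves the tables alone, and conversely. -/
theorem memOf_update (m : Str → Str) (T : Tab) (a w : Str) :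
    Function.update (memOf m T) (true :: a) w = memOf (Function.update m a w) T := by
  funext x
  rcases x with _ | ⟨_ | _, x⟩
  · simp [memOf]
  · rcases x with _ | ⟨_ | _, _ | ⟨_ | _, x⟩⟩ <;> simp [memOf]
  · simp [memOf, Function.update_apply]

theorem memOf_update_sk (m : Str → Str) (T : Tab) (p w : Str) :
    Function.update (memOf m T) (false :: true :: p) w =
      memOf m { T with sk := Function.update T.sk p w } := by
  funext x
  rcases x with _ | ⟨_ | _, _ | ⟨_ | _, _ | ⟨_ | _, x⟩⟩⟩ <;> simp [memOf, Function.update_apply]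

theorem memOf_update_put (m : Str → Str) (T : Tab) (a s v : Str) :
    Function.update (Function.update (memOf m T) (false :: false :: true :: a) s)
      (false :: false :: false :: s) v = memOf m (T.put a s v) := by
  funext x
  rcases x with _ | ⟨_ | _, _ | ⟨_ | _, _ | ⟨_ | _, x⟩⟩⟩ <;>
    simp [memOf, Function.update_apply, Tab.put]

/-- The number of random bits used for an event. -/
def Event.coins (P : Params) : Event → ℕ
  | .ask _ => 0
  | .samp _ => 2 * P.κ
  | .flip _ => 1

def coinCount (P : Params) (h : List Event) : ℕ := (h.map (Event.coins P)).sum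

/-- Samples are taken from a tape of random bits. -/
def tapeSource (P : Params) (coin : ℕ → Bool) : Source where
  pair h _ := (List.ofFn fun b : Fin P.κ => coin (coinCount P h + b),
    List.ofFn fun b : Fin P.κ => coin (coinCount P h + P.κ + b))
  bit h _ := coin (coinCount P h)

theorem tapeSource_valid (P : Params) (coin : ℕ → Bool) : (tapeSource P coin).Valid P :=
  fun _ _ => ⟨by simp [tapeSource], by simp [tapeSource]⟩

/-- The reduction is in a configuration that represents the adversary and the simulator. -/
structure Represents (P : Params) (j : ℕ) (pk : Str) (c : Config Scheme.Query) (e : Sim)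
    (d : Config HORS.Query) : Prop where
  fixed : ∀ r < 12, d.reg r = fixedReg P j pk e.tab r
  reg : ∀ r, d.reg (r + 24) = c.reg r
  mem : d.mem = memOf c.mem e.tab
  coins : d.coins = coinCount P e.rcd.hist
  log : d.log = e.rcd.log

section

variable {P : Params} {j : ℕ} {pk : Str} {c : Config Scheme.Query} {e : Sim}
  {d d' : Config HORS.Query} {coin : ℕ → Bool} {orc : Oracle HORS.Query}

theorem Represents.congr (h : Represents P j pk c e d)
    (hr : ∀ r, r < 12 ∨ 24 ≤ r → d'.reg r = d.reg r) (hm : d'.mem = d.mem)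
    (hc : d'.coins = d.coins) (hl : d'.log = d.log) : Represents P j pk c e d' :=
  ⟨fun r hr' => (hr r (.inl hr')).trans (h.fixed r hr'),
    fun r => (hr _ (.inr (Nat.le_add_left _ _))).trans (h.reg r),
    hm.trans h.mem, hc.trans h.coins, hl.trans h.log⟩

/-- `Runs coin orc p d N R`: program `p`, started in `d`, halts after time at most `N` in a
configuration that satisfies `R`. -/
def Runs (coin : ℕ → Bool) (orc : Oracle HORS.Query) (p : Prog HORS.Query) (d : Config HORS.Query)
    (N : ℕ) (R : Config HORS.Query → Prop) : Prop :=
  ∃ d' n, Exec coin orc p d d' n ∧ n ≤ N ∧ R d'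

/-! ### Sampling -/

def sampleLoop (r : ℕ) : Prog HORS.Query :=
  .loop Reg.ctr Reg.empty (.seq (.flip Reg.bit) (.ops [.cat r Reg.bit, .drop Reg.ctr Reg.one]))

def sampleProg (r : ℕ) : Prog HORS.Query :=
  .seq (.ops [.copy Reg.ctr Reg.zerosκ, .const r []]) (sampleLoop r)

/-- Register `22` is a unary counter, so one round (test, flip, append one bit, drop one bit) has
constant cost. -/
theorem sampleLoop_runs (r : ℕ) (hr : r = 17 ∨ r = 18) (m : ℕ)
    (h8 : d.reg 8 = [true]) (h9 : d.reg 9 = []) (hc : d.reg 22 = List.replicate m false) :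
    Runs coin orc (sampleLoop r) d (8 * m + 1) fun d' =>
      (∀ s, s ≠ r → s ≠ 21 → s ≠ 22 → d'.reg s = d.reg s) ∧
      d'.reg r = d.reg r ++ List.ofFn (fun b : Fin m => coin (d.coins + b)) ∧
      d'.mem = d.mem ∧ d'.coins = d.coins + m ∧ d'.log = d.log := by
  induction m generalizing d with
  | zero =>
    refine ⟨d, _, .loop_done (by rw [hc, h9]; rfl), ?_, ?_⟩
    · simp [h9]
    · simp
  | succ m ih =>
    set d₁ : Config HORS.Query := { d.setReg 21 [coin d.coins] with coins := d.coins + 1 }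
      with hd₁
    set d₂ := applyOps [.cat r 21, .drop 22 8] d₁ with hd₂
    have e1 : ∀ s, s ≠ r → s ≠ 21 → s ≠ 22 → d₂.reg s = d.reg s := by
      intro s hs hs' hs''
      rw [hd₂, applyOps_reg]
      · simp [hd₁, Config.setReg, Function.update_of_ne hs']
      · simp [Op.target, Ne.symm hs, Ne.symm hs'']
    have e2 : d₂.reg r = d.reg r ++ [coin d.coins] := by
      rcases hr with rfl | rfl <;>
        simp [hd₂, hd₁, applyOps, Op.apply, Config.setReg]
    have e3 : d₂.reg 22 = List.replicate m false := by
      rcases hr with rfl | rfl <;>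
        simp [hd₂, hd₁, applyOps, Op.apply, Config.setReg, hc, h8]
    have hr8 : (8 : ℕ) ≠ r ∧ (9 : ℕ) ≠ r := by rcases hr with rfl | rfl <;> simp
    obtain ⟨d₃, n, hex, hn, f1, f2, f3, f4, f5⟩ := ih (d := d₂)
      (by rw [e1 8 hr8.1 (by simp) (by simp), h8]) (by rw [e1 9 hr8.2 (by simp) (by simp), h9]) e3
    refine ⟨d₃, _, .loop_step ?_ (.seq (.flip _ _) (.ops [.cat r 21, .drop 22 8] d₁)) hex, ?_, ?_, ?_, ?_, ?_, ?_⟩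
    · rw [hc, h9]; simp [List.replicate_succ]
    · have : opsCost [.cat r 21, .drop 22 8] d₁ ≤ 5 := by
        rcases hr with rfl | rfl <;>
        simp [hd₁, opsCost, Op.cost, Op.apply, Config.setReg, h8]
      rw [h9]
      simp only [List.length_nil, Nat.min_zero]
      omega
    · intro s h1 h2 h3; rw [f1 s h1 h2 h3, e1 s h1 h2 h3]
    · rw [f2, e2, List.ofFn_succ, List.append_assoc, List.singleton_append]
      have : d₂.coins = d.coins + 1 := rfl
      rw [this]
      simp [Nat.add_assoc, Nat.add_comm 1]
    · rw [f3]; rfl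
    · rw [f4]; change d.coins + 1 + m = _; omega
    · rw [f5]; rfl

theorem sampleProg_runs (r : ℕ) (hr : r = 17 ∨ r = 18)
    (h1 : d.reg 1 = List.replicate P.κ false) (h8 : d.reg 8 = [true]) (h9 : d.reg 9 = []) :
    Runs coin orc (sampleProg r) d (9 * P.κ + 4) fun d' =>
      (∀ s, s ≠ r → s ≠ 21 → s ≠ 22 → d'.reg s = d.reg s) ∧
      d'.reg r = List.ofFn (fun b : Fin P.κ => coin (d.coins + b)) ∧
      d'.mem = d.mem ∧ d'.coins = d.coins + P.κ ∧ d'.log = d.log := by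
  set d₁ := applyOps [.copy 22 1, .const r []] d with hd₁
  have e1 : ∀ s, s ≠ r → s ≠ 21 → s ≠ 22 → d₁.reg s = d.reg s := by
    intro s hs hs' hs''
    exact applyOps_reg _ (by simp [Op.target, Ne.symm hs, Ne.symm hs''])
  have hr8 : (8 : ℕ) ≠ r ∧ (9 : ℕ) ≠ r := by rcases hr with rfl | rfl <;> simp
  have e2 : d₁.reg r = [] := by simp [hd₁, applyOps, Op.apply, Config.setReg]
  have e3 : d₁.reg 22 = List.replicate P.κ false := by
    rcases hr with rfl | rfl <;>
      simp [hd₁, applyOps, Op.apply, Config.setReg, h1]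
  obtain ⟨d₂, n, hex, hn, f1, f2, f3, f4, f5⟩ := sampleLoop_runs (coin := coin) (orc := orc) r hr P.κ
    (by rw [e1 8 hr8.1 (by simp) (by simp), h8]) (by rw [e1 9 hr8.2 (by simp) (by simp), h9]) e3
  refine ⟨d₂, _, .seq (.ops [.copy 22 1, .const r []] d) hex, ?_, ?_, ?_, f3, f4, f5⟩
  · simp [opsCost, Op.cost, h1]
    omega
  · intro s h1 h2 h3; rw [f1 s h1 h2 h3, e1 s h1 h2 h3]
  · rw [f2, e2]; rfl

/-! ### Tables -/

def ensureProg : Prog HORS.Query :=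
  .seq (.ops [.const Reg.tmp [false, false, true], .cat Reg.tmp Reg.addr,
      .load Reg.secret Reg.tmp])
    (.ifEq Reg.secret Reg.empty
      (.seq (sampleProg Reg.secret) (.seq (sampleProg Reg.image)
        (.ops [.store Reg.tmp Reg.secret, .const Reg.tmp' [false, false, false],
          .cat Reg.tmp' Reg.secret, .store Reg.tmp' Reg.image])))
      .skip)

theorem Tab.Valid.length_cell_le {T : Tab} {h : List Event} (hT : T.Valid P h) (a : Str) :
    (T.cell a).length ≤ P.κ := by
  rcases hT.cell a with h | h
  · simp [h]
  · exact h.1.le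

theorem Tab.Valid.length_h2_le {T : Tab} {h : List Event} (hT : T.Valid P h) (a : Str) :
    (T.h2 a).length ≤ P.κ := by
  rcases hT.h2 a with h | h
  · simp [h]
  · exact h.le

theorem Tab.Valid.length_sk_le {T : Tab} {h : List Event} (hT : T.Valid P h) (a : Str) :
    (T.sk a).length ≤ P.J.size := by
  rcases hT.sk a with h | ⟨m, _, _, h⟩
  · simp [h]
  · simp [h]

theorem Tab.Valid.length_cnt {T : Tab} {h : List Event} (hT : T.Valid P h) :
    T.cnt.length = P.J.size := by
  obtain ⟨n, _, h, _⟩ := hT.cnt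
  simp [h]

/-- A lookup costs the lengths of address and entry, and a miss costs `2κ` coin flips with constant
overhead. Addresses of at most `2κ` bits make the total `O(κ)`. The coins are consumed in the order
string, then image, as `tapeSource` prescribes. -/
theorem ensureProg_runs (hR : Represents P j pk c e d) (hv : e.tab.Valid P e.rcd.hist) {a : Str}
    (ha : d.reg 12 = a) (hl : a.length ≤ 2 * P.κ) :
    Runs coin orc ensureProg d (80 * P.κ) fun d' =>
      Represents P j pk c ⟨((ensure e.tab a).run (tapeSource P coin) orc e.rcd).1,
        ((ensure e.tab a).run (tapeSource P coin) orc e.rcd).2⟩ d' ∧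
      d'.reg 17 = ((ensure e.tab a).run (tapeSource P coin) orc e.rcd).1.cell a ∧
      ∀ r < 17, d'.reg r = d.reg r := by
  have hκ := P.κ_pos
  set l₀ : List Op := [.const 19 [false, false, true], .cat 19 12, .load 17 19] with hl₀
  set d₁ := applyOps l₀ d with hd₁
  have e1 : ∀ s, s ≠ 19 → s ≠ 17 → d₁.reg s = d.reg s := by
    intro s h1 h2
    exact applyOps_reg _ (by simp [hl₀, Op.target]; omega)
  have e2 : d₁.reg 19 = false :: false :: true :: a := by
    simp [hd₁, hl₀, applyOps, Op.apply, Config.setReg, ← ha]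
  have e3 : d₁.reg 17 = e.tab.cell a := by
    simp [hd₁, hl₀, applyOps, Op.apply, Config.setReg, hR.mem, ha, memOf]
  have hcost : opsCost l₀ d ≤ 10 + 5 * P.κ := by
    have := hv.length_cell_le a
    simp [hl₀, opsCost, Op.cost, Op.apply, Config.setReg, hR.mem, ha, memOf]
    omega
  have h9 : d₁.reg 9 = [] := by rw [e1 9 (by simp) (by simp), hR.fixed 9 (by simp)]; rfl
  by_cases hne : e.tab.cell a = []
  · have hrun : (ensure e.tab a).run (tapeSource P coin) orc e.rcd =
        (e.tab.put a (List.ofFn fun b : Fin P.κ => coin (coinCount P e.rcd.hist + b))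
          (List.ofFn fun b : Fin P.κ => coin (coinCount P e.rcd.hist + P.κ + b)),
          ⟨.samp a :: e.rcd.hist, e.rcd.log⟩) := by
      simp [ensure, hne, Handler.run, tapeSource]
    obtain ⟨d₂, n₂, hex₂, hn₂, f1, f2, f3, f4, f5⟩ := sampleProg_runs (d := d₁) (P := P)
      (coin := coin) (orc := orc) 17
      (.inl rfl) (by rw [e1 1 (by simp) (by simp), hR.fixed 1 (by simp)]; rfl)
      (by rw [e1 8 (by simp) (by simp), hR.fixed 8 (by simp)]; rfl) h9
    have e1' : ∀ s, s < 17 ∨ 24 ≤ s → d₂.reg s = d.reg s := by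
      intro s hs
      rw [f1 s (by simp; omega) (by simp; omega) (by simp; omega), e1 s (by simp; omega)
        (by simp; omega)]
    obtain ⟨d₃, n₃, hex₃, hn₃, g1, g2, g3, g4, g5⟩ := sampleProg_runs (d := d₂) (P := P)
      (coin := coin) (orc := orc) 18
      (.inr rfl) (by rw [e1' 1 (by simp), hR.fixed 1 (by simp)]; rfl)
      (by rw [e1' 8 (by simp), hR.fixed 8 (by simp)]; rfl)
      (by rw [e1' 9 (by simp), hR.fixed 9 (by simp)]; rfl)
    set l : List Op := [.store 19 17, .const 20 [false, false, false],
          .cat 20 17, .store 20 18] with hl4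
    set d₄ := applyOps l d₃ with hd₄
    have h1 : d₁.coins = coinCount P e.rcd.hist := hR.coins
    have k1 : ∀ s, s < 17 ∨ 24 ≤ s → d₄.reg s = d.reg s := by
      intro s hs
      rw [hd₄, applyOps_reg _ (by simp [hl4, Op.target]; omega),
        g1 s (by simp; omega) (by simp; omega) (by simp; omega), e1' s hs]
    have s3 : d₃.reg 17 =
        List.ofFn fun b : Fin P.κ => coin (coinCount P e.rcd.hist + b) := by
      rw [g1 _ (by simp) (by simp) (by simp), f2, h1]
    have t3 : d₃.reg 19 = false :: false :: true :: a := by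
      rw [g1 _ (by simp) (by simp) (by simp), f1 _ (by simp) (by simp) (by simp), e2]
    have i3 : d₃.reg 18 =
        List.ofFn fun b : Fin P.κ => coin (coinCount P e.rcd.hist + P.κ + b) := by
      rw [g2, f4, h1]
    have k2 : d₄.reg 17 =
        List.ofFn fun b : Fin P.κ => coin (coinCount P e.rcd.hist + b) := by
      rw [hd₄, applyOps_reg _ (by simp [hl4, Op.target]), s3]
    have k3 : d₄.mem = memOf c.mem (e.tab.put a
        (List.ofFn fun b : Fin P.κ => coin (coinCount P e.rcd.hist + b))
          (List.ofFn fun b : Fin P.κ => coin (coinCount P e.rcd.hist + P.κ + b))) := by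
      rw [← memOf_update_put, ← hR.mem]
      have : d.mem = d₃.mem := by rw [g3, f3]; rfl
      simp [hd₄, hl4, applyOps, Op.apply, Config.setReg, s3, t3, i3, this]
    have hc4 : opsCost l d₃ ≤ 7 * P.κ + 20 := by
      simp [hl4, opsCost, Op.cost, Op.apply, Config.setReg, s3, t3, i3]
      omega
    refine ⟨d₄, _, .seq (.ops l₀ d) (.ifEq_true (r := 17) (s := 9) ?_ (.seq hex₂ (.seq hex₃ (.ops l d₃)))), ?_, ?_, ?_, ?_⟩
    · exact (e3.trans hne).trans h9.symm
    · have : (d₁.reg 17).length = 0 := by rw [e3, hne]; rfl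
      rw [this]
      simp only [Nat.zero_min]
      omega
    · rw [hrun]
      refine ⟨fun r hr => ?_, fun r => ?_, k3, ?_, ?_⟩
      · rw [k1 r (by omega), hR.fixed r hr]; rfl
      · rw [k1 _ (by simp), hR.reg]
      · change d₃.coins = _
        rw [g4, f4, h1]
        simp [coinCount, Event.coins]; omega
      · change d₃.log = _
        rw [g5, f5]; exact hR.log
    · rw [hrun, k2]; simp [Tab.put]
    · intro r hr; exact k1 r (.inl hr)
  · have hrun : (ensure e.tab a).run (tapeSource P coin) orc e.rcd = (e.tab, e.rcd) := by
      simp [ensure, hne, Handler.run]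
    refine ⟨d₁, _, .seq (.ops l₀ d) (.ifEq_false (r := 17) (s := 9) ?_ (.skip _)), ?_, ?_, ?_, ?_⟩
    · rw [e3]; exact fun h => hne (h.trans h9)
    · rw [h9]; simp only [List.length_nil, Nat.min_zero]; omega
    · rw [hrun]
      exact hR.congr (fun r hr => e1 r (by simp at hr ⊢; omega) (by simp at hr ⊢; omega)) rfl rfl rfl
    · rw [hrun, e3]
    · intro r hr; exact e1 r (by simp; omega) (by simp; omega)

end

/-! ### Rules for reasoning about running time, and the programs for the random oracles -/

section

variable {P : Params} {j : ℕ} {pk : Str} {c : Config Scheme.Query} {e : Sim}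
  {d d' : Config HORS.Query} {coin : ℕ → Bool} {orc : Oracle HORS.Query}
  {R R' : Config HORS.Query → Prop} {p p' : Prog HORS.Query} {N N' M : ℕ}

theorem Runs.mono (h : Runs coin orc p d N R) (hN : N ≤ N') (hR : ∀ d', R d' → R' d') :
    Runs coin orc p d N' R' := by
  obtain ⟨d', n, h, hn, hd⟩ := h
  exact ⟨d', n, h, hn.trans hN, hR _ hd⟩

theorem Runs.seq (h : Runs coin orc p d N fun d₁ => Runs coin orc p' d₁ N' R) (hN : N + N' ≤ M) :
    Runs coin orc (.seq p p') d M R := by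
  obtain ⟨d₁, n, h, hn, d₂, n', h', hn', hR⟩ := h
  exact ⟨d₂, _, .seq h h', by omega, hR⟩

theorem Runs.ops {l : List Op} (hN : opsCost l d ≤ N) (hR : R (applyOps l d)) :
    Runs coin orc (.ops l) d N R :=
  ⟨_, _, .ops l d, hN, hR⟩

theorem Runs.skip (hN : 1 ≤ N) (hR : R d) : Runs coin orc .skip d N R := ⟨d, 1, .skip d, hN, hR⟩

theorem Runs.ifEq {r s : ℕ} (h : d.reg r = d.reg s → Runs coin orc p d N R)
    (h' : d.reg r ≠ d.reg s → Runs coin orc p' d N R)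
    (hN : 1 + min (d.reg r).length (d.reg s).length + N ≤ M) :
    Runs coin orc (.ifEq r s p p') d M R := by
  by_cases hrs : d.reg r = d.reg s
  · obtain ⟨d', n, h, hn, hR⟩ := h hrs
    exact ⟨d', _, .ifEq_true hrs h, by omega, hR⟩
  · obtain ⟨d', n, h, hn, hR⟩ := h' hrs
    exact ⟨d', _, .ifEq_false hrs h, by omega, hR⟩

theorem Runs.ifLt {r s : ℕ} (h : val (d.reg r) < val (d.reg s) → Runs coin orc p d N R)
    (h' : ¬ val (d.reg r) < val (d.reg s) → Runs coin orc p' d N R)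
    (hN : 1 + (d.reg r).length + (d.reg s).length + N ≤ M) :
    Runs coin orc (.ifLt r s p p') d M R := by
  by_cases hrs : val (d.reg r) < val (d.reg s)
  · obtain ⟨d', n, h, hn, hR⟩ := h hrs
    exact ⟨d', _, .ifLt_true hrs h, by omega, hR⟩
  · obtain ⟨d', n, h, hn, hR⟩ := h' hrs
    exact ⟨d', _, .ifLt_false hrs h, by omega, hR⟩

theorem applyOps_coins_log (l : List Op) (d : Config HORS.Query) :
    (applyOps l d).coins = d.coins ∧ (applyOps l d).log = d.log := by
  induction l generalizing d with
  | nil => exact ⟨rfl, rfl⟩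
  | cons o l ih =>
    rw [applyOps, (ih _).1, (ih _).2]
    exact o.apply_coins_log d

theorem applyOps_mem {l : List Op} (d : Config HORS.Query) (h : ∀ o ∈ l, o.target ≠ none) :
    (applyOps l d).mem = d.mem := by
  induction l generalizing d with
  | nil => rfl
  | cons o l ih =>
    rw [applyOps, ih _ fun o' ho' => h o' (List.mem_cons_of_mem _ ho')]
    have := h o List.mem_cons_self
    cases o with
    | store => exact absurd rfl this
    | _ => rfl

/-- Registers `12` to `23` are scratch space and take no part in the representation. -/
theorem Represents.ops (h : Represents P j pk c e d) {l : List Op}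
    (hl : ∀ o ∈ l, ∃ r, o.target = some r ∧ 12 ≤ r ∧ r < 24) :
    Represents P j pk c e (applyOps l d) := by
  refine h.congr (fun r hr => applyOps_reg _ fun o ho ho' => ?_) (applyOps_mem _ fun o ho ho' => ?_)
    (applyOps_coins_log l d).1 (applyOps_coins_log l d).2
  · obtain ⟨s, hs, h1, h2⟩ := hl o ho
    rw [hs, Option.some.injEq] at ho'
    omega
  · obtain ⟨s, hs, h1, h2⟩ := hl o ho
    rw [hs] at ho'
    exact absurd ho' (by simp)

/-- The reduction has put the result of a computation of the simulator in the answer register. -/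
def Answered (P : Params) (j : ℕ) (pk : Str) (c : Config Scheme.Query) (coin : ℕ → Bool)
    (orc : Oracle HORS.Query) (h : Handler (Str × Tab)) (w : Record) (d' : Config HORS.Query) :
    Prop :=
  Represents P j pk c ⟨(h.run (tapeSource P coin) orc w).1.2,
    (h.run (tapeSource P coin) orc w).2⟩ d' ∧
    d'.reg 13 = (h.run (tapeSource P coin) orc w).1.1

theorem Answered.of_run {h : Handler (Str × Tab)} {w w' : Record} {r : Str × Tab}
    (hr : h.run (tapeSource P coin) orc w = (r, w')) (hd : Represents P j pk c ⟨r.2, w'⟩ d')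
    (ha : d'.reg 13 = r.1) : Answered P j pk c coin orc h w d' := by
  unfold Answered; rw [hr]; exact ⟨hd, ha⟩

/-! ### Forwarded queries -/

theorem Represents.query (hR : Represents P j pk c e d) (q : HORS.Query) (x y : ℕ) (hy : 12 ≤ y)
    (hy' : y < 24) :
    Represents P j pk c ⟨e.tab, ⟨e.rcd.hist, (q, d.reg x) :: e.rcd.log⟩⟩
      { d.setReg y (orc d.log q (d.reg x)) with log := (q, d.reg x) :: d.log } := by
  refine ⟨fun r hr => ?_, fun r => ?_, hR.mem, hR.coins, ?_⟩
  · simp only [Config.setReg]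
    rw [Function.update_of_ne (by omega), hR.fixed r hr]
  · simp only [Config.setReg]
    rw [Function.update_of_ne (by omega), hR.reg]
  · simp [hR.log]

theorem forward_runs (hR : Represents P j pk c e d) (q : HORS.Query) (x : ℕ)
    (hq : (orc d.log q (d.reg x)).length ≤ M) :
    Runs coin orc (.query q x Reg.ans) d (1 + (d.reg x).length + M)
      (Answered P j pk c coin orc (forward q (d.reg x) e.tab) e.rcd) := by
  refine ⟨_, _, .query q x 13 d, by omega, ?_⟩
  refine .of_run (r := (orc d.log q (d.reg x), e.tab)) ?_ (hR.query q x 13 (by simp) (by simp)) ?_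
  · simp [forward, Handler.run, hR.log]
  · simp [Config.setReg]

/-! ### Revealed keys -/

def nextKeyProg : Prog HORS.Query :=
  .seq ensureProg (.ops [.copy Reg.flag Reg.addr, .inc Reg.flag, .const Reg.tmp' [false, true],
    .cat Reg.tmp' Reg.secret, .store Reg.tmp' Reg.flag])

theorem tab_ensured (hv : e.tab.Valid P e.rcd.hist) (a : Str) :
    e.tab.Ensured P e.rcd a ((ensure e.tab a).run (tapeSource P coin) orc e.rcd).1
      ((ensure e.tab a).run (tapeSource P coin) orc e.rcd).2 :=
  (ensure_spec (W := fun _ _ _ _ => True) hv a).run (tapeSource_valid P coin) fun _ _ _ => trivial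

theorem nextKeyProg_runs (hR : Represents P j pk c e d) (hv : e.tab.Valid P e.rcd.hist) {a : Str}
    (ha : d.reg Reg.addr = a) (hl : a.length ≤ P.κ) :
    Runs coin orc nextKeyProg d (100 * P.κ) fun d' =>
      Represents P j pk c ⟨((nextKey e.tab a).run (tapeSource P coin) orc e.rcd).1.2,
        ((nextKey e.tab a).run (tapeSource P coin) orc e.rcd).2⟩ d' ∧
      d'.reg 17 = ((nextKey e.tab a).run (tapeSource P coin) orc e.rcd).1.1 ∧
      ∀ r < 17, d'.reg r = d.reg r := by
  have hκ := P.κ_pos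
  refine Runs.seq (N' := 20 * P.κ)
    ((ensureProg_runs (coin := coin) (orc := orc) hR hv ha (by omega)).mono le_rfl ?_)
    (by omega)
  rintro d₁ ⟨h1, h2, h3⟩
  have hE := tab_ensured (coin := coin) (orc := orc) hv a
  have hrun : (nextKey e.tab a).run (tapeSource P coin) orc e.rcd =
      (let r := (ensure e.tab a).run (tapeSource P coin) orc e.rcd
       ((r.1.cell a, { r.1 with sk := Function.update r.1.sk (r.1.cell a) (incr a) }), r.2)) := by
    simp [nextKey, Handler.run_bind, Handler.run]
  rw [hrun]
  generalize (ensure e.tab a).run (tapeSource P coin) orc e.rcd = r at h1 h2 hE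
  have ha1 : d₁.reg 12 = a := (h3 12 (by simp)).trans ha
  refine Runs.ops (l := [.copy 23 12, .inc 23, .const 20 [false, true], .cat 20 17, .store 20 23])
    ?_ ⟨⟨?_, ?_, ?_, ?_, ?_⟩, ?_, ?_⟩
  · have h4 := length_incr_le a
    have h5 : (r.1.cell a).length = P.κ := hE.length
    simp [opsCost, Op.cost, Op.apply, Config.setReg, ha1, h2, h5]
    omega
  · intro s hs
    rw [applyOps_reg _ (by simp [Op.target]; omega), h1.fixed s hs]
    rfl
  · intro s
    rw [applyOps_reg _ (by simp [Op.target]), h1.reg]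
  · simp [applyOps, Op.apply, Config.setReg, ha1, h2, h1.mem, memOf_update_sk]
  · exact h1.coins
  · exact h1.log
  · rw [applyOps_reg _ (by simp [Op.target]), h2]
  · intro s hs
    rw [applyOps_reg _ (by simp [Op.target]; omega), h3 s hs]

/-! ### Random oracles -/

/-- That the rest of the question has exactly `τ` bits is decided by comparing strings. Cutting `τ`
zeros to the length of the rest leaves them unchanged iff the rest has at least `τ` bits; cutting
the rest to `τ` bits leaves it unchanged iff it has at most `τ`. -/
def ro1Prog (x : ℕ) : Prog HORS.Query :=
  .seq (.ops [.take Reg.tmp x Reg.zerosκ, .const Reg.tmp' [false, true], .cat Reg.tmp' Reg.tmp,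
      .load Reg.code Reg.tmp', .copy Reg.rest x, .drop Reg.rest Reg.zerosκ])
    (.ifEq Reg.code Reg.empty (.query (.ro 1) x Reg.ans)
      (.ifEq Reg.rest Reg.empty
        (.ifEq Reg.code Reg.last (.query (.ro 1) x Reg.ans)
          (.seq (.ops [.copy Reg.addr Reg.code])
            (.seq nextKeyProg (.ops [.copy Reg.ans Reg.secret]))))
        (.seq (.ops [.take Reg.tmp Reg.zerosτ Reg.rest])
          (.ifEq Reg.tmp Reg.zerosτ
            (.seq (.ops [.take Reg.tmp Reg.rest Reg.zerosτ])
              (.ifEq Reg.tmp Reg.rest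
                (.seq (.ops [.copy Reg.addr Reg.code, .cat Reg.addr Reg.rest])
                  (.seq ensureProg (.ops [.copy Reg.ans Reg.secret])))
                (.query (.ro 1) x Reg.ans)))
            (.query (.ro 1) x Reg.ans)))))

def ro2Prog (x : ℕ) : Prog HORS.Query :=
  .seq (.ops [.const Reg.tmp [false, false, false], .cat Reg.tmp x, .load Reg.ans Reg.tmp])
    (.ifEq Reg.ans Reg.empty (.query (.ro 2) x Reg.ans) .skip)

def roProg (x : ℕ) : Fin 3 → Prog HORS.Query
  | 0 => .query (.ro 0) x Reg.ans
  | 1 => ro1Prog x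
  | 2 => ro2Prog x

/-- Lengths of codes and answers of the oracles. -/
structure Lengths (P : Params) (pk : Str) (orc : Oracle HORS.Query) : Prop where
  size : P.J.size ≤ P.κ
  pk : pk.length = P.T * P.κ
  orc : ∀ l q x, HORS.AnswerLength P q (orc l q x).length

theorem Lengths.ro (h : Lengths P pk orc) (l : List (HORS.Query × Str)) (i : Fin 3) (x : Str) :
    (orc l (.ro i) x).length = P.κ :=
  h.orc l (.ro i) x

theorem ro1Prog_runs (hR : Represents P j pk c e d) (hv : e.tab.Valid P e.rcd.hist)
    (hlen : Lengths P pk orc) (x : ℕ) :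
    Runs coin orc (ro1Prog (x + 24)) d (200 * ((c.reg x).length + P.κ))
      (Answered P j pk c coin orc (handleRo P (c.reg x) e.tab 1) e.rcd) := by
  have hκ := P.κ_pos
  have hτ := P.τ_le_κ
  have hs := hlen.size
  have hx := hR.reg x
  generalize hxs : c.reg x = xs at hx ⊢
  generalize hX : x + 24 = X at hx ⊢
  have hX' : 24 ≤ X := by omega
  have f1 := hR.fixed 1 (by simp)
  simp only [fixedReg] at f1
  set l : List Op := [.take 19 X 1, .const 20 [false, true], .cat 20 19, .load 14 20, .copy 16 X,
    .drop 16 1] with hl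
  refine Runs.seq (p := .ops l) (N := 6 * P.κ + 11 + xs.length) (N' := 180 * P.κ + xs.length * 20)
    (Runs.ops ?_ ?_) (by ring_nf; omega)
  · have hsk := hv.length_sk_le (xs.take P.κ)
    have hX19 : X ≠ 19 := by omega
    have hX20 : X ≠ 20 := by omega
    have hX14 : X ≠ 14 := by omega
    simp [hl, opsCost, Op.cost, Op.apply, Config.setReg, f1, hx, hR.mem, memOf, hX19, hX20, hX14]
    omega
  have hR₁ : Represents P j pk c e (applyOps l d) := hR.ops (by simp [hl, Op.target])
  have e1 : (applyOps l d).reg 14 = e.tab.sk (xs.take P.κ) := by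
    simp [hl, applyOps, Op.apply, Config.setReg, f1, hx, hR.mem, memOf]
  have e2 : (applyOps l d).reg 16 = xs.drop P.κ := by
    have hX19 : X ≠ 19 := by omega
    have hX20 : X ≠ 20 := by omega
    have hX14 : X ≠ 14 := by omega
    simp [hl, applyOps, Op.apply, Config.setReg, f1, hx, hX19, hX20, hX14]
  generalize applyOps l d = d₁ at hR₁ e1 e2
  clear hR hl f1 hx
  have fwd : ∀ {d₁}, Represents P j pk c e d₁ → Runs coin orc (.query (.ro 1) X Reg.ans) d₁
      (1 + xs.length + P.κ) (Answered P j pk c coin orc (forward (.ro 1) xs e.tab) e.rcd) := by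
    intro d₁ hR₁
    have hx : d₁.reg X = xs := by rw [← hX, hR₁.reg, hxs]
    have := forward_runs (coin := coin) (orc := orc) (M := P.κ) hR₁ (.ro 1) X (hlen.ro _ _ _).le
    rwa [hx] at this
  have f9 := hR₁.fixed 9 (by simp)
  have f5 := hR₁.fixed 5 (by simp)
  have f2 := hR₁.fixed 2 (by simp)
  simp only [fixedReg] at f9 f5 f2
  have hsk := hv.length_sk_le (xs.take P.κ)
  refine Runs.ifEq (N := 170 * P.κ + xs.length * 10) (fun h => ?_) (fun h => ?_)
    (by simp [f9]; omega)
  · rw [e1, f9] at h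
    simp only [handleRo, h, if_true]
    exact (fwd hR₁).mono (by omega) fun _ h => h
  rw [e1, f9] at h
  refine Runs.ifEq (N := 160 * P.κ + xs.length * 10) (fun h2 => ?_) (fun h2 => ?_)
    (by simp [f9]; omega)
  · rw [e2, f9] at h2
    refine Runs.ifEq (N := 150 * P.κ + xs.length * 10) (fun h3 => ?_) (fun h3 => ?_)
      (by simp [e1, f5]; omega)
    · rw [e1, f5] at h3
      simp only [handleRo, h2, if_true, h3]
      rw [if_neg (by rw [← h3]; exact h)]
      exact (fwd hR₁).mono (by omega) fun _ h => h
    · rw [e1, f5] at h3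
      simp only [handleRo, h, h2, if_true, if_false, h3]
      refine Runs.seq (p := .ops [.copy 12 14]) (N := P.κ + 2) (N' := 140 * P.κ)
        (Runs.ops ?_ ?_) (by omega)
      · simp [opsCost, Op.cost, e1]; omega
      refine Runs.seq (N' := 10 * P.κ) ((nextKeyProg_runs (a := e.tab.sk (xs.take P.κ))
        (hR₁.ops (by simp [Op.target])) hv ?_ ?_).mono le_rfl ?_) (by omega)
      · simp [applyOps, Op.apply, Config.setReg, e1]
      · omega
      · rintro d₂ ⟨g1, g2, g3⟩
        obtain ⟨m, _, hm, hm'⟩ := (hv.sk (xs.take P.κ)).resolve_left h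
        have hlt : m < P.J := lt_of_le_of_ne hm fun h => h3 (by rw [hm', h])
        have hsp := (nextKey_spec (W := fun _ _ _ _ => True) hv hlt).run (tapeSource_valid P coin)
          (orc := orc) fun _ _ _ => trivial
        rw [← hm'] at hsp
        refine Runs.ops (l := [.copy 13 17]) ?_ ⟨g1.ops (by simp [Op.target]), ?_⟩
        · simp [opsCost, Op.cost, g2, hsp.2.2.1]; omega
        · simp [applyOps, Op.apply, Config.setReg, g2]
  · rw [e2, f9] at h2
    have hdl : (xs.drop P.κ).length ≤ xs.length := by simp
    refine Runs.seq (p := .ops [.take 19 2 16]) (N := xs.length + 2)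
      (N' := 150 * P.κ + xs.length * 5) (Runs.ops ?_ ?_) (by omega)
    · simp [opsCost, Op.cost, e2]; omega
    have hR₂ : Represents P j pk c e (applyOps [.take 19 2 16] d₁) :=
      hR₁.ops (by simp [Op.target])
    have g1 : (applyOps [.take 19 2 16] d₁).reg 14 = e.tab.sk (xs.take P.κ) := by
      rw [applyOps_reg _ (by simp [Op.target]), e1]
    have g2 : (applyOps [.take 19 2 16] d₁).reg 16 = xs.drop P.κ := by
      rw [applyOps_reg _ (by simp [Op.target]), e2]
    have g3 : (applyOps [.take 19 2 16] d₁).reg 19 =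
        (List.replicate P.τ false).take (xs.drop P.κ).length := by
      simp [applyOps, Op.apply, Config.setReg, f2, e2]
    have g4 : (applyOps [.take 19 2 16] d₁).reg 2 = List.replicate P.τ false := by
      rw [applyOps_reg _ (by simp [Op.target]), f2]
    generalize applyOps [.take 19 2 16] d₁ = d₂ at hR₂ g1 g2 g3 g4
    have hbranch : (List.replicate P.τ false).take (xs.drop P.κ).length = List.replicate P.τ false ↔
        P.τ ≤ (xs.drop P.κ).length := by
      rw [List.take_replicate]
      constructor
      · intro h; have := congrArg List.length h; simp at this ⊢; omega
      · intro h; rw [min_eq_right h]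
    refine Runs.ifEq (N := 140 * P.κ + xs.length * 5) (fun h3 => ?_) (fun h3 => ?_)
      (by simp only [Reg.tmp, Reg.zerosτ, g3, g4, List.length_replicate]; omega)
    · have h3 := hbranch.1 (by rw [← g3, ← g4]; exact h3)
      refine Runs.seq (p := .ops [.take 19 16 2]) (N := P.κ + 2)
        (N' := 130 * P.κ + xs.length * 3) (Runs.ops ?_ ?_) (by omega)
      · simp [opsCost, Op.cost, g4]; omega
      have hR₃ : Represents P j pk c e (applyOps [.take 19 16 2] d₂) :=
        hR₂.ops (by simp [Op.target])
      have k1 : (applyOps [.take 19 16 2] d₂).reg 14 = e.tab.sk (xs.take P.κ) := by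
        rw [applyOps_reg _ (by simp [Op.target]), g1]
      have k2 : (applyOps [.take 19 16 2] d₂).reg 16 = xs.drop P.κ := by
        rw [applyOps_reg _ (by simp [Op.target]), g2]
      have k3 : (applyOps [.take 19 16 2] d₂).reg 19 = (xs.drop P.κ).take P.τ := by
        simp [applyOps, Op.apply, Config.setReg, g2, g4]
      generalize applyOps [.take 19 16 2] d₂ = d₃ at hR₃ k1 k2 k3
      refine Runs.ifEq (N := 120 * P.κ + xs.length * 3) (fun h4 => ?_) (fun h4 => ?_)
        (by simp only [Reg.tmp, Reg.rest, k3, k2, List.length_take]; omega)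
      · have h4 : (xs.drop P.κ).take P.τ = xs.drop P.κ := by rw [← k3]; exact h4.trans k2
        have hlen' : (xs.drop P.κ).length = P.τ := by
          have := congrArg List.length h4
          rw [List.length_take] at this
          omega
        simp only [handleRo, h, h2, if_false, hlen', if_true]
        refine Runs.seq (p := .ops [.copy 12 14, .cat 12 16]) (N := 2 * P.κ + 3) (N' := 110 * P.κ)
          (Runs.ops ?_ ?_) (by omega)
        · rw [List.length_drop] at hlen'
          simp [opsCost, Op.cost, Op.apply, Config.setReg, k1, k2, hlen']
          omega
        refine Runs.seq (N' := 10 * P.κ) ((ensureProg_runs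
          (a := e.tab.sk (xs.take P.κ) ++ xs.drop P.κ)
          (hR₃.ops (by simp [Op.target])) hv ?_ ?_).mono le_rfl ?_) (by omega)
        · simp [applyOps, Op.apply, Config.setReg, k1, k2]
        · rw [List.length_append, hlen']; omega
        · rintro d₄ ⟨m1, m2, m3⟩
          have hE := tab_ensured (coin := coin) (orc := orc) hv
            (e.tab.sk (xs.take P.κ) ++ xs.drop P.κ)
          refine Runs.ops (l := [.copy 13 17]) ?_ ?_
          · simp [opsCost, Op.cost, m2, hE.length]; omega
          · have m1 := m1.ops (l := [.copy 13 17]) (by simp [Op.target])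
            refine .of_run (by simp only [Handler.run_bind, Handler.run]; rfl) m1 ?_
            simp [applyOps, Op.apply, Config.setReg, m2]
      · have hlen' : ¬ (xs.drop P.κ).length = P.τ := by
          intro hlen'
          apply h4
          change d₃.reg 19 = d₃.reg 16
          rw [k3, k2, ← hlen', List.take_length]
        simp only [handleRo, h, h2, if_false, hlen']
        exact (fwd hR₃).mono (by omega) fun _ h => h
    · have hlen' : ¬ (xs.drop P.κ).length = P.τ := by
        intro hlen'
        exact h3 (by change d₂.reg 19 = d₂.reg 2; rw [g3, g4]; exact hbranch.2 hlen'.ge)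
      simp only [handleRo, h, h2, if_false, hlen']
      exact (fwd hR₂).mono (by omega) fun _ h => h

theorem roProg_runs (hR : Represents P j pk c e d) (hv : e.tab.Valid P e.rcd.hist)
    (hlen : Lengths P pk orc) (x : ℕ) (i : Fin 3) :
    Runs coin orc (roProg (x + 24) i) d (200 * ((c.reg x).length + P.κ))
      (Answered P j pk c coin orc (handleRo P (c.reg x) e.tab i) e.rcd) := by
  have hκ := P.κ_pos
  match i with
  | 0 =>
    have := forward_runs (coin := coin) (orc := orc) (M := P.κ) hR (.ro 0) (x + 24)
      (hlen.ro _ _ _).le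
    rw [hR.reg] at this
    exact this.mono (by omega) fun _ h => h
  | 1 => exact ro1Prog_runs hR hv hlen x
  | 2 =>
    have hx := hR.reg x
    have f9 := hR.fixed 9 (by simp)
    have hh2 := hv.length_h2_le (c.reg x)
    refine Runs.seq (p := .ops [.const 19 [false, false, false], .cat 19 (x + 24), .load 13 19])
      (N := 2 * (c.reg x).length + P.κ + 20) (N' := 20 * P.κ + (c.reg x).length)
      (Runs.ops ?_ ?_) (by omega)
    · simp [opsCost, Op.cost, Op.apply, Config.setReg, hx, hR.mem, memOf]
      omega
    set d₁ := applyOps [.const 19 [false, false, false], .cat 19 (x + 24), .load 13 19] d with hd₁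
    have hR₁ : Represents P j pk c e d₁ := hR.ops (by simp [Op.target])
    have e1 : d₁.reg 13 = e.tab.h2 (c.reg x) := by
      simp [hd₁, applyOps, Op.apply, Config.setReg, hx, hR.mem, memOf]
    have f9 := hR₁.fixed 9 (by simp)
    simp only [fixedReg] at f9
    refine Runs.ifEq (N := 10 * P.κ + (c.reg x).length) (fun h => ?_) (fun h => ?_)
      (by simp [f9]; omega)
    · rw [e1, f9] at h
      simp only [handleRo, h, if_true]
      have := forward_runs (coin := coin) (orc := orc) (M := P.κ) hR₁ (.ro 2) (x + 24)
        (hlen.ro _ _ _).le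
      rw [hR₁.reg] at this
      exact this.mono (by omega) fun _ h => h
    · rw [e1, f9] at h
      simp only [handleRo, h, if_false]
      exact Runs.skip (by omega) (.of_run rfl hR₁ e1)

end

section

variable {P : Params} {j : ℕ} {pk : Str} {c : Config Scheme.Query} {e : Sim}
  {d d' : Config HORS.Query} {coin : ℕ → Bool} {orc : Oracle HORS.Query}

theorem run_ensureAll_cons (src : Source) (out : Tab → Str → Str) (a : Str) (l : List Str)
    (acc : Str) (T : Tab) (w : Record) :
    (ensureAll out (a :: l) acc T).run src orc w =
      (ensureAll out l (acc ++ out ((ensure T a).run src orc w).1 a)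
        ((ensure T a).run src orc w).1).run src orc ((ensure T a).run src orc w).2 := by
  simp [ensureAll, Handler.run_bind]

theorem run_ensureAll_cnt (hv : e.tab.Valid P e.rcd.hist) (a : Str) :
    ((ensure e.tab a).run (tapeSource P coin) orc e.rcd).1.cnt = e.tab.cnt :=
  (tab_ensured hv a).cnt

/-! ### Signing -/

def signLoop : Prog HORS.Query :=
  .loop Reg.iter Reg.empty
    (.seq (.ops [.copy Reg.addr Reg.cnt, .take Reg.tmp Reg.rest Reg.zerosτ,
        .cat Reg.addr Reg.tmp, .drop Reg.rest Reg.zerosτ])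
      (.seq ensureProg (.ops [.cat Reg.ans Reg.secret, .drop Reg.iter Reg.one])))

def sigProg (x : ℕ) : Prog HORS.Query :=
  .ifEq Reg.closed Reg.empty
    (.seq (.ops [.inc Reg.cnt])
      (.seq (.ifEq Reg.cnt Reg.last (.ops [.const Reg.closed [true]]) .skip)
        (.ifEq Reg.cnt Reg.target (.query .sig x Reg.ans)
          (.seq (.query (.ro 0) x Reg.rest)
            (.seq (.ops [.const Reg.ans [], .copy Reg.iter Reg.zerosk]) signLoop)))))
    (.ops [.const Reg.ans []])

theorem blocks_succ (n k : ℕ) (x : Str) :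
    blocks n (k + 1) x = x.take n :: blocks n k (x.drop n) := by
  simp only [blocks, List.range_succ_eq_map, List.map_cons, List.map_map, Nat.zero_mul,
    List.drop_zero, List.cons.injEq, true_and]
  refine List.map_congr_left fun l _ => ?_
  simp [Nat.succ_mul, Nat.add_comm]

theorem signLoop_runs (hR : Represents P j pk c e d) (hv : e.tab.Valid P e.rcd.hist)
    (hlen : Lengths P pk orc) (m : ℕ) {acc h : Str} (hi : d.reg 15 = List.replicate m false)
    (ha : d.reg 13 = acc) (hh : d.reg 16 = h) :
    Runs coin orc signLoop d (m * (110 * P.κ) + 1)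
      (Answered P j pk c coin orc (ensureAll (fun T a => T.cell a)
        ((blocks P.τ m h).map (e.tab.cnt ++ ·)) acc e.tab) e.rcd) := by
  have hκ := P.κ_pos
  have hτ := P.τ_le_κ
  have hs := hlen.size
  induction m generalizing e d acc h with
  | zero =>
    have f9 := hR.fixed 9 (by simp)
    simp only [fixedReg] at f9
    refine ⟨d, _, .loop_done (r := 15) (s := 9) (by rw [hi, f9]; rfl), ?_, .of_run rfl hR ha⟩
    simp [f9]
  | succ m ih =>
    have f9 := hR.fixed 9 (by simp)
    have f2 := hR.fixed 2 (by simp)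
    have f8 := hR.fixed 8 (by simp)
    have f10 := hR.fixed 10 (by simp)
    simp only [fixedReg] at f9 f2 f8 f10
    set l : List Op := [.copy 12 10, .take 19 16 2, .cat 12 19, .drop 16 2] with hl
    set d₁ := applyOps l d with hd₁
    have hR₁ : Represents P j pk c e d₁ := hR.ops (by simp [hl, Op.target])
    have e1 : d₁.reg 12 = e.tab.cnt ++ h.take P.τ := by
      simp [hd₁, hl, applyOps, Op.apply, Config.setReg, f2, f10, hh]
    have e2 : d₁.reg 16 = h.drop P.τ := by
      simp [hd₁, hl, applyOps, Op.apply, Config.setReg, f2, hh]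
    have e3 : d₁.reg 13 = acc := by rw [hd₁, applyOps_reg _ (by simp [hl, Op.target]), ha]
    have e4 : d₁.reg 15 = List.replicate (m + 1) false := by
      rw [hd₁, applyOps_reg _ (by simp [hl, Op.target]), hi]
    have hcost : opsCost l d ≤ 6 * P.κ + 5 := by
      simp [hl, opsCost, Op.cost, Op.apply, Config.setReg, f2, f10, hh, hv.length_cnt]
      omega
    obtain ⟨d₂, n₂, hex₂, hn₂, g1, g2, g3⟩ := ensureProg_runs (coin := coin) (orc := orc)
      (a := e.tab.cnt ++ h.take P.τ) hR₁ hv e1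
      (by rw [List.length_append, hv.length_cnt, List.length_take]; omega)
    have hE := tab_ensured (coin := coin) (orc := orc) hv (e.tab.cnt ++ h.take P.τ)
    set l' : List Op := [.cat 13 17, .drop 15 8] with hl'
    set d₃ := applyOps l' d₂ with hd₃
    have hcost' : opsCost l' d₂ ≤ P.κ + 4 := by
      simp [hl', opsCost, Op.cost, Op.apply, Config.setReg, g2, hE.length, g3 8,
        hR₁.fixed 8, fixedReg]
      omega
    have h8 : d₂.reg 8 = [true] := by rw [g3 8 (by simp), hR₁.fixed 8 (by simp)]; rfl
    obtain ⟨d₄, n₄, hex₄, hn₄, hA⟩ := ih (e := ⟨_, _⟩) (d := d₃) (h := h.drop P.τ)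
      (acc := acc ++ ((ensure e.tab (e.tab.cnt ++ h.take P.τ)).run (tapeSource P coin) orc
        e.rcd).1.cell (e.tab.cnt ++ h.take P.τ))
      (g1.ops (by simp [hl', Op.target])) hE.valid
      (by simp [hd₃, hl', applyOps, Op.apply, Config.setReg, h8, g3 15, e4])
      (by simp [hd₃, hl', applyOps, Op.apply, Config.setReg, g2, g3 13, e3])
      (by rw [hd₃, applyOps_reg _ (by simp [hl', Op.target]), g3 16 (by simp), e2])
    refine ⟨d₄, _, .loop_step (r := 15) (s := 9) ?_ (.seq (.ops l d) (.seq hex₂ (.ops l' d₂))) hex₄,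
      ?_, ?_⟩
    · rw [hi, f9]; simp [List.replicate_succ]
    · rw [f9, Nat.succ_mul]
      simp only [List.length_nil, Nat.min_zero]
      omega
    · unfold Answered at hA ⊢
      rw [blocks_succ, List.map_cons, run_ensureAll_cons]
      rw [run_ensureAll_cnt hv] at hA
      exact hA

/-- The bound is in terms of question and answer, because this is what the adversary pays for the
query. A refusal has to be cheap; an answer has `k κ` bits, which pays for sampling `k` table
entries. -/
theorem sigProg_runs (hR : Represents P j pk c e d) (hv : e.tab.Valid P e.rcd.hist)
    (hlen : Lengths P pk orc) (x : ℕ) :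
    Runs coin orc (sigProg (x + 24)) d
      (200 * (1 + (c.reg x).length +
        ((handleSig P j (c.reg x) e.tab).run (tapeSource P coin) orc e.rcd).1.1.length))
      (Answered P j pk c coin orc (handleSig P j (c.reg x) e.tab) e.rcd) := by
  have hκ := P.κ_pos
  have hs := hlen.size
  have f9 := hR.fixed 9 (by simp)
  have f11 := hR.fixed 11 (by simp)
  simp only [fixedReg] at f9 f11
  have hsp := (handle_spec (j := j) hlen.pk .sig (c.reg x) hv).run (tapeSource_valid P coin) hlen.orc
  refine Runs.ifEq (r := 11) (s := 9) (N := 198 * (1 + (c.reg x).length +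
        ((handleSig P j (c.reg x) e.tab).run (tapeSource P coin) orc e.rcd).1.1.length))
    (fun h => ?_) (fun h => ?_) (by rw [f9]; simp only [List.length_nil, Nat.min_zero]; omega)
  · have hcl : e.tab.closed = false := by
      rw [f9, f11] at h
      by_contra hc
      simp [hc] at h
    obtain ⟨n, hn, hcnt, hlt⟩ := hv.cnt
    have hlt := hlt hcl
    set r := handleSig P j (c.reg x) e.tab with hr
    have hans : ((r.run (tapeSource P coin) orc e.rcd).1.1).length = P.k * P.κ := by
      rcases hsp.length with h | h
      · exact h
      · exfalso
        change ((handleSig P j (c.reg x) e.tab).run _ _ _).1.1.length = 0 at h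
        simp only [handleSig, hcl] at h
        by_cases ht : incr e.tab.cnt = P.code j
        · simp only [ht, if_true, Bool.false_eq_true, if_false, forward, Handler.run] at h
          have := hlen.orc e.rcd.log .sig (c.reg x)
          simp only [HORS.AnswerLength] at this
          rw [h] at this
          have := P.k_pos
          have : 0 < P.k * P.κ := by positivity
          omega
        · simp only [ht, Bool.false_eq_true, if_false, Handler.run] at h
          have hsc : (signCells P (e.tab.advance P) (orc e.rcd.log (.ro 0) (c.reg x))).Spec
              (SampleLength P) (fun _ _ _ _ => True)
              ⟨e.rcd.hist, (.ro 0, c.reg x) :: e.rcd.log⟩ _ :=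
            ensureAll_spec (out := fun T a => T.cell a) (fun _ _ _ _ h => h) _ _ (hv.advance hcl)
          have := hsc.run (orc := orc) (tapeSource_valid P coin) fun _ _ _ => trivial
          have h2 := this.2.2.1
          rw [h] at h2
          simp [blocks_length] at h2
          have := P.k_pos
          omega
    rw [hans]
    have hkκ : P.κ ≤ P.k * P.κ := Nat.le_mul_of_pos_left _ P.k_pos
    set K := P.k * P.κ with hK
    have f10 := hR.fixed 10 (by simp)
    simp only [fixedReg] at f10
    refine Runs.seq (p := .ops [.inc 10]) (N := P.κ + 2) (N' := 190 * (1 + (c.reg x).length + K))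
      (Runs.ops ?_ ?_) (by omega)
    · simp [opsCost, Op.cost, f10, hv.length_cnt]; omega
    set d₁ := applyOps [.inc 10] d with hd₁
    have e10 : d₁.reg 10 = incr e.tab.cnt := by
      simp [hd₁, applyOps, Op.apply, Config.setReg, f10]
    have e5 : d₁.reg 5 = P.code P.J := by
      rw [hd₁, applyOps_reg _ (by simp [Op.target]), hR.fixed 5 (by simp)]; rfl
    have hinc : (incr e.tab.cnt).length = P.J.size := by
      rw [hcnt, P.incr_code hlt]; simp
    refine Runs.seq (N := P.κ + 5) (N' := 180 * (1 + (c.reg x).length + K))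
      (R := Answered P j pk c coin orc r e.rcd)
      (Runs.mono (N := P.κ + 5)
        (R := fun d₂ => Represents P j pk c ⟨e.tab.advance P, e.rcd⟩ d₂) ?_ le_rfl ?_) (by omega)
    · have key : ∀ b : Bool, b = decide (incr e.tab.cnt = P.code P.J) → ∀ d₂ : Config HORS.Query,
          (∀ s, s ≠ 11 → d₂.reg s = d₁.reg s) → d₂.reg 11 = (if b then [true] else []) →
          d₂.mem = d.mem → d₂.coins = d.coins → d₂.log = d.log →
          Represents P j pk c ⟨e.tab.advance P, e.rcd⟩ d₂ := by
        intro b hb d₂ h1 h2 h3 h4 h5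
        refine ⟨fun s hs => ?_, fun s => ?_, h3.trans hR.mem, h4.trans hR.coins, h5.trans hR.log⟩
        · by_cases hs11 : s = 11
          · subst hs11
            rw [h2, hb]
            rfl
          · rw [h1 s hs11]
            by_cases hs10 : s = 10
            · subst hs10; exact e10
            · rw [hd₁, applyOps_reg _ (by simp [Op.target]; omega), hR.fixed s hs]
              interval_cases s <;> first | rfl | omega
        · rw [h1 _ (by simp), hd₁, applyOps_reg _ (by simp [Op.target]), hR.reg]
      have e11 : d₁.reg 11 = [] := by
        rw [hd₁, applyOps_reg _ (by simp [Op.target]), f11, hcl]; rfl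
      refine Runs.ifEq (r := 10) (s := 5) (N := 3) (fun h => ?_) (fun h => ?_) ?_
      · rw [e10, e5] at h
        refine Runs.ops (l := [.const 11 [true]]) (by simp [opsCost, Op.cost])
          (key true (by simp [h]) _ ?_ ?_ rfl rfl rfl)
        · intro s hs; exact applyOps_reg _ (by simp [Op.target]; omega)
        · simp [applyOps, Op.apply, Config.setReg]
      · rw [e10, e5] at h
        exact Runs.skip (by simp) (key false (by simp [h]) _ (fun _ _ => rfl) (by simp [e11])
          rfl rfl rfl)
      · rw [e10, e5, hinc]; simp; omega
    intro d₂ hR₂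
    have g10 := hR₂.fixed 10 (by simp)
    have g6 := hR₂.fixed 6 (by simp)
    simp only [fixedReg] at g10 g6
    have hx := hR₂.reg x
    have hcnt2 : (e.tab.advance P).cnt = incr e.tab.cnt := rfl
    refine Runs.ifEq (r := 10) (s := 6) (N := 170 * (1 + (c.reg x).length + K))
      (fun h => ?_) (fun h => ?_)
      (by rw [g10, g6, hcnt2, hinc]; simp; omega)
    · rw [g10, g6, hcnt2] at h
      have hr' : r = forward .sig (c.reg x) (e.tab.advance P) := by
        rw [hr]; simp [handleSig, hcl, h]
      rw [hr']
      have := forward_runs (coin := coin) (orc := orc) (M := K) hR₂ .sig (x + 24)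
        (le_of_eq (hlen.orc _ .sig _))
      rw [hR₂.reg] at this
      exact this.mono (by omega) fun _ h => h
    · rw [g10, g6, hcnt2] at h
      have hr' : r = .call (.ro 0) (c.reg x) fun h => signCells P (e.tab.advance P) h := by
        rw [hr]; simp [handleSig, hcl, h]
      refine Runs.seq (N := 1 + (c.reg x).length + P.κ) (N' := 160 * (1 + (c.reg x).length + K))
        ⟨_, _, .query (.ro 0) (x + 24) 16 d₂, ?_, ?_⟩ (by omega)
      · rw [hx, hlen.ro]
      have hR₃ := hR₂.query (orc := orc) (.ro 0) (x + 24) 16 (by simp) (by simp)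
      rw [hx] at hR₃
      set d₃ : Config HORS.Query := { d₂.setReg 16 (orc d₂.log (.ro 0) (d₂.reg (x + 24))) with
        log := (.ro 0, d₂.reg (x + 24)) :: d₂.log } with hd₃
      rw [hx] at hd₃
      have h16 : d₃.reg 16 = orc e.rcd.log (.ro 0) (c.reg x) := by
        rw [hd₃]; simp [Config.setReg, hR₂.log]
      rw [← hd₃] at hR₃
      have g7 := hR₃.fixed 7 (by simp)
      simp only [fixedReg] at g7
      refine Runs.seq (p := .ops [.const 13 [], .copy 15 7]) (N := P.k + 3) (N' := P.k * (110 * P.κ) + 1)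
        (Runs.ops ?_ ?_) ?_
      · simp [opsCost, Op.cost, Op.apply, Config.setReg, g7]; omega
      · set d₄ := applyOps [.const 13 [], .copy 15 7] d₃ with hd₄
        have := signLoop_runs (coin := coin) (e := ⟨e.tab.advance P, _⟩) (d := d₄)
          (hR₃.ops (by simp [Op.target])) (hv.advance hcl) hlen
          P.k (acc := []) (h := orc e.rcd.log (.ro 0) (c.reg x))
          (by simp [hd₄, applyOps, Op.apply, Config.setReg, g7])
          (by simp [hd₄, applyOps, Op.apply, Config.setReg])
          (by rw [hd₄, applyOps_reg _ (by simp [Op.target]), h16])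
        refine this.mono le_rfl fun d' hd' => ?_
        rw [hr']
        exact hd'
      · have : P.k * (110 * P.κ) = 110 * K := by rw [hK]; ring
        have := P.k_le_κ
        omega
  · have hcl : e.tab.closed = true := by
      rw [f9, f11] at h
      by_contra hc
      simp [hc] at h
    refine Runs.ops (l := [.const 13 []]) (by simp [opsCost, Op.cost]; omega) ?_
    refine .of_run (r := ([], e.tab)) (w' := e.rcd) (by simp [handleSig, hcl, Handler.run])
      (hR.ops (by simp [Op.target])) (by simp [applyOps, Op.apply, Config.setReg])

/-! ### Commitments -/

def comLoop : Prog HORS.Query :=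
  .loop Reg.iter Reg.full
    (.seq (.ops [.copy Reg.addr Reg.code, .cat Reg.addr Reg.iter])
      (.seq ensureProg (.ops [.const Reg.tmp' [false, false, false], .cat Reg.tmp' Reg.secret,
        .load Reg.image Reg.tmp', .cat Reg.ans Reg.image, .inc Reg.iter])))

/-- A refused question returns nothing, so the range test may cost only as much as the question is
long. The numeric comparison, which reads the code of `J` in full, is made only for questions at
least as long as that code; a shorter question writes a number below `J` anyway. -/
def comProg (x : ℕ) : Prog HORS.Query :=
  .seq (.ops [.const Reg.flag [], .take Reg.tmp Reg.last x])
    (.seq (.ifEq Reg.tmp Reg.last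
        (.ifLt Reg.last x (.ops [.const Reg.flag [true]]) .skip) .skip)
      (.seq (.ifLt Reg.empty x .skip (.ops [.const Reg.flag [true]]))
        (.ifEq Reg.flag Reg.empty
          (.seq (.ops [.copy Reg.code x, .cat Reg.code Reg.zerosL,
              .take Reg.code Reg.code Reg.zerosL])
            (.ifEq Reg.code Reg.target (.ops [.copy Reg.ans Reg.pk])
              (.seq (.ops [.const Reg.ans [], .copy Reg.iter Reg.zerosτ]) comLoop)))
          (.ops [.const Reg.ans []]))))

/-- Here `m` is the number of rounds left. The loop register runs through the `τ`-bit strings by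
increments and holds the overflow string when `m = 0`. -/
theorem comLoop_runs (hR : Represents P j pk c e d) (hv : e.tab.Valid P e.rcd.hist)
    (m i : ℕ) (hm : i + m = P.T) {acc a : Str}
    (hi : d.reg 15 = if m = 0 then List.replicate P.τ false ++ [true] else enc P.τ i)
    (ha : d.reg 13 = acc) (hc : d.reg 14 = a) (hl : a.length ≤ P.κ) :
    Runs coin orc comLoop d (m * (110 * P.κ) + 2 * P.κ + 1)
      (Answered P j pk c coin orc (ensureAll (fun T a => T.h2 (T.cell a))
        ((List.range' i m).map fun i => a ++ enc P.τ i) acc e.tab) e.rcd) := by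
  have hκ := P.κ_pos
  have hτ := P.τ_le_κ
  induction m generalizing e d acc i with
  | zero =>
    have f3 := hR.fixed 3 (by simp)
    simp only [fixedReg] at f3
    refine ⟨d, _, .loop_done (r := 15) (s := 3) (by rw [hi, f3]; rfl), ?_, .of_run rfl hR ha⟩
    simp [f3]; omega
  | succ m ih =>
    have f3 := hR.fixed 3 (by simp)
    simp only [fixedReg] at f3
    rw [if_neg (Nat.succ_ne_zero m)] at hi
    set l : List Op := [.copy 12 14, .cat 12 15] with hl0
    set d₁ := applyOps l d with hd₁
    have hR₁ : Represents P j pk c e d₁ := hR.ops (by simp [hl0, Op.target])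
    have e1 : d₁.reg 12 = a ++ enc P.τ i := by
      simp [hd₁, hl0, applyOps, Op.apply, Config.setReg, hc, hi]
    have e2 : ∀ s, s ≠ 12 → d₁.reg s = d.reg s := fun s hs =>
      applyOps_reg _ (by simp [hl0, Op.target]; omega)
    have hcost : opsCost l d ≤ 2 * P.κ + 3 := by
      simp [hl0, opsCost, Op.cost, Op.apply, Config.setReg, hc, hi]
      omega
    obtain ⟨d₂, n₂, hex₂, hn₂, g1, g2, g3⟩ := ensureProg_runs (coin := coin) (orc := orc)
      (a := a ++ enc P.τ i) hR₁ hv e1 (by rw [List.length_append, length_enc]; omega)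
    have hE := tab_ensured (coin := coin) (orc := orc) hv (a ++ enc P.τ i)
    set r := (ensure e.tab (a ++ enc P.τ i)).run (tapeSource P coin) orc e.rcd with hr
    have hv2 : r.1.Valid P r.2.hist := hE.valid
    have hl2 := hv2.length_h2_le (r.1.cell (a ++ enc P.τ i))
    have hlc : (r.1.cell (a ++ enc P.τ i)).length = P.κ := hE.length
    have g2' : d₂.reg 17 = r.1.cell (a ++ enc P.τ i) := g2
    set l' : List Op := [.const 20 [false, false, false], .cat 20 17, .load 18 20, .cat 13 18,
      .inc 15] with hl'
    set d₃ := applyOps l' d₂ with hd₃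
    have k13 : d₂.reg 13 = acc := by rw [g3 13 (by simp), e2 13 (by simp), ha]
    have k15 : d₂.reg 15 = enc P.τ i := by rw [g3 15 (by simp), e2 15 (by simp), hi]
    have hmem : d₂.mem (false :: false :: false :: r.1.cell (a ++ enc P.τ i)) =
        r.1.h2 (r.1.cell (a ++ enc P.τ i)) := by rw [g1.mem]; rfl
    have hcost' : opsCost l' d₂ ≤ 5 * P.κ + 15 := by
      simp [hl', opsCost, Op.cost, Op.apply, Config.setReg, g2', hmem, k15, hlc]
      omega
    have hT : P.T = 2 ^ P.τ := rfl
    obtain ⟨d₄, n₄, hex₄, hn₄, hA⟩ := ih (e := ⟨r.1, r.2⟩) (d := d₃) (i := i + 1)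
      (acc := acc ++ r.1.h2 (r.1.cell (a ++ enc P.τ i)))
      (g1.ops (by simp [hl', Op.target])) hv2 (by omega)
      (by
        have : d₃.reg 15 = incr (enc P.τ i) := by
          simp [hd₃, hl', applyOps, Op.apply, Config.setReg, k15]
        rw [this]
        split_ifs with h0
        · exact incr_enc_last _ _ (by omega)
        · exact incr_enc _ _ (by omega))
      (by simp [hd₃, hl', applyOps, Op.apply, Config.setReg, g2', hmem, k13])
      (by rw [hd₃, applyOps_reg _ (by simp [hl', Op.target]), g3 14 (by simp), e2 14 (by simp), hc])
    refine ⟨d₄, _, .loop_step (r := 15) (s := 3) ?_ (.seq (.ops l d) (.seq hex₂ (.ops l' d₂))) hex₄,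
      ?_, ?_⟩
    · rw [hi, f3]; intro h; have := congrArg List.length h; simp at this
    · rw [f3, hi, Nat.succ_mul]
      simp only [length_enc, List.length_append, List.length_replicate, List.length_singleton]
      omega
    · unfold Answered at hA ⊢
      rw [List.range'_succ, List.map_cons, run_ensureAll_cons]
      exact hA

theorem comProg_runs (hR : Represents P j pk c e d)
    (hv : e.tab.Valid P e.rcd.hist) (hlen : Lengths P pk orc) (x : ℕ) :
    Runs coin orc (comProg (x + 24)) d
      (200 * (1 + (c.reg x).length +
        ((handleCom P j pk (c.reg x) e.tab).run (tapeSource P coin) orc e.rcd).1.1.length))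
      (Answered P j pk c coin orc (handleCom P j pk (c.reg x) e.tab) e.rcd) := by
  have hκ := P.κ_pos
  have hτ := P.τ_le_κ
  have hs := hlen.size
  have hx := hR.reg x
  have hv5 : val (P.code P.J) = P.J := val_enc _ _ (Nat.lt_size_self _)
  have hsp := (handle_spec (j := j) hlen.pk .com (c.reg x) hv).run (tapeSource_valid P coin) hlen.orc
  change Handled _ _ _ _ _ _ ((handleCom P j pk (c.reg x) e.tab).run (tapeSource P coin) orc e.rcd).1
    _ at hsp
  generalize hxs : c.reg x = xs at hx hsp ⊢
  set M := ((handleCom P j pk xs e.tab).run (tapeSource P coin) orc e.rcd).1.1.length with hM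
  have f5 := hR.fixed 5 (by simp)
  simp only [fixedReg] at f5
  refine Runs.seq (p := .ops [.const 23 [], .take 19 5 (x + 24)]) (N := xs.length + 3)
    (N' := 190 * (1 + xs.length + M)) (Runs.ops ?_ ?_) (by omega)
  · have : x + 24 ≠ 23 := by omega
    simp [opsCost, Op.cost, Op.apply, Config.setReg, hx]; omega
  set d₁ := applyOps [.const 23 [], .take 19 5 (x + 24)] d with hd₁
  have hR₁ : Represents P j pk c e d₁ := hR.ops (by simp [Op.target])
  have e19 : d₁.reg 19 = (P.code P.J).take xs.length := by
    simp [hd₁, applyOps, Op.apply, Config.setReg, f5, hx]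
  have e23 : d₁.reg 23 = [] := by simp [hd₁, applyOps, Op.apply, Config.setReg]
  have e5 := hR₁.fixed 5 (by simp)
  have ex := hR₁.reg x
  rw [hxs] at ex
  simp only [fixedReg] at e5
  refine Runs.seq (N := 4 * xs.length + 10) (N' := 180 * (1 + xs.length + M))
    (R := Answered P j pk c coin orc (handleCom P j pk xs e.tab) e.rcd)
    (Runs.mono (N := 4 * xs.length + 10) (R := fun d₂ => Represents P j pk c e d₂ ∧
      d₂.reg 23 = if val xs ≤ P.J then [] else [true]) ?_ le_rfl ?_) (by omega)
  · by_cases hle : P.J.size ≤ xs.length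
    · refine Runs.ifEq (r := 19) (s := 5) (N := 2 * xs.length + 5) (fun h => ?_) (fun h => ?_)
        (by rw [e19, e5]; simp; omega)
      · refine Runs.ifLt (r := 5) (s := x + 24) (N := 3) (fun h => ?_) (fun h => ?_)
          (by rw [e5, ex]; simp; omega)
        · rw [e5, ex, hv5] at h
          refine Runs.ops (l := [.const 23 [true]]) (by simp [opsCost, Op.cost])
            ⟨hR₁.ops (by simp [Op.target]), ?_⟩
          rw [if_neg (by omega)]
          simp [applyOps, Op.apply, Config.setReg]
        · rw [e5, ex, hv5] at h
          exact Runs.skip (by simp) ⟨hR₁, by rw [if_pos (by omega), e23]⟩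
      · exfalso
        apply h
        rw [e19, e5, List.take_of_length_le (by simpa using hle)]
    · have hlt := val_lt xs
      have hJ2 : 2 ^ xs.length ≤ P.J := Nat.lt_size.1 (by omega)
      refine Runs.ifEq (r := 19) (s := 5) (N := 2 * xs.length + 5) (fun h => ?_) (fun h => ?_)
        (by rw [e19, e5]; simp; omega)
      · exfalso
        rw [e19, e5] at h
        have := congrArg List.length h
        simp at this
        omega
      · exact Runs.skip (by omega) ⟨hR₁, by rw [if_pos (by omega), e23]⟩
  rintro d₂ ⟨hR₂, g23⟩
  have g9 := hR₂.fixed 9 (by simp)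
  have gx := hR₂.reg x
  rw [hxs] at gx
  simp only [fixedReg] at g9
  refine Runs.seq (N := xs.length + 5) (N' := 170 * (1 + xs.length + M))
    (R := Answered P j pk c coin orc (handleCom P j pk xs e.tab) e.rcd)
    (Runs.mono (N := xs.length + 5) (R := fun d₃ => Represents P j pk c e d₃ ∧
      (d₃.reg 23 = [] ↔ 1 ≤ val xs ∧ val xs ≤ P.J)) ?_ le_rfl ?_) (by omega)
  · refine Runs.ifLt (r := 9) (s := x + 24) (N := 3) (fun h => ?_) (fun h => ?_)
      (by rw [g9, gx]; simp; omega)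
    · rw [g9, gx] at h
      refine Runs.skip (by simp) ⟨hR₂, ?_⟩
      rw [g23]
      simp only [val] at h
      constructor
      · intro h'
        refine ⟨h, ?_⟩
        by_contra hc
        simp [hc] at h'
      · rintro ⟨_, h'⟩; simp [h']
    · rw [g9, gx] at h
      refine Runs.ops (l := [.const 23 [true]]) (by simp [opsCost, Op.cost])
        ⟨hR₂.ops (by simp [Op.target]), ?_⟩
      simp only [val] at h
      simp [applyOps, Op.apply, Config.setReg]
      omega
  rintro d₃ ⟨hR₃, k23⟩
  have k9 := hR₃.fixed 9 (by simp)
  have k4 := hR₃.fixed 4 (by simp)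
  have kx := hR₃.reg x
  rw [hxs] at kx
  simp only [fixedReg] at k9 k4
  refine Runs.ifEq (r := 23) (s := 9) (N := 168 * (1 + xs.length + M)) (fun h => ?_) (fun h => ?_)
    (by rw [k9]; simp; omega)
  · rw [k9, k23] at h
    -- An accepted question is answered by `T κ` bits, and this length pays for normalising the
    -- epoch and for the loop.
    have hMT : M = P.T * P.κ := by
      rcases hsp.length with h' | h'
      · exact h'
      · exfalso
        have hTpos : 0 < P.T * P.κ := Nat.mul_pos (Nat.two_pow_pos _) hκ
        rw [← hM] at h'
        simp only [handleCom, h, and_self, if_true] at hM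
        split_ifs at hM with ht
        · have : M = pk.length := hM
          rw [hlen.pk] at this
          omega
        · have := (ensureAll_spec (W := fun _ _ _ _ => True) (out := fun T a => T.h2 (T.cell a))
            (P := P) (fun T' l a hT' ha => by
              rcases hT'.cell a with h | h
              · rw [h] at ha; simp at ha; omega
              · exact h.2)
            ((List.range P.T).map fun i => P.code (val xs) ++ enc P.τ i) [] hv).run
              (orc := orc) (tapeSource_valid P coin) fun _ _ _ => trivial
          have h2 := this.2.2.1
          rw [comCells] at hM
          rw [← hM] at h2
          simp at h2
          omega
    have hκM : P.κ ≤ M := by rw [hMT]; exact Nat.le_mul_of_pos_left _ (Nat.two_pow_pos _)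
    refine Runs.seq (p := .ops [.copy 14 (x + 24), .cat 14 4, .take 14 14 4])
      (N := xs.length + 2 * P.κ + 4) (N' := 160 * (1 + xs.length + M)) (Runs.ops ?_ ?_) (by omega)
    · simp [opsCost, Op.cost, Op.apply, Config.setReg, kx, k4]; omega
    set d₄ := applyOps [.copy 14 (x + 24), .cat 14 4, .take 14 14 4] d₃ with hd₄
    have hR₄ : Represents P j pk c e d₄ := hR₃.ops (by simp [Op.target])
    have m14 : d₄.reg 14 = P.code (val xs) := by
      rw [Params.code, ← enc_val_append xs _ (h.2.trans_lt (Nat.lt_size_self _))]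
      simp [hd₄, applyOps, Op.apply, Config.setReg, kx, k4]
    have m6 := hR₄.fixed 6 (by simp)
    have m0 := hR₄.fixed 0 (by simp)
    have m2 := hR₄.fixed 2 (by simp)
    simp only [fixedReg] at m6 m0 m2
    refine Runs.ifEq (r := 14) (s := 6) (N := 150 * (1 + xs.length + M)) (fun ht => ?_) (fun ht => ?_)
      (by rw [m14, m6]; simp; omega)
    · rw [m14, m6] at ht
      refine Runs.ops (l := [.copy 13 0]) (by simp [opsCost, Op.cost, m0, hlen.pk, ← hMT]; omega) ?_
      refine .of_run (r := (pk, e.tab)) (w' := e.rcd) (by simp [handleCom, h, ht, Handler.run])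
        (hR₄.ops (by simp [Op.target])) (by simp [applyOps, Op.apply, Config.setReg, m0])
    · rw [m14, m6] at ht
      refine Runs.seq (p := .ops [.const 13 [], .copy 15 2]) (N := P.κ + 3)
        (N' := P.T * (110 * P.κ) + 2 * P.κ + 1) (Runs.ops ?_ ?_) ?_
      · simp [opsCost, Op.cost, Op.apply, Config.setReg, m2]; omega
      · set d₅ := applyOps [.const 13 [], .copy 15 2] d₄ with hd₅
        have hTne : P.T ≠ 0 := (Nat.two_pow_pos _).ne'
        have := comLoop_runs (coin := coin) (orc := orc) (e := e) (d := d₅)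
          (hR₄.ops (by simp [Op.target])) hv P.T 0 (Nat.zero_add _) (acc := [])
          (a := P.code (val xs))
          (by rw [if_neg hTne, enc_zero]; simp [hd₅, applyOps, Op.apply, Config.setReg, m2])
          (by simp [hd₅, applyOps, Op.apply, Config.setReg])
          (by rw [hd₅, applyOps_reg _ (by simp [Op.target]), m14]) (by simpa using hs)
        refine this.mono le_rfl fun d' hd' => ?_
        have : handleCom P j pk xs e.tab = comCells P e.tab (P.code (val xs)) := by
          simp [handleCom, h, ht]
        rw [this, comCells, List.range_eq_range']
        exact hd'
      · have : P.T * (110 * P.κ) = 110 * M := by rw [hMT]; ring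
        omega
  · rw [k9, ne_eq, k23] at h
    refine Runs.ops (l := [.const 13 []]) (by simp [opsCost, Op.cost]; omega) ?_
    refine .of_run (r := ([], e.tab)) (w' := e.rcd) (by simp [handleCom, h, Handler.run])
      (hR₃.ops (by simp [Op.target])) (by simp [applyOps, Op.apply, Config.setReg])

/-! ### Break-in -/

def brkProg : Prog HORS.Query :=
  .ifEq Reg.closed Reg.empty
    (.seq (.ops [.copy Reg.addr Reg.cnt])
      (.seq nextKeyProg (.ops [.const Reg.closed [true], .copy Reg.ans Reg.secret])))
    (.ops [.const Reg.ans []])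

theorem brkProg_runs (hR : Represents P j pk c e d) (hv : e.tab.Valid P e.rcd.hist)
    (hlen : Lengths P pk orc) :
    Runs coin orc brkProg d
      (200 * (1 + ((handleBrk e.tab).run (tapeSource P coin) orc e.rcd).1.1.length))
      (Answered P j pk c coin orc (handleBrk e.tab) e.rcd) := by
  have hκ := P.κ_pos
  have hs := hlen.size
  have f9 := hR.fixed 9 (by simp)
  have f10 := hR.fixed 10 (by simp)
  have f11 := hR.fixed 11 (by simp)
  simp only [fixedReg] at f9 f10 f11
  refine Runs.ifEq (r := 11) (s := 9)
    (N := 198 * (1 + ((handleBrk e.tab).run (tapeSource P coin) orc e.rcd).1.1.length))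
    (fun h => ?_) (fun h => ?_) (by rw [f9]; simp only [List.length_nil, Nat.min_zero]; omega)
  · have hcl : e.tab.closed = false := by
      rw [f9, f11] at h
      by_contra hc
      simp [hc] at h
    obtain ⟨n, hn, hcnt, hlt⟩ := hv.cnt
    have hlt := hlt hcl
    have hsp := (nextKey_spec (W := fun _ _ _ _ => True) hv hlt).run (tapeSource_valid P coin)
      (orc := orc) fun _ _ _ => trivial
    rw [← hcnt] at hsp
    have hrun : (handleBrk e.tab).run (tapeSource P coin) orc e.rcd =
        (let r := (nextKey e.tab e.tab.cnt).run (tapeSource P coin) orc e.rcd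
         ((r.1.1, { r.1.2 with closed := true }), r.2)) := by
      simp [handleBrk, hcl, Handler.run_bind, Handler.run]
    have hl : ((handleBrk e.tab).run (tapeSource P coin) orc e.rcd).1.1.length = P.κ := by
      rw [hrun]; exact hsp.2.2.1
    rw [hl]
    refine Runs.seq (p := .ops [.copy 12 10]) (N := P.κ + 2) (N' := 180 * P.κ)
      (Runs.ops ?_ ?_) (by omega)
    · simp [opsCost, Op.cost, f10, hv.length_cnt]; omega
    refine Runs.seq (N' := 10 * P.κ) ((nextKeyProg_runs (a := e.tab.cnt)
        (hR.ops (by simp [Op.target])) hv ?_ ?_).mono le_rfl ?_) (by omega)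
    · simp [applyOps, Op.apply, Config.setReg, f10]
    · rw [hv.length_cnt]; omega
    · rintro d₂ ⟨g1, g2, g3⟩
      have hl' := hsp.2.2.1
      generalize (nextKey e.tab e.tab.cnt).run (tapeSource P coin) orc e.rcd = r at g1 g2 hrun hl'
      refine Runs.ops (l := [.const 11 [true], .copy 13 17]) ?_
        (.of_run hrun ⟨fun s hs => ?_, fun s => ?_, ?_, ?_, ?_⟩ ?_)
      · simp [opsCost, Op.cost, Op.apply, Config.setReg, g2, hl']; omega
      · by_cases h11 : s = 11
        · subst h11; simp [applyOps, Op.apply, Config.setReg, fixedReg]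
        · rw [applyOps_reg _ (by simp [Op.target]; omega), g1.fixed s hs]
          interval_cases s <;> first | rfl | omega
      · rw [applyOps_reg _ (by simp [Op.target]), g1.reg]
      · rw [applyOps_mem _ (by simp [Op.target]), g1.mem]; rfl
      · exact g1.coins
      · exact g1.log
      · simp [applyOps, Op.apply, Config.setReg, g2]
  · have hcl : e.tab.closed = true := by
      rw [f9, f11] at h
      by_contra hc
      simp [hc] at h
    refine Runs.ops (l := [.const 13 []]) (by simp [opsCost, Op.cost]; omega) ?_
    refine .of_run (r := ([], e.tab)) (w' := e.rcd) (by simp [handleBrk, hcl, Handler.run])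
      (hR.ops (by simp [Op.target])) (by simp [applyOps, Op.apply, Config.setReg])

end

/-! ### Compilation of the adversary -/

def handleProg (x : ℕ) : Scheme.Query → Prog HORS.Query
  | .ro i => roProg x i
  | .sig => sigProg x
  | .com => comProg x
  | .brk => brkProg

/-- A memory access needs the tag `1` in front of the address. Copying the address costs a constant
factor only, since an access is charged for its address in any case. -/
def compileOp : Op → Prog HORS.Query
  | .const r w => .op (.const (r + 24) w)
  | .copy r s => .op (.copy (r + 24) (s + 24))
  | .cat r s => .op (.cat (r + 24) (s + 24))
  | .take d r s => .op (.take (d + 24) (r + 24) (s + 24))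
  | .drop r s => .op (.drop (r + 24) (s + 24))
  | .inc r => .op (.inc (r + 24))
  | .load r a => .ops [.const Reg.tmp [true], .cat Reg.tmp (a + 24), .load (r + 24) Reg.tmp]
  | .store a r => .ops [.const Reg.tmp [true], .cat Reg.tmp (a + 24), .store Reg.tmp (r + 24)]

/-- The adversary with its oracles replaced by the simulator. -/
def compile : Prog Scheme.Query → Prog HORS.Query
  | .skip => .skip
  | .op o => compileOp o
  | .flip r => .flip (r + 24)
  | .query q x y => .seq (handleProg (x + 24) q) (.ops [.copy (y + 24) Reg.ans])
  | .seq p q => .seq (compile p) (compile q)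
  | .ifEq r s p q => .ifEq (r + 24) (s + 24) (compile p) (compile q)
  | .ifLt r s p q => .ifLt (r + 24) (s + 24) (compile p) (compile q)
  | .loop r s p => .loop (r + 24) (s + 24) (compile p)

/-- A constant suffices because all strings that depend on the parameters or on `j` are put in
registers by `prologue`; the code of the simulator contains none of them. -/
theorem size_handleProg_le (x : ℕ) (q : Scheme.Query) : (handleProg x q).size ≤ 245 := by
  match q with
  | .ro 0 | .ro 1 | .ro 2 | .sig | .com | .brk =>
    simp [handleProg, roProg, ro1Prog, ro2Prog, sigProg, signLoop, comProg, comLoop, brkProg,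
      nextKeyProg, ensureProg, sampleProg, sampleLoop, Prog.ops, Prog.size, Op.size]

theorem size_compile_le (p : Prog Scheme.Query) : (compile p).size ≤ 250 * p.size := by
  induction p with
  | skip => simp [compile, Prog.size]
  | op o =>
    cases o <;> simp [compile, compileOp, Prog.ops, Prog.size, Op.size]
  | flip r => simp [compile, Prog.size]
  | query q x y =>
    have := size_handleProg_le (x + 24) q
    simp [compile, Prog.ops, Prog.size, Op.size]
    omega
  | seq p q ih ih' | ifEq _ _ p q ih ih' | ifLt _ _ p q ih ih' =>
    simp only [compile, Prog.size]; omega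
  | loop _ _ p ih => simp only [compile, Prog.size]; omega

/-! ### Cost and correctness of the compiled adversary -/

section

variable {P : Params} {j : ℕ} {pk : Str} {c : Config Scheme.Query} {e : Sim}
  {d d' : Config HORS.Query} {coin : ℕ → Bool} {orc : Oracle HORS.Query}

/-- Simulating an oracle costs a constant times the charge for calling it. This keeps terms such as
the number of queries times `T κ` out of the time bound: receiving a commitment is as expensive as
producing it. -/
theorem handleProg_runs (hR : Represents P j pk c e d) (hv : e.tab.Valid P e.rcd.hist)
    (hlen : Lengths P pk orc) (q : Scheme.Query) (x : ℕ) :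
    Runs coin orc (handleProg (x + 24) q) d
      (200 * (1 + (c.reg x).length +
        ((handle P j pk q (c.reg x) e.tab).run (tapeSource P coin) orc e.rcd).1.1.length))
      (Answered P j pk c coin orc (handle P j pk q (c.reg x) e.tab) e.rcd) := by
  have hsp := (handle_spec (j := j) hlen.pk q (c.reg x) hv).run (tapeSource_valid P coin) hlen.orc
  have hl := hsp.length
  cases q with
  | ro i =>
    refine (roProg_runs hR hv hlen x i).mono ?_ fun _ h => h
    simp only [Scheme.AnswerLength] at hl
    rw [hl]; omega
  | sig => exact sigProg_runs hR hv hlen x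
  | com => exact comProg_runs hR hv hlen x
  | brk => exact (brkProg_runs hR hv hlen).mono (by simp only [handle]; omega) fun _ h => h

theorem Represents.setReg (hR : Represents P j pk c e d) (r : ℕ) (w : Str) :
    Represents P j pk (c.setReg r w) e (d.setReg (r + 24) w) := by
  refine ⟨fun s hs => ?_, fun s => ?_, hR.mem, hR.coins, hR.log⟩
  · simp only [Config.setReg]
    rw [Function.update_of_ne (by omega), hR.fixed s hs]
  · by_cases h : s = r
    · subst h; simp [Config.setReg]
    · simp only [Config.setReg]
      rw [Function.update_of_ne (by omega), Function.update_of_ne h, hR.reg]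

theorem compileOp_runs (hR : Represents P j pk c e d) (o : Op) :
    Runs coin orc (compileOp o) d (250 * o.cost c) (Represents P j pk (o.apply c) e) := by
  have direct : ∀ o' : Op, Represents P j pk (o.apply c) e (o'.apply d) → o'.cost d = o.cost c →
      Runs coin orc (.op o') d (250 * o.cost c) (Represents P j pk (o.apply c) e) :=
    fun o' h h' => ⟨_, _, .op o' d, by omega, h⟩
  cases o with
  | const r w => exact direct _ (hR.setReg r w) rfl
  | copy r s =>
    refine direct _ ?_ (by simp [Op.cost, hR.reg])
    simp only [Op.apply, hR.reg]; exact hR.setReg r _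
  | cat r s =>
    refine direct _ ?_ (by simp [Op.cost, hR.reg])
    simp only [Op.apply, hR.reg]; exact hR.setReg r _
  | take d r s =>
    refine direct _ ?_ (by simp [Op.cost, hR.reg])
    simp only [Op.apply, hR.reg]; exact hR.setReg d _
  | drop r s =>
    refine direct _ ?_ (by simp [Op.cost, hR.reg])
    simp only [Op.apply, hR.reg]; exact hR.setReg r _
  | inc r =>
    refine direct _ ?_ (by simp [Op.cost, hR.reg])
    simp only [Op.apply, hR.reg]; exact hR.setReg r _
  | load r a =>
    refine Runs.ops (l := [.const 19 [true], .cat 19 (a + 24), .load (r + 24) 19]) ?_ ?_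
    · simp [opsCost, Op.cost, Op.apply, Config.setReg, hR.reg, hR.mem, memOf]
      omega
    · have h1 : Represents P j pk c e (applyOps [.const 19 [true], .cat 19 (a + 24)] d) :=
        hR.ops (by simp [Op.target])
      have h2 := h1.setReg r (c.mem (c.reg a))
      have h3 : (applyOps [.const 19 [true], .cat 19 (a + 24), .load (r + 24) 19] d) =
          (applyOps [.const 19 [true], .cat 19 (a + 24)] d).setReg (r + 24) (c.mem (c.reg a)) := by
        simp [applyOps, Op.apply, Config.setReg, hR.reg, hR.mem, memOf]
      rw [h3]; exact h2
  | store a r =>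
    refine Runs.ops (l := [.const 19 [true], .cat 19 (a + 24), .store 19 (r + 24)]) ?_ ?_
    · simp [opsCost, Op.cost, Op.apply, Config.setReg, hR.reg]
      omega
    · have h1 : Represents P j pk c e (applyOps [.const 19 [true], .cat 19 (a + 24)] d) :=
        hR.ops (by simp [Op.target])
      refine ⟨h1.fixed, h1.reg, ?_, h1.coins, h1.log⟩
      simp [applyOps, Op.apply, Config.setReg, hR.reg, hR.mem, memOf_update]

theorem coinCount_asks (q : Scheme.Query) (x : Str) (h : List Event) :
    coinCount P (asks P q x ++ h) = coinCount P h := by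
  unfold asks
  split <;> simp [coinCount, Event.coins]

/-- Induction on the run with the simulator. The registers of the adversary are only shifted by
`24`, so every branch is decided alike, and each rule costs at most `250` times its original charge.
-/
theorem compile_runs (hlen : Lengths P pk orc) (hj : j ≤ P.J) {p : Prog Scheme.Query}
    {c' : Config Scheme.Query} {e' : Sim} {n : ℕ}
    (h : EnvExec (simEnv P j pk (tapeSource P coin) orc) p c e c' e' n)
    (hR : Represents P j pk c e d) (hv : JointValid P j c e) :
    Runs coin orc (compile p) d (250 * n) (Represents P j pk c' e') := by
  induction h generalizing d with
  | skip => exact Runs.skip (by omega) hR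
  | op o c e => exact compileOp_runs hR o
  | flip r c e =>
    refine ⟨_, _, .flip (r + 24) d, by omega, ?_⟩
    have h1 := hR.setReg r [((simEnv P j pk (tapeSource P coin) orc).flip c.coins e).1]
    refine ⟨?_, ?_, h1.mem, ?_, h1.log⟩
    · intro s hs; exact (congrFun (by simp [simEnv, tapeSource, hR.coins]) s).trans (h1.fixed s hs)
    · intro s
      exact (congrFun (by simp [simEnv, tapeSource, hR.coins]) _).trans (h1.reg s)
    · simp [simEnv, coinCount, Event.coins, hR.coins]; omega
  | query q x y c e =>
    have hR' : Represents P j pk c ⟨e.tab, ⟨asks P q (c.reg x) ++ e.rcd.hist, e.rcd.log⟩⟩ d :=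
      ⟨hR.fixed, hR.reg, hR.mem, hR.coins.trans (coinCount_asks q _ _).symm, hR.log⟩
    have H := handleProg_runs (coin := coin) hR' (hv.sim.tab.asks q _) hlen q x
    refine Runs.seq (N' := 2 * (1 + ((simEnv P j pk (tapeSource P coin) orc).query q
      (c.reg x) e).1.length)) (H.mono le_rfl ?_) ?_
    · rintro d₁ ⟨h1, h2⟩
      refine Runs.ops (l := [.copy (y + 24) 13]) ?_ ?_
      · simp only [opsCost, Op.cost, h2, simEnv]; omega
      · have h3 := h1.setReg y (d₁.reg 13)
        rw [h2] at h3
        refine ⟨?_, ?_, h3.mem, h3.coins, h3.log⟩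
        · intro s hs
          rw [← h2] at h3
          exact h3.fixed s hs
        · intro s
          have := h3.reg s
          rw [← h2] at this
          simp only [applyOps, Op.apply]
          rw [this]
          simp [Config.setReg, simEnv, h2]
    · simp only [simEnv]; omega
  | seq h h' ih ih' =>
    refine Runs.seq ((ih hR hv).mono le_rfl fun d₁ h1 => ih' h1 ?_) (by omega)
    exact hv.envExec hlen.pk (tapeSource_valid P coin) hlen.orc hj h
  | ifEq_true hrs h ih =>
    obtain ⟨d', n, h1, h2, h3⟩ := ih hR hv
    exact ⟨d', _, .ifEq_true (by rw [hR.reg, hR.reg, hrs]) h1, by rw [hR.reg, hR.reg]; omega, h3⟩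
  | ifEq_false hrs h ih =>
    obtain ⟨d', n, h1, h2, h3⟩ := ih hR hv
    exact ⟨d', _, .ifEq_false (by rwa [hR.reg, hR.reg]) h1, by rw [hR.reg, hR.reg]; omega, h3⟩
  | ifLt_true hrs h ih =>
    obtain ⟨d', n, h1, h2, h3⟩ := ih hR hv
    exact ⟨d', _, .ifLt_true (by rwa [hR.reg, hR.reg]) h1, by rw [hR.reg, hR.reg]; omega, h3⟩
  | ifLt_false hrs h ih =>
    obtain ⟨d', n, h1, h2, h3⟩ := ih hR hv
    exact ⟨d', _, .ifLt_false (by rwa [hR.reg, hR.reg]) h1, by rw [hR.reg, hR.reg]; omega, h3⟩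
  | loop_done hrs =>
    exact ⟨d, _, .loop_done (by rw [hR.reg, hR.reg, hrs]), by rw [hR.reg, hR.reg]; omega, hR⟩
  | loop_step hrs h h' ih ih' =>
    obtain ⟨d₁, n, h1, h2, h3⟩ := ih hR hv
    obtain ⟨d₂, n', h1', h2', h3'⟩ :=
      ih' h3 (hv.envExec hlen.pk (tapeSource_valid P coin) hlen.orc hj h)
    exact ⟨d₂, _, .loop_step (by rwa [hR.reg, hR.reg]) h1 h1', by rw [hR.reg, hR.reg]; omega, h3'⟩

end

theorem length_update_le {α : Type} [DecidableEq α] {f : α → Str} {M : ℕ}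
    (hf : ∀ y, (f y).length ≤ M) (x : α) {w : Str} {n : ℕ} (hw : w.length ≤ M + n) (y : α) :
    (Function.update f x w y).length ≤ M + n := by
  rw [Function.update_apply]
  split_ifs
  · exact hw
  · exact (hf y).trans (Nat.le_add_right _ _)

/-- Strings in the machine grow at most as fast as time passes. -/
theorem EnvExec.length_le {Q E : Type} {env : Env Q E} {p : Prog Q} {c c' : Config Q} {e e' : E}
    {n : ℕ} (h : EnvExec env p c e c' e' n) {M : ℕ} (hr : ∀ r, (c.reg r).length ≤ M)
    (hm : ∀ a, (c.mem a).length ≤ M) :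
    (∀ r, (c'.reg r).length ≤ M + n) ∧ ∀ a, (c'.mem a).length ≤ M + n := by
  induction h generalizing M with
  | skip | loop_done => exact ⟨fun r => (hr r).trans (Nat.le_add_right _ _),
      fun r => (hm r).trans (Nat.le_add_right _ _)⟩
  | op o c e =>
    cases o with
    | const r w => exact ⟨length_update_le hr _ (by simp [Op.cost]; omega),
        fun a => (hm a).trans (Nat.le_add_right _ _)⟩
    | copy r s => exact ⟨length_update_le hr _ ((hr s).trans (Nat.le_add_right _ _)),
        fun a => (hm a).trans (Nat.le_add_right _ _)⟩
    | cat r s =>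
      refine ⟨length_update_le hr _ ?_, fun a => (hm a).trans (Nat.le_add_right _ _)⟩
      have := hr r
      simp [Op.cost]; omega
    | take d r s =>
      refine ⟨length_update_le hr _ ?_, fun a => (hm a).trans (Nat.le_add_right _ _)⟩
      simp [Op.cost]; omega
    | drop r s =>
      refine ⟨length_update_le hr _ ?_, fun a => (hm a).trans (Nat.le_add_right _ _)⟩
      have := hr r
      simp [Op.cost]; omega
    | inc r =>
      refine ⟨length_update_le hr _ ?_, fun a => (hm a).trans (Nat.le_add_right _ _)⟩
      have := length_incr_le (c.reg r)
      have := hr r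
      simp [Op.cost]; omega
    | load r a => exact ⟨length_update_le hr _ ((hm _).trans (Nat.le_add_right _ _)),
        fun a => (hm a).trans (Nat.le_add_right _ _)⟩
    | store a r => exact ⟨fun r => (hr r).trans (Nat.le_add_right _ _),
        length_update_le hm _ ((hr r).trans (Nat.le_add_right _ _))⟩
  | flip r c e => exact ⟨length_update_le hr _ (by simp), fun a => (hm a).trans (Nat.le_add_right _ _)⟩
  | query q x y c e =>
    exact ⟨length_update_le hr _ (by omega), fun a => (hm a).trans (Nat.le_add_right _ _)⟩
  | seq h h' ih ih' =>
    have := ih' (ih hr hm).1 (ih hr hm).2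
    exact ⟨fun r => (this.1 r).trans (by omega), fun a => (this.2 a).trans (by omega)⟩
  | ifEq_true _ _ ih | ifEq_false _ _ ih | ifLt_true _ _ ih | ifLt_false _ _ ih =>
    exact ⟨fun r => ((ih hr hm).1 r).trans (by omega), fun a => ((ih hr hm).2 a).trans (by omega)⟩
  | loop_step _ _ _ ih ih' =>
    have := ih' (ih hr hm).1 (ih hr hm).2
    exact ⟨fun r => (this.1 r).trans (by omega), fun a => (this.2 a).trans (by omega)⟩

/-! ### The reduction -/

def prologue (P : Params) (j : ℕ) : Prog HORS.Query :=
  .ops [.const Reg.zerosκ (List.replicate P.κ false), .const Reg.zerosτ (List.replicate P.τ false),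
    .const Reg.full (List.replicate P.τ false ++ [true]),
    .const Reg.zerosL (List.replicate P.J.size false), .const Reg.last (P.code P.J),
    .const Reg.target (P.code j), .const Reg.zerosk (List.replicate P.k false),
    .const Reg.one [true], .const Reg.cnt (P.code 0)]

/-- The adversary against HORS that guesses that the forged signature is for epoch `j`. -/
def reduction (P : Params) (j : ℕ) (A : Prog Scheme.Query) : Prog HORS.Query :=
  .seq (prologue P j) (.seq (compile A) (.ops [.copy 0 24, .copy 1 25]))

theorem reduction_runs {P : Params} {j : ℕ} {pk : Str} {coin : ℕ → Bool}
    {orc : Oracle HORS.Query} {A : Prog Scheme.Query} (hlen : Lengths P pk orc) (hJ : 0 < P.J)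
    (hj' : 0 < j) (hj : j ≤ P.J) {c : Config Scheme.Query} {e : Sim} {n : ℕ}
    (h : EnvExec (simEnv P j pk (tapeSource P coin) orc) A (Config.start _ []) (Sim.start P) c e n) :
    Runs coin orc (reduction P j A) (Config.start _ pk) (20 * P.κ + 260 * n + 40) fun d =>
      d.reg 0 = c.reg 0 ∧ d.reg 1 = c.reg 1 ∧ d.log = e.rcd.log := by
  have hκ := P.κ_pos
  have hτ := P.τ_le_κ
  have hk := P.k_le_κ
  have hs := hlen.size
  refine Runs.seq (N := 10 * P.κ + 30) (N' := 10 * P.κ + 260 * n + 10) (Runs.ops ?_ ?_) (by omega)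
  · simp [opsCost, Op.cost]; omega
  refine Runs.seq (N := 250 * n) (N' := 2 * n + 3) ((compile_runs hlen hj h ?_
    (JointValid.start hJ hj')).mono le_rfl ?_) (by omega)
  · refine ⟨fun r hr => ?_, fun r => ?_, ?_, rfl, rfl⟩
    · interval_cases r <;>
        simp [applyOps, Op.apply, Config.setReg, Config.start, fixedReg, Sim.start]
    · rw [applyOps_reg _ (by
        simp only [List.mem_cons, List.not_mem_nil, or_false, forall_eq_or_imp, forall_eq, Op.target,
          ne_eq, Option.some.injEq]
        unfold Reg.zerosκ Reg.zerosτ Reg.full Reg.zerosL Reg.last Reg.target Reg.zerosk Reg.one Reg.cnt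
        omega)]
      simp [Config.start]
    · funext a
      change [] = _
      rcases a with _ | ⟨_ | _, _ | ⟨_ | _, _ | ⟨_ | _, x⟩⟩⟩ <;> rfl
  · intro d hd
    -- All registers of the adversary start empty and strings grow no faster than time, so the
    -- forgery has length `O(n)` and can be copied to the output registers in time `O(n)`.
    have hl := (h.length_le (M := 0) (fun r => by simp [Config.start])
      fun r => by simp [Config.start]).1
    have h0 := hd.reg 0
    have h1 := hd.reg 1
    refine Runs.ops (l := [.copy 0 24, .copy 1 25]) ?_ ⟨?_, ?_, hd.log⟩
    · have := hl 0
      have := hl 1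
      simp at h0 h1
      simp [opsCost, Op.cost, Op.apply, Config.setReg, h0, h1]; omega
    · simpa [applyOps, Op.apply, Config.setReg] using h0
    · simpa [applyOps, Op.apply, Config.setReg] using h1

theorem size_reduction_le {P : Params} (hs : P.J.size ≤ P.κ) (j : ℕ) (A : Prog Scheme.Query) :
    (reduction P j A).size ≤ 20 * P.κ + 250 * A.size + 50 := by
  have hκ := P.κ_pos
  have hτ := P.τ_le_κ
  have hk := P.k_le_κ
  have := size_compile_le A
  simp [reduction, prologue, Prog.ops, Prog.size, Op.size]
  omega

/-- The terms of order `κ` in running time and size come from the constants loaded by `prologue` and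
are paid for by one hash evaluation; `J.size ≤ P.κ` keeps the epoch codes within that budget. The
HORS signing calls are bounded by the queries of the adversary and also by one, because the counter
passes `j` at most once. -/
theorem reduction_admissible {P : Params} (hs : P.J.size ≤ P.κ) (hJ : 0 < P.J) {j : ℕ}
    (hj' : 0 < j) (hj : j ≤ P.J) {A : Prog Scheme.Query} {t qs qh qb : ℕ}
    (hA : Scheme.Admissible P t qs qh qb A) :
    HORS.Admissible P (260 * (t + P.k * P.hashTime)) (min qs 1) (qh + qs + 1)
      (reduction P j A) := by
  intro pk hpk coin orc horc
  have hlen : Lengths P pk orc := ⟨hs, hpk, horc⟩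
  obtain ⟨c, e, n, hex, hv, ht, hb⟩ := exists_simEnv_exec hpk (tapeSource_valid P coin) horc hJ hj'
    hj hA
  obtain ⟨d, m, hd, hm, -, -, hlog⟩ := reduction_runs hlen hJ hj' hj hex
  have hk : 1 + 2 * P.κ ≤ P.k * P.hashTime :=
    le_trans (by unfold Params.hashTime; omega) (Nat.le_mul_of_pos_left _ P.k_pos)
  refine ⟨d, m, hd, ?_, ?_⟩
  · have := size_reduction_le hs j A
    omega
  · rw [hlog]
    obtain ⟨i, _, _, hi⟩ := hv.sim.sig
    have h1 := hv.sigCount_le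
    have h2 := hv.roCount_le
    have h3 := hb.1
    have h4 := hb.2.1
    refine ⟨le_min ?_ ?_, ?_⟩
    · exact h1.trans h3
    · change sigCount _ ≤ _
      rw [hi]; split_ifs <;> omega
    · change roCount _ ≤ _
      omega

/-! ### Local constancy of runs -/

section

variable {X α β γ : Type} [TopologicalSpace X]

/-- Near a point the argument `g` is constant first, and then `f` at this fixed argument is. -/
theorem IsLocallyConstant.apply {f : X → α → β} {g : X → α}
    (hf : ∀ a, IsLocallyConstant fun x => f x a) (hg : IsLocallyConstant g) :
    IsLocallyConstant fun x => f x (g x) := by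
  rw [IsLocallyConstant.iff_eventually_eq]
  intro x
  filter_upwards [hg.eventually_eq x, (hf (g x)).eventually_eq x] with y h1 h2
  rw [h1, h2]

theorem IsLocallyConstant.list_map {f : X → α → β} (hf : ∀ a, IsLocallyConstant fun x => f x a)
    {l : X → List α} (hl : IsLocallyConstant l) : IsLocallyConstant fun x => (l x).map (f x) := by
  refine IsLocallyConstant.apply (f := fun x l => l.map (f x)) (fun l => ?_) hl
  induction l with
  | nil => exact IsLocallyConstant.const _
  | cons a l ih => exact IsLocallyConstant.comp₂ (hf a) ih List.cons

theorem isLocallyConstant_ofFn {ι : Type} {n : ℕ} (p : Fin n → ι) :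
    IsLocallyConstant fun ω : ι → Bool => List.ofFn fun b => ω (p b) := by
  refine IsLocallyConstant.comp (f := fun (ω : ι → Bool) b => ω (p b)) ?_ List.ofFn
  rw [IsLocallyConstant.iff_continuous]
  fun_prop

theorem isLocallyConstant_apply {ι : Type} (i : ι) :
    IsLocallyConstant fun ω : ι → Bool => ω i := by
  rw [IsLocallyConstant.iff_continuous]
  fun_prop

/-- With countably many bits, open sets of the product space belong to the product σ-algebra. This
is the reason for the countability instances of the name types. -/
theorem IsLocallyConstant.measurableSet {ι : Type} [Countable ι] {f : (ι → Bool) → α}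
    (hf : IsLocallyConstant f) (p : α → Prop) : MeasurableSet {ω | p (f ω)} :=
  (hf {a | p a}).measurableSet

/-- A halting run uses finitely many coins and answers, and each of them is constant near `x₀`. -/
theorem EnvExec.eventually {Q E : Type} {env : X → Env Q E} {x₀ : X}
    (hflip : ∀ i e, ∀ᶠ x in nhds x₀, (env x).flip i e = (env x₀).flip i e)
    (hquery : ∀ q y e, ∀ᶠ x in nhds x₀, (env x).query q y e = (env x₀).query q y e)
    {p : Prog Q} {c c' : Config Q} {e e' : E} {n : ℕ} (h : EnvExec (env x₀) p c e c' e' n) :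
    ∀ᶠ x in nhds x₀, EnvExec (env x) p c e c' e' n := by
  induction h with
  | skip c e => exact .of_forall fun x => .skip c e
  | op o c e => exact .of_forall fun x => .op o c e
  | flip r c e =>
    filter_upwards [hflip c.coins e] with x hx
    rw [← hx]; exact .flip r c e
  | query q y z c e =>
    filter_upwards [hquery q (c.reg y) e] with x hx
    rw [← hx]; exact .query q y z c e
  | seq _ _ ih ih' => filter_upwards [ih, ih'] with x h h' using .seq h h'
  | ifEq_true hc _ ih => filter_upwards [ih] with x h using .ifEq_true hc h
  | ifEq_false hc _ ih => filter_upwards [ih] with x h using .ifEq_false hc h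
  | ifLt_true hc _ ih => filter_upwards [ih] with x h using .ifLt_true hc h
  | ifLt_false hc _ ih => filter_upwards [ih] with x h using .ifLt_false hc h
  | loop_done hc => exact .of_forall fun x => .loop_done hc
  | loop_step hc _ _ ih ih' => filter_upwards [ih, ih'] with x h h' using .loop_step hc h h'

theorem Exec.eventually {Q : Type} {coin : X → ℕ → Bool} {orc : X → Oracle Q} {x₀ : X}
    (hcoin : ∀ i, IsLocallyConstant fun x => coin x i)
    (horc : ∀ l q y, IsLocallyConstant fun x => orc x l q y)
    {p : Prog Q} {c c' : Config Q} {n : ℕ} (h : Exec (coin x₀) (orc x₀) p c c' n) :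
    ∀ᶠ x in nhds x₀, Exec (coin x) (orc x) p c c' n := by
  induction h with
  | skip c => exact .of_forall fun x => .skip c
  | op o c => exact .of_forall fun x => .op o c
  | flip r c =>
    filter_upwards [(hcoin c.coins).eventually_eq x₀] with x hx
    rw [← hx]; exact .flip r c
  | query q y z c =>
    filter_upwards [(horc c.log q (c.reg y)).eventually_eq x₀] with x hx
    rw [← hx]; exact .query q y z c
  | seq _ _ ih ih' => filter_upwards [ih, ih'] with x h h' using .seq h h'
  | ifEq_true hc _ ih => filter_upwards [ih] with x h using .ifEq_true hc h
  | ifEq_false hc _ ih => filter_upwards [ih] with x h using .ifEq_false hc h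
  | ifLt_true hc _ ih => filter_upwards [ih] with x h using .ifLt_true hc h
  | ifLt_false hc _ ih => filter_upwards [ih] with x h using .ifLt_false hc h
  | loop_done hc => exact .of_forall fun x => .loop_done hc
  | loop_step hc _ _ ih ih' => filter_upwards [ih, ih'] with x h h' using .loop_step hc h h'

/-- A family of sources whose values are locally constant. -/
structure Source.LocallyConstant (src : X → Source) : Prop where
  pair : ∀ h a, IsLocallyConstant fun x => (src x).pair h a
  bit : ∀ h i, IsLocallyConstant fun x => (src x).bit h i

theorem Handler.run_isLocallyConstant {src : X → Source} {orc : X → Oracle HORS.Query}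
    (hsrc : Source.LocallyConstant src) (horc : ∀ l q y, IsLocallyConstant fun x => orc x l q y)
    (h : Handler α) (w : Record) : IsLocallyConstant fun x => h.run (src x) (orc x) w := by
  induction h generalizing w with
  | ret r => exact IsLocallyConstant.const _
  | samp a f ih =>
    exact IsLocallyConstant.apply
      (f := fun x (s : Str × Str) => (f s.1 s.2).run (src x) (orc x) ⟨.samp a :: w.hist, w.log⟩)
      (fun s => ih _ _ _) (hsrc.pair w.hist a)
  | call q y f ih =>
    exact IsLocallyConstant.apply
      (f := fun x s => (f s).run (src x) (orc x) ⟨w.hist, (q, y) :: w.log⟩)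
      (fun s => ih _ _) (horc w.log q y)

end

/-- The final state of the adversary and of the simulator. -/
noncomputable def simRun (P : Params) (j : ℕ) (pk : Str) (src : Source) (orc : Oracle HORS.Query)
    (A : Prog Scheme.Query) : Config Scheme.Query × Sim :=
  open Classical in
  if h : ∃ r : Config Scheme.Query × Sim, ∃ n, EnvExec (simEnv P j pk src orc) A
    (Config.start _ []) (Sim.start P) r.1 r.2 n then h.choose
  else (Config.start _ [], Sim.start P)

section

variable {P : Params} {j : ℕ} {pk : Str} {src : Source} {orc : Oracle HORS.Query}
  {A : Prog Scheme.Query}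

theorem Source.not_differ (src : Source) (h : List Event) (ev : Event) :
    ¬ src.Differ src h ev := by
  cases ev <;> simp [Source.Differ]

/-- A source never differs from itself, so the alternative of divergence is empty and runs are
unique. -/
theorem simRun_eq {c : Config Scheme.Query} {e : Sim} {n : ℕ}
    (h : EnvExec (simEnv P j pk src orc) A (Config.start _ []) (Sim.start P) c e n) :
    simRun P j pk src orc A = (c, e) := by
  have h' : ∃ r : Config Scheme.Query × Sim, ∃ n, EnvExec (simEnv P j pk src orc) A
    (Config.start _ []) (Sim.start P) r.1 r.2 n := ⟨(c, e), n, h⟩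
  rw [simRun, dif_pos h']
  obtain ⟨m, hm⟩ := h'.choose_spec
  rcases simEnv_diverge hm h with ⟨h1, -, h2⟩ | ⟨ev, l, -, -, h3⟩
  · exact Prod.ext h1 h2
  · exact absurd h3 (src.not_differ _ _)

theorem simRun_isLocallyConstant {X : Type} [TopologicalSpace X] {pk : X → Str} {src : X → Source}
    {orc : X → Oracle HORS.Query} (hpk : IsLocallyConstant pk)
    (hsrc : Source.LocallyConstant src) (horc : ∀ l q y, IsLocallyConstant fun x => orc x l q y)
    (h : ∀ x, ∃ c e n, EnvExec (simEnv P j (pk x) (src x) (orc x)) A (Config.start _ [])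
      (Sim.start P) c e n) :
    IsLocallyConstant fun x => simRun P j (pk x) (src x) (orc x) A := by
  rw [IsLocallyConstant.iff_eventually_eq]
  intro x
  obtain ⟨c, e, n, hex⟩ := h x
  have := EnvExec.eventually (env := fun x => simEnv P j (pk x) (src x) (orc x)) (x₀ := x) ?_ ?_ hex
  · filter_upwards [this] with y hy
    rw [simRun_eq hex, simRun_eq hy]
  · intro i e
    filter_upwards [(hsrc.bit e.rcd.hist i).eventually_eq x] with y hy
    simp only [simEnv, hy]
  · intro q y e
    have h1 := Handler.run_isLocallyConstant hsrc horc (handle P j (pk x) q y e.tab)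
      ⟨asks P q y ++ e.rcd.hist, e.rcd.log⟩
    filter_upwards [hpk.eventually_eq x, h1.eventually_eq x] with z hz hz'
    simp only [simEnv, hz, hz']

end

/-! ### Local constancy of the experiments -/

section

variable {X : Type} [TopologicalSpace X] {P : Params} {H : X → Hash}

theorem isLocallyConstant_msgIndices (hH : ∀ i y, IsLocallyConstant fun x => H x i y) (M : Str) :
    IsLocallyConstant fun x => msgIndices P (H x) M :=
  (hH 0 M).comp fun h => (blocks P.τ P.k h).map val

theorem isLocallyConstant_hash (hH : ∀ i y, IsLocallyConstant fun x => H x i y) (i : Fin 3)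
    {y : X → Str} (hy : IsLocallyConstant y) : IsLocallyConstant fun x => H x i (y x) :=
  IsLocallyConstant.apply (f := fun x => H x i) (hH i) hy

theorem isLocallyConstant_iterate (hH : ∀ i y, IsLocallyConstant fun x => H x i y) (i : Fin 3)
    {y : X → Str} (hy : IsLocallyConstant y) (n : ℕ) :
    IsLocallyConstant fun x => (H x i)^[n] (y x) := by
  induction n generalizing y with
  | zero => exact hy
  | succ n ih => exact ih (isLocallyConstant_hash hH i hy)

theorem isLocallyConstant_publicKey (hH : ∀ i y, IsLocallyConstant fun x => H x i y)
    {s : X → ℕ → Str} (hs : ∀ i, IsLocallyConstant fun x => s x i) :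
    IsLocallyConstant fun x => HORS.publicKey P (H x) (s x) :=
  IsLocallyConstant.list_map (fun i => isLocallyConstant_hash hH 2 (hs i)) (IsLocallyConstant.const _)

theorem isLocallyConstant_secrets (hH : ∀ i y, IsLocallyConstant fun x => H x i y)
    {y : X → Str} (hy : IsLocallyConstant y) (i : ℕ) :
    IsLocallyConstant fun x => Scheme.secrets P (H x) (y x) i :=
  isLocallyConstant_hash hH 1 (hy.comp (· ++ enc P.τ i))

theorem HORS.isLocallyConstant_hash (P : Params) (i : Fin 3) (y : Str) :
    IsLocallyConstant fun ω : HORS.Sample P => HORS.hash ω i y :=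
  isLocallyConstant_ofFn _

theorem HORS.isLocallyConstant_oracle (P : Params) (l : List (HORS.Query × Str)) (q : HORS.Query)
    (y : Str) : IsLocallyConstant fun ω : HORS.Sample P => HORS.oracle ω l q y := by
  cases q with
  | ro i => exact HORS.isLocallyConstant_hash P i y
  | sig =>
    refine IsLocallyConstant.comp ?_ List.flatten
    exact IsLocallyConstant.list_map (fun i => isLocallyConstant_ofFn _)
      (isLocallyConstant_msgIndices (HORS.isLocallyConstant_hash P) y)

theorem HORS.isLocallyConstant_publicKey (P : Params) :
    IsLocallyConstant fun ω : HORS.Sample P =>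
      (HORS.publicKey P (HORS.hash ω) (HORS.secretKey ω)).flatten :=
  (PQHases.isLocallyConstant_publicKey (HORS.isLocallyConstant_hash P)
    fun _ => isLocallyConstant_ofFn _).comp List.flatten

theorem Scheme.isLocallyConstant_hash (P : Params) (i : Fin 3) (y : Str) :
    IsLocallyConstant fun ω : Scheme.Sample P => Scheme.hash ω i y :=
  isLocallyConstant_ofFn _

theorem Scheme.isLocallyConstant_masterKey (P : Params) :
    IsLocallyConstant fun ω : Scheme.Sample P => Scheme.masterKey ω :=
  isLocallyConstant_ofFn _

theorem Scheme.isLocallyConstant_signerKey (P : Params) (ID : Str) (n : ℕ) :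
    IsLocallyConstant fun ω : Scheme.Sample P =>
      Scheme.signerKey (Scheme.hash ω) (Scheme.masterKey ω) ID n :=
  isLocallyConstant_iterate (Scheme.isLocallyConstant_hash P) 1
    (PQHases.isLocallyConstant_hash (Scheme.isLocallyConstant_hash P) 0
      ((Scheme.isLocallyConstant_masterKey P).comp (· ++ ID))) n

theorem Scheme.isLocallyConstant_comConstr (P : Params) (ID : Str) (j : ℕ) :
    IsLocallyConstant fun ω : Scheme.Sample P =>
      Scheme.comConstr P (Scheme.hash ω) (Scheme.masterKey ω) ID j := by
  have hH := Scheme.isLocallyConstant_hash P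
  refine IsLocallyConstant.list_map (fun i => PQHases.isLocallyConstant_hash hH 2
    (isLocallyConstant_secrets hH (isLocallyConstant_iterate hH 1 ?_ _) i))
    (IsLocallyConstant.const _)
  generalize (j - 1) / P.J₂ = m
  induction m with
  | zero =>
    exact PQHases.isLocallyConstant_hash hH 0
      ((Scheme.isLocallyConstant_masterKey P).comp (· ++ ID))
  | succ m ih => exact isLocallyConstant_iterate hH 1 ih _

theorem Scheme.isLocallyConstant_oracle (P : Params) (ID : Str) (l : List (Scheme.Query × Str))
    (q : Scheme.Query) (y : Str) :
    IsLocallyConstant fun ω : Scheme.Sample P => Scheme.oracle ID ω l q y := by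
  have hH := Scheme.isLocallyConstant_hash P
  cases q with
  | ro i => exact hH i y
  | sig =>
    simp only [Scheme.oracle]
    split_ifs
    · refine IsLocallyConstant.comp ?_ List.flatten
      exact IsLocallyConstant.list_map (fun i => isLocallyConstant_secrets hH
        (Scheme.isLocallyConstant_signerKey P ID _) i) (isLocallyConstant_msgIndices hH y)
    · exact IsLocallyConstant.const _
  | com =>
    simp only [Scheme.oracle]
    split_ifs
    · exact (Scheme.isLocallyConstant_comConstr P ID _).comp List.flatten
    · exact IsLocallyConstant.const _
  | brk =>
    simp only [Scheme.oracle]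
    split_ifs
    · exact Scheme.isLocallyConstant_signerKey P ID _
    · exact IsLocallyConstant.const _

theorem Scheme.isLocallyConstant_ver (P : Params) (IDs : List Str) (M : Str)
    (σ : Scheme.Signature) :
    IsLocallyConstant fun ω : Scheme.Sample P =>
      Scheme.Ver P (Scheme.hash ω) (Scheme.masterKey ω) IDs M σ := by
  have hH := Scheme.isLocallyConstant_hash P
  have h1 : IsLocallyConstant fun ω : Scheme.Sample P => σ.s.map (Scheme.hash ω 2) :=
    IsLocallyConstant.list_map (hH 2) (IsLocallyConstant.const _)
  have h2 := (isLocallyConstant_msgIndices (P := P) hH M).comp₂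
    (Scheme.isLocallyConstant_comConstr P σ.id σ.epoch) fun l C => l.map fun i => C.getD i []
  exact (h1.comp₂ h2 Eq).comp fun p => σ.id ∈ IDs ∧ 1 ≤ σ.epoch ∧ σ.epoch ≤ P.J ∧ p

end

/-- The adversary wins with a signature for epoch `j`. -/
def WinsAt (P : Params) (IDs : List Str) (ID : Str) (A : Prog Scheme.Query) (j : ℕ)
    (ω : Scheme.Sample P) : Prop :=
  ∃ c n, Exec (fun i => ω (.coin i)) (Scheme.oracle ID ω) A (Config.start _ []) c n ∧
    (Scheme.Query.sig, c.reg 0) ∉ c.log ∧ ¬ Scheme.Exposed c.log j ∧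
    (c.reg 1).length = P.k * P.κ ∧ val (c.reg 2) = j ∧
    Scheme.Ver P (Scheme.hash ω) (Scheme.masterKey ω) IDs (c.reg 0)
      ⟨blocks P.κ P.k (c.reg 1), j, ID⟩

theorem Scheme.Wins.winsAt {P : Params} {IDs : List Str} {ID : Str} {A : Prog Scheme.Query}
    {ω : Scheme.Sample P} (h : Scheme.Wins P IDs ID A ω) :
    ∃ j, 1 ≤ j ∧ j ≤ P.J ∧ WinsAt P IDs ID A j ω := by
  obtain ⟨c, n, h1, h2, h3, h4, h5⟩ := h
  exact ⟨val (c.reg 2), h5.2.1, h5.2.2.1, c, n, h1, h2, h3, h4, rfl, h5⟩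

instance (κ : ℕ) : Countable (Scheme.Bits κ) := by
  refine Function.Injective.countable (f := fun x : Scheme.Bits κ =>
    (match x with
      | .ro i y b => .inl (i, y, b)
      | .msk b => .inr (.inl b)
      | .coin n => .inr (.inr n) : (Fin 3 × Str × Fin κ) ⊕ Fin κ ⊕ ℕ)) ?_
  rintro (_ | _ | _) (_ | _ | _) h <;> simp_all

instance (κ : ℕ) : Countable (HORS.Bits κ) := by
  refine Function.Injective.countable (f := fun x : HORS.Bits κ =>
    (match x with
      | .ro i y b => .inl (i, y, b)
      | .key i b => .inr (.inl (i, b))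
      | .coin n => .inr (.inr n) : (Fin 3 × Str × Fin κ) ⊕ (ℕ × Fin κ) ⊕ ℕ)) ?_
  rintro (_ | _ | _) (_ | _ | _) h <;> simp_all

/-- A win is witnessed by one halting run and finitely many bits, so it is an open event.
Measurability is needed for the passage to the complement in `winsAt_le_program`. -/
theorem measurableSet_winsAt (P : Params) (IDs : List Str) (ID : Str) (A : Prog Scheme.Query)
    (j : ℕ) : MeasurableSet {ω | WinsAt P IDs ID A j ω} := by
  refine IsOpen.measurableSet (isOpen_iff_eventually.2 ?_)
  rintro ω ⟨c, n, h1, h2, h3, h4, h5, h6⟩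
  have := Exec.eventually (coin := fun (ω : Scheme.Sample P) i => ω (.coin i))
    (orc := fun ω => Scheme.oracle ID ω)
    (fun i => isLocallyConstant_apply _) (Scheme.isLocallyConstant_oracle P ID) h1
  filter_upwards [this, (Scheme.isLocallyConstant_ver P IDs (c.reg 0)
    ⟨blocks P.κ P.k (c.reg 1), j, ID⟩).eventually_eq ω] with ω' h h'
  exact ⟨c, n, h, h2, h3, h4, h5, by rw [h']; exact h6⟩

/-! ### The experiment with named random bits -/

/-- Names of the random bits: bits of the random oracles, bits of the secret strings of HORS, bits of
the string sampled for an address and of its image under `H 2`, bits of the master key, coins of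
the adversary, unused coins. -/
inductive NamedBit (κ : ℕ)
  | ro (i : Fin 3) (x : Str) (b : Fin κ)
  | key (i : ℕ) (b : Fin κ)
  | cell (a : Str) (b : Fin κ)
  | img (a : Str) (b : Fin κ)
  | msk (b : Fin κ)
  | coin (n : ℕ)
  | extra (n : ℕ)

instance (κ : ℕ) : Countable (NamedBit κ) := by
  refine Function.Injective.countable (f := fun x : NamedBit κ =>
    (match x with
      | .ro i y b => .inl (i, y, b)
      | .key i b => .inr (.inl (i, b))
      | .cell a b => .inr (.inr (.inl (a, b)))
      | .img a b => .inr (.inr (.inr (.inl (a, b))))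
      | .msk b => .inr (.inr (.inr (.inr (.inl b))))
      | .coin n => .inr (.inr (.inr (.inr (.inr (.inl n)))))
      | .extra n => .inr (.inr (.inr (.inr (.inr (.inr n))))) :
      (Fin 3 × Str × Fin κ) ⊕ (ℕ × Fin κ) ⊕ (Str × Fin κ) ⊕ (Str × Fin κ) ⊕ Fin κ ⊕ ℕ ⊕ ℕ)) ?_
  rintro (_ | _ | _ | _ | _ | _ | _) (_ | _ | _ | _ | _ | _ | _) h <;> simp_all

instance : Countable Event := by
  refine Function.Injective.countable (f := fun x : Event =>
    (match x with
      | .ask y => .inl y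
      | .samp a => .inr (.inl a)
      | .flip n => .inr (.inr n) : Str ⊕ Str ⊕ ℕ)) ?_
  rintro (_ | _ | _) (_ | _ | _) h <;> simp_all

namespace Named

abbrev Sample (P : Params) := NamedBit P.κ → Bool

variable {P : Params}

def horsBit {κ : ℕ} : HORS.Bits κ → NamedBit κ
  | .ro i x b => .ro i x b
  | .key i b => .key i b
  | .coin n => .extra n

/-- The random oracles and secret strings. -/
def hors (ω : Sample P) : HORS.Sample P := ω ∘ horsBit

def cell (ω : Sample P) (a : Str) : Str := List.ofFn fun b : Fin P.κ => ω (.cell a b)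

def img (ω : Sample P) (a : Str) : Str := List.ofFn fun b : Fin P.κ => ω (.img a b)

def masterKey (ω : Sample P) : Str := List.ofFn fun b : Fin P.κ => ω (.msk b)

def source (ω : Sample P) : Source where
  pair _ a := (cell ω a, img ω a)
  bit _ i := ω (.coin i)

theorem source_valid (ω : Sample P) : (source ω).Valid P :=
  fun _ _ => ⟨by simp [source, cell], by simp [source, img]⟩

theorem source_locallyConstant : Source.LocallyConstant fun ω : Sample P => source ω :=
  ⟨fun _ _ => (isLocallyConstant_ofFn _).prodMk (isLocallyConstant_ofFn _),
    fun _ _ => isLocallyConstant_apply _⟩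

end Named

namespace HORS

/-- The public key as an input string. -/
def keyString {P : Params} (ω : Sample P) : Str := (publicKey P (hash ω) (secretKey ω)).flatten

theorem length_flatten {l : List Str} {n : ℕ} (h : ∀ x ∈ l, x.length = n) :
    l.flatten.length = l.length * n := by
  induction l with
  | nil => simp
  | cons x l ih =>
    rw [List.flatten_cons, List.length_append, ih fun y hy => h y (List.mem_cons_of_mem _ hy),
      h x List.mem_cons_self, List.length_cons]
    ring

theorem length_keyString {P : Params} (ω : Sample P) : (keyString ω).length = P.T * P.κ := by
  rw [keyString, length_flatten (n := P.κ)]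
  · simp [publicKey]
  · simp [publicKey, hash]

theorem length_oracle {P : Params} (ω : Sample P) (l : List (Query × Str)) (q : Query) (x : Str) :
    AnswerLength P q (oracle ω l q x).length := by
  cases q with
  | ro i => simp [oracle, hash, AnswerLength]
  | sig =>
    rw [oracle, AnswerLength, length_flatten (n := P.κ)]
    · simp [sign, msgIndices, blocks]
    · simp [sign, secretKey]

end HORS

/-! ### Coins on the tape of the reduction and named bits -/

section

variable {P : Params} {j : ℕ} {A : Prog Scheme.Query}

/-- The final state of the adversary and of the simulator, with named random bits. -/
noncomputable def namedRun (P : Params) (j : ℕ) (A : Prog Scheme.Query) (ω : Named.Sample P) :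
    Config Scheme.Query × Sim :=
  simRun P j (HORS.keyString (Named.hors ω)) (Named.source ω) (HORS.oracle (Named.hors ω)) A

/-- The reduction wins. -/
def NamedWins (P : Params) (j : ℕ) (A : Prog Scheme.Query) (ω : Named.Sample P) : Prop :=
  (HORS.Query.sig, (namedRun P j A ω).1.reg 0) ∉ (namedRun P j A ω).2.rcd.log ∧
  ((namedRun P j A ω).1.reg 1).length = P.k * P.κ ∧
  HORS.Ver P (HORS.hash (Named.hors ω))
    (HORS.publicKey P (HORS.hash (Named.hors ω)) (HORS.secretKey (Named.hors ω)))
    ((namedRun P j A ω).1.reg 0) (blocks P.κ P.k ((namedRun P j A ω).1.reg 1))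

/-- The name of the `n`-th coin of the reduction, given the events. -/
def coinName (P : Params) : List Event → ℕ → NamedBit P.κ
  | [], n => .extra n
  | .ask _ :: h, n => coinName P h n
  | .flip i :: h, n => if n = coinCount P h then .coin i else coinName P h n
  | .samp a :: h, n =>
      if hn : coinCount P h ≤ n ∧ n < coinCount P h + P.κ then
        .cell a ⟨n - coinCount P h, by omega⟩
      else if hn : coinCount P h + P.κ ≤ n ∧ n < coinCount P h + P.κ + P.κ then
        .img a ⟨n - (coinCount P h + P.κ), by omega⟩
      else coinName P h n

theorem coinCount_cons (ev : Event) (h : List Event) :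
    coinCount P (ev :: h) = ev.coins P + coinCount P h := by
  simp [coinCount]

/-- A coin that has been used keeps its name: a later event names only coins beyond the current
position of the tape. -/
theorem coinName_cons {ev : Event} {h : List Event} {n : ℕ} (hn : n < coinCount P h) :
    coinName P (ev :: h) n = coinName P h n := by
  cases ev with
  | ask => rfl
  | flip i => rw [coinName, if_neg (by omega)]
  | samp a => rw [coinName, dif_neg (by omega), dif_neg (by omega)]

theorem coinCount_suffix {h h' : List Event} (hs : h <:+ h') : coinCount P h ≤ coinCount P h' := by
  obtain ⟨l, rfl⟩ := hs
  simp [coinCount]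

theorem coinName_suffix {h h' : List Event} (hs : h <:+ h') {n : ℕ} (hn : n < coinCount P h) :
    coinName P h' n = coinName P h n := by
  obtain ⟨l, rfl⟩ := hs
  induction l with
  | nil => rfl
  | cons ev l ih =>
    rw [List.cons_append, coinName_cons, ih]
    exact hn.trans_le (coinCount_suffix (List.suffix_append l h))

theorem coinName_samp {a : Str} {l h : List Event} (hs : (.samp a :: l) <:+ h) (b : Fin P.κ) :
    coinName P h (coinCount P l + b) = .cell a b ∧
      coinName P h (coinCount P l + P.κ + b) = .img a b := by
  have hb := b.2
  have hc : coinCount P (.samp a :: l) = 2 * P.κ + coinCount P l := coinCount_cons _ _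
  rw [coinName_suffix hs (by omega), coinName_suffix hs (by omega)]
  constructor
  · rw [coinName, dif_pos (by omega)]; simp
  · rw [coinName, dif_neg (by omega), dif_pos (by omega)]; simp

theorem coinName_flip {i : ℕ} {l h : List Event} (hs : (.flip i :: l) <:+ h) :
    coinName P h (coinCount P l) = .coin i := by
  have hc : coinCount P (.flip i :: l) = 1 + coinCount P l := coinCount_cons _ _
  rw [coinName_suffix hs (by omega), coinName, if_pos rfl]

/-- The names of coins, given the events. -/
def NamedBit.Used {κ : ℕ} (h : List Event) : NamedBit κ → Prop
  | .cell a _ | .img a _ => Event.samp a ∈ h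
  | .coin i => Event.flip i ∈ h
  | .extra _ => True
  | _ => False

theorem NamedBit.Used.cons {κ : ℕ} {h : List Event} {x : NamedBit κ} (hx : x.Used h) (ev : Event) :
    x.Used (ev :: h) := by
  cases x <;> simp_all [NamedBit.Used]

theorem used_coinName (h : List Event) (n : ℕ) : (coinName P h n).Used h := by
  induction h with
  | nil => trivial
  | cons ev h ih =>
    cases ev with
    | ask => exact ih.cons _
    | flip i =>
      rw [coinName]
      split_ifs
      · simp [NamedBit.Used]
      · exact ih.cons _
    | samp a =>
      rw [coinName]
      split_ifs
      · simp [NamedBit.Used]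
      · simp [NamedBit.Used]
      · exact ih.cons _

/-- The names given by a history, other than `extra`, mention an event of that history, whereas a
fresh event brings names that have not occurred; coins not named by an event keep the distinct names
`extra`. -/
theorem coinName_injective {h : List Event} (hf : FreshEvents h) : (coinName P h).Injective := by
  induction h with
  | nil => intro m n hmn; simpa [coinName] using hmn
  | cons ev h ih =>
    have used := used_coinName (P := P) h
    cases ev with
    | ask => exact ih hf
    | flip i =>
      intro m n hmn
      have hm := used m
      have hn := used n
      simp only [coinName] at hmn
      split_ifs at hmn with h1 h2 h2
      · rw [h1, h2]
      · rw [← hmn] at hn; exact absurd hn hf.1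
      · rw [hmn] at hm; exact absurd hm hf.1
      · exact ih hf.2 hmn
    | samp a =>
      intro m n hmn
      have hm := used m
      have hn := used n
      simp only [coinName] at hmn
      split_ifs at hmn with h1 h2 h3 h2 h3 h4 h4
      all_goals first
        | (simp at hmn; omega)
        | (rw [← hmn] at hn; exact absurd hn hf.1)
        | (rw [hmn] at hm; exact absurd hm hf.1)
        | exact ih hf.2 hmn

/-- The names of the bits of the experiment of HORS, given the events. -/
def bitName (P : Params) (h : List Event) : HORS.Bits P.κ → NamedBit P.κ
  | .ro i x b => .ro i x b
  | .key i b => .key i b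
  | .coin n => coinName P h n

theorem bitName_injective {h : List Event} (hf : FreshEvents h) : (bitName P h).Injective := by
  have used := used_coinName (P := P) h
  rintro (⟨i, x, b⟩ | ⟨i, b⟩ | m) (⟨i', x', b'⟩ | ⟨i', b'⟩ | n) hmn <;>
    simp only [bitName] at hmn
  · cases hmn; rfl
  · cases hmn
  · have := used n; rw [← hmn] at this; exact this.elim
  · cases hmn
  · cases hmn; rfl
  · have := used n; rw [← hmn] at this; exact this.elim
  · have := used m; rw [hmn] at this; exact this.elim
  · have := used m; rw [hmn] at this; exact this.elim
  · rw [coinName_injective hf hmn]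

section

variable {t qs qh qb : ℕ}

theorem namedRun_exec (hJ : 0 < P.J) (hj' : 0 < j) (hj : j ≤ P.J)
    (hA : Scheme.Admissible P t qs qh qb A) (ω : Named.Sample P) :
    ∃ n, EnvExec (simEnv P j (HORS.keyString (Named.hors ω)) (Named.source ω)
      (HORS.oracle (Named.hors ω))) A (Config.start _ []) (Sim.start P) (namedRun P j A ω).1
      (namedRun P j A ω).2 n ∧ JointValid P j (namedRun P j A ω).1 (namedRun P j A ω).2 ∧
      Scheme.Budget qs qh qb (namedRun P j A ω).1.log := by
  obtain ⟨c, e, n, h, h', _, h''⟩ := exists_simEnv_exec (HORS.length_keyString (Named.hors ω))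
    (Named.source_valid ω) (HORS.length_oracle (Named.hors ω)) hJ hj' hj hA
  rw [namedRun, simRun_eq h]
  exact ⟨n, h, h', h''⟩

theorem namedRun_isLocallyConstant (hJ : 0 < P.J) (hj' : 0 < j) (hj : j ≤ P.J)
    (hA : Scheme.Admissible P t qs qh qb A) :
    IsLocallyConstant (namedRun P j A) := by
  have hc : Continuous (Named.hors : Named.Sample P → HORS.Sample P) := by
    unfold Named.hors Function.comp; fun_prop
  refine simRun_isLocallyConstant ?_ Named.source_locallyConstant ?_ fun ω => ?_
  · exact (HORS.isLocallyConstant_publicKey P).comp_continuous hc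
  · exact fun l q y => (HORS.isLocallyConstant_oracle P l q y).comp_continuous hc
  · obtain ⟨n, h, -⟩ := namedRun_exec hJ hj' hj hA ω
    exact ⟨_, _, n, h⟩

/-- The tape is read in the order of need, while named bits are attached to addresses; `bitName` of
the final history translates between them. Histories form a countable set, and the history can be
recovered by running on the translated tape, so `fairBits_relabel` applies although the translation
depends on the sample point. -/
theorem namedWins_le_advantage (hJ : 0 < P.J) (hj' : 0 < j) (hj : j ≤ P.J)
    (hA : Scheme.Admissible P t qs qh qb A)
    (hs : P.J.size ≤ P.κ) :
    fairBits (NamedBit P.κ) {ω | NamedWins P j A ω} ≤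
      HORS.advantage P (reduction P j A) := by
  let tapeRun : HORS.Sample P → Config Scheme.Query × Sim := fun ω =>
    simRun P j (HORS.keyString ω) (tapeSource P fun i => ω (.coin i)) (HORS.oracle ω) A
  have hex : ∀ ω : HORS.Sample P, ∃ n, EnvExec (simEnv P j (HORS.keyString ω)
      (tapeSource P fun i => ω (.coin i)) (HORS.oracle ω)) A (Config.start _ []) (Sim.start P)
      (tapeRun ω).1 (tapeRun ω).2 n := by
    intro ω
    obtain ⟨c, e, n, h, -⟩ := exists_simEnv_exec (HORS.length_keyString ω)
      (tapeSource_valid P fun i => ω (.coin i)) (HORS.length_oracle ω) hJ hj' hj hA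
    refine ⟨n, ?_⟩
    simp only [tapeRun]
    rw [simRun_eq h]
    exact h
  have hlc : IsLocallyConstant tapeRun := by
    refine simRun_isLocallyConstant (HORS.isLocallyConstant_publicKey P) ⟨?_, ?_⟩
      (HORS.isLocallyConstant_oracle P) fun ω => ?_
    · exact fun h a => (isLocallyConstant_ofFn _).prodMk (isLocallyConstant_ofFn _)
    · exact fun _ _ => isLocallyConstant_apply _
    · obtain ⟨n, h⟩ := hex ω
      exact ⟨_, _, n, h⟩
  -- At each request in the history of the named run, the tape position given by the earlier events
  -- carries exactly the named bits requested. The two sources thus agree where it matters, and the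
  -- runs coincide.
  have key : ∀ ω, tapeRun (ω ∘ bitName P (namedRun P j A ω).2.rcd.hist) = namedRun P j A ω := by
    intro ω
    obtain ⟨n, h1, -⟩ := namedRun_exec hJ hj' hj hA ω
    obtain ⟨m, h2⟩ := hex (ω ∘ bitName P (namedRun P j A ω).2.rcd.hist)
    have horc : HORS.oracle (ω ∘ bitName P (namedRun P j A ω).2.rcd.hist) =
        HORS.oracle (Named.hors ω) := by
      funext l q x; cases q <;> rfl
    have hpk : HORS.keyString (ω ∘ bitName P (namedRun P j A ω).2.rcd.hist) =
        HORS.keyString (Named.hors ω) := rfl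
    rw [horc, hpk] at h2
    rcases simEnv_diverge h1 h2 with ⟨h3, -, h4⟩ | ⟨ev, l, h3, -, h4⟩
    · exact (Prod.ext h3 h4).symm
    · exfalso
      cases ev with
      | ask => exact h4
      | samp a =>
        refine h4 (Prod.ext ?_ ?_)
        · simp only [Named.source, tapeSource, Named.cell, Function.comp, bitName,
            (coinName_samp h3 _).1]
        · simp only [Named.source, tapeSource, Named.img, Function.comp, bitName,
            (coinName_samp h3 _).2]
      | flip i =>
        refine h4 ?_
        simp only [Named.source, tapeSource, Function.comp, bitName, coinName_flip h3]
  refine fairBits_relabel (bitName P) (fun ω => (namedRun P j A ω).2.rcd.hist)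
    (fun ω => (tapeRun ω).2.rcd.hist) (fun h => IsLocallyConstant.measurableSet hlc fun r => r.2.rcd.hist = h)
    _ _ ?_ ?_ ?_
  · intro ω _
    obtain ⟨_, -, h, -⟩ := namedRun_exec hJ hj' hj hA ω
    exact bitName_injective h.sim.tab.fresh
  · rintro ω ⟨h1, h2, h3⟩
    set ω' : HORS.Sample P := ω ∘ bitName P (namedRun P j A ω).2.rcd.hist with hω'
    obtain ⟨m, h4⟩ := hex ω'
    obtain ⟨d, n, h5, -, h6, h7, h8⟩ := reduction_runs
      ⟨hs, HORS.length_keyString ω', HORS.length_oracle ω'⟩ hJ hj' hj h4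
    rw [key ω] at h6 h7 h8
    refine ⟨d, n, h5, ?_, ?_, ?_⟩
    · rw [h6, h8]; exact h1
    · rw [h7]; exact h2
    · rw [h6, h7]; exact h3
  · intro ω _
    exact congrArg (fun r => r.2.rcd.hist) (key ω)

end

end

/-! ### Programming of the random oracles -/

/-- The private keys `sk_{n+1}` and the secret strings of epoch `n + 1`, for `n < J`. -/
abbrev Slot (P : Params) := Fin P.J ⊕ Fin P.J × Fin P.T

namespace Slot

variable {P : Params}

/-- The address of a string in the tables of the simulator. -/
def addr : Slot P → Str
  | .inl n => P.code n
  | .inr (n, i) => P.code (n + 1) ++ enc P.τ i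

/-- The secret strings of epoch `j` are not in the tables of the simulator. -/
def IsTarget (j : ℕ) : Slot P → Prop
  | .inl _ => False
  | .inr (n, _) => (n : ℕ) + 1 = j

open Classical in
/-- The names of the bits of a string. -/
noncomputable def name (j : ℕ) (d : Slot P) (b : Fin P.κ) : NamedBit P.κ :=
  match d with
  | .inl n => .cell (P.code n) b
  | .inr (n, i) => if (n : ℕ) + 1 = j then .key i b else .cell (P.code (n + 1) ++ enc P.τ i) b

/-- The strings. -/
noncomputable def value (j : ℕ) (ω : Named.Sample P) (d : Slot P) : Str :=
  List.ofFn fun b => ω (d.name j b)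

/-- The question to the random oracles whose answer is a given string. -/
def question (ID m : Str) (s : Slot P → Str) : Slot P → Fin 3 × Str
  | .inl ⟨0, _⟩ => (0, m ++ ID)
  | .inl ⟨n + 1, h⟩ => (1, s (.inl ⟨n, Nat.lt_of_succ_lt h⟩))
  | .inr (n, i) => (1, s (.inl n) ++ enc P.τ i)

/-- Addresses of keys and of secret strings differ in length because `τ > 0`; within one kind the
code and the index can be read off. -/
theorem addr_injective : (addr (P := P)).Injective := by
  have hτ := P.τ_pos
  rintro (n | ⟨n, i⟩) (n' | ⟨n', i'⟩) h <;> simp only [addr] at h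
  · rw [Fin.ext (P.code_inj n.2.le n'.2.le h)]
  · have := congrArg List.length h; simp at this; omega
  · have := congrArg List.length h; simp at this; omega
  · obtain ⟨h1, h2⟩ := List.append_inj h (by simp)
    have h3 := P.code_inj n.2 n'.2 h1
    have h4 := enc_inj i.2 i'.2 h2
    rw [Fin.ext (Nat.succ_injective h3), Fin.ext h4]

theorem name_of_not_isTarget {j : ℕ} {d : Slot P} (h : ¬ d.IsTarget j) (b : Fin P.κ) :
    d.name j b = .cell d.addr b := by
  rcases d with n | ⟨n, i⟩
  · rfl
  · exact if_neg h

theorem value_of_not_isTarget {j : ℕ} {d : Slot P} (h : ¬ d.IsTarget j) (ω : Named.Sample P) :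
    d.value j ω = Named.cell ω d.addr := by
  simp only [value, name_of_not_isTarget h, Named.cell]

theorem value_target {j : ℕ} {n : Fin P.J} (h : (n : ℕ) + 1 = j) (i : Fin P.T)
    (ω : Named.Sample P) :
    value j ω (.inr (n, i)) = HORS.secretKey (Named.hors ω) i := by
  simp only [value, name, if_pos h]
  rfl

@[simp] theorem length_value (j : ℕ) (ω : Named.Sample P) (d : Slot P) :
    (d.value j ω).length = P.κ := by
  simp [value]

theorem name_inj {j : ℕ} {d d' : Slot P} {b b' : Fin P.κ} (h : d.name j b = d'.name j b') :
    d = d' ∧ b = b' := by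
  by_cases hd : d.IsTarget j <;> by_cases hd' : d'.IsTarget j
  · rcases d with n | ⟨n, i⟩
    · exact hd.elim
    rcases d' with n' | ⟨n', i'⟩
    · exact hd'.elim
    simp only [IsTarget] at hd hd'
    simp only [name, if_pos hd, if_pos hd', NamedBit.key.injEq] at h
    refine ⟨?_, h.2⟩
    rw [Fin.ext (Nat.succ_injective (hd.trans hd'.symm)), Fin.ext h.1]
  · rw [name_of_not_isTarget hd'] at h
    rcases d with n | ⟨n, i⟩
    · exact hd.elim
    · simp only [IsTarget] at hd
      simp [name, if_pos hd] at h
  · rw [name_of_not_isTarget hd] at h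
    rcases d' with n | ⟨n, i⟩
    · exact hd'.elim
    · simp only [IsTarget] at hd'
      simp [name, if_pos hd'] at h
  · rw [name_of_not_isTarget hd, name_of_not_isTarget hd', NamedBit.cell.injEq] at h
    exact ⟨addr_injective h.1, h.2⟩

theorem name_ne_ro {j : ℕ} {d : Slot P} {b b' : Fin P.κ} {i : Fin 3} {x : Str} :
    d.name j b ≠ .ro i x b' := by
  rcases d with n | ⟨n, i⟩ <;> simp only [name]
  · simp
  · split_ifs <;> simp

theorem name_ne_img {j : ℕ} {d : Slot P} {b b' : Fin P.κ} {a : Str} :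
    d.name j b ≠ .img a b' := by
  rcases d with n | ⟨n, i⟩ <;> simp only [name]
  · simp
  · split_ifs <;> simp

theorem name_ne_msk {j : ℕ} {d : Slot P} {b b' : Fin P.κ} : d.name j b ≠ .msk b' := by
  rcases d with n | ⟨n, i⟩ <;> simp only [name]
  · simp
  · split_ifs <;> simp

theorem name_ne_coin {j : ℕ} {d : Slot P} {b : Fin P.κ} {n : ℕ} : d.name j b ≠ .coin n := by
  rcases d with n | ⟨n, i⟩ <;> simp only [name]
  · simp
  · split_ifs <;> simp

/-- Only the first key comes from `H 0`; questions for later keys have `κ` bits and questions for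
secret strings `κ + τ`. Within one kind, distinct keys or indices give distinct questions. So
distinctness of the strings alone makes the programming consistent. -/
theorem question_injective {ID m : Str} {s : Slot P → Str} (hs : s.Injective)
    (hl : ∀ d, (s d).length = P.κ) : (question ID m s).Injective := by
  have hτ := P.τ_pos
  rintro (⟨_ | n, hn⟩ | ⟨n, i⟩) (⟨_ | n', hn'⟩ | ⟨n', i'⟩) h <;>
    simp only [question, Prod.mk.injEq, true_and] at h
  · rfl
  · simp at h
  · simp at h
  · simp at h
  · have := hs h
    simp only [Sum.inl.injEq, Fin.mk.injEq] at this
    subst this; rfl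
  · have := congrArg List.length h; simp [hl] at this; omega
  · simp at h
  · have := congrArg List.length h; simp [hl] at this; omega
  · obtain ⟨h1, h2⟩ := List.append_inj h (by simp [hl])
    have h3 := hs h1
    have h4 := enc_inj i.2 i'.2 h2
    simp only [Sum.inl.injEq] at h3
    rw [h3, Fin.ext h4]

end Slot

/-! ### The sample point with programmed random oracles -/

section

variable {P : Params} {j : ℕ} {ID : Str}

open Classical in
/-- The names of the bits of the experiment in which the random oracles are programmed such that
the private keys and the secret strings are `s`. -/
noncomputable def programName (P : Params) (j : ℕ) (ID : Str) (g : Str × (Slot P → Str)) :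
    Scheme.Bits P.κ → NamedBit P.κ
  | .ro i x b =>
      if h : ∃ d, Slot.question ID g.1 g.2 d = (i, x) then h.choose.name j b
      else if h : i = 2 ∧ ∃ d : Slot P, ¬ d.IsTarget j ∧ g.2 d = x then .img h.2.choose.addr b
      else .ro i x b
  | .msk b => .msk b
  | .coin n => .coin n

theorem programName_question {g : Str × (Slot P → Str)} (hs : g.2.Injective)
    (hl : ∀ d, (g.2 d).length = P.κ) {d : Slot P} {i : Fin 3} {x : Str}
    (h : Slot.question ID g.1 g.2 d = (i, x)) (b : Fin P.κ) :
    programName P j ID g (.ro i x b) = d.name j b := by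
  have h' : ∃ d, Slot.question ID g.1 g.2 d = (i, x) := ⟨d, h⟩
  rw [programName, dif_pos h',
    Slot.question_injective hs hl (h'.choose_spec.trans h.symm)]

theorem Slot.question_ne {ID m : Str} {s : Slot P → Str} (d : Slot P) (x : Str) :
    question ID m s d ≠ (2, x) := by
  rcases d with ⟨_ | n, hn⟩ | ⟨n, i⟩ <;> simp [question]

theorem programName_value {g : Str × (Slot P → Str)} (hs : g.2.Injective) {d : Slot P}
    (hd : ¬ d.IsTarget j) (b : Fin P.κ) :
    programName P j ID g (.ro 2 (g.2 d) b) = .img d.addr b := by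
  have h' : (2 : Fin 3) = 2 ∧ ∃ d' : Slot P, ¬ d'.IsTarget j ∧ g.2 d' = g.2 d := ⟨rfl, d, hd, rfl⟩
  rw [programName, dif_neg, dif_pos h', hs h'.2.choose_spec.2]
  rintro ⟨d', h⟩
  exact d'.question_ne _ h

theorem programName_other {g : Str × (Slot P → Str)} {i : Fin 3} {x : Str}
    (h : ∀ d, Slot.question ID g.1 g.2 d ≠ (i, x))
    (h' : i = 2 → ∀ d : Slot P, ¬ d.IsTarget j → g.2 d ≠ x) (b : Fin P.κ) :
    programName P j ID g (.ro i x b) = .ro i x b := by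
  rw [programName, dif_neg (not_exists.2 h), dif_neg]
  rintro ⟨h1, d, h2, h3⟩
  exact h' h1 d h2 h3

theorem programName_ro_cases {g : Str × (Slot P → Str)} (hs : g.2.Injective)
    (hl : ∀ d, (g.2 d).length = P.κ) (i : Fin 3) (x : Str) :
    (∃ d, Slot.question ID g.1 g.2 d = (i, x) ∧
      ∀ b, programName P j ID g (.ro i x b) = d.name j b) ∨
    (i = 2 ∧ ∃ d : Slot P, ¬ d.IsTarget j ∧ g.2 d = x ∧
      ∀ b, programName P j ID g (.ro i x b) = .img d.addr b) ∨
    ∀ b, programName P j ID g (.ro i x b) = .ro i x b := by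
  by_cases h : ∃ d, Slot.question ID g.1 g.2 d = (i, x)
  · obtain ⟨d, hd⟩ := h
    exact .inl ⟨d, hd, programName_question hs hl hd⟩
  by_cases h' : i = 2 ∧ ∃ d : Slot P, ¬ d.IsTarget j ∧ g.2 d = x
  · obtain ⟨rfl, d, hd, rfl⟩ := h'
    exact .inr (.inl ⟨rfl, d, hd, rfl, programName_value hs hd⟩)
  · exact .inr (.inr (programName_other (not_exists.1 h)
      fun h1 d h2 h3 => h' ⟨h1, d, h2, h3⟩))

/-- A position of a random oracle takes the bits of a slot, image bits, or its own bits, and these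
names are of different kinds. Within a kind the slot determines the position, because its question
or its string does. -/
theorem programName_injective {g : Str × (Slot P → Str)} (hs : g.2.Injective)
    (hl : ∀ d, (g.2 d).length = P.κ) : (programName P j ID g).Injective := by
  rintro (⟨i, x, b⟩ | b | n) (⟨i', x', b'⟩ | b' | n') h
  · rcases programName_ro_cases (j := j) (ID := ID) hs hl i x with
      ⟨d, h1, h2⟩ | ⟨rfl, d, h1, h3, h2⟩ | h2 <;>
    rcases programName_ro_cases (j := j) (ID := ID) hs hl i' x' with
      ⟨d', h1', h2'⟩ | ⟨rfl, d', h1', h3', h2'⟩ | h2' <;> rw [h2, h2'] at h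
    · obtain ⟨rfl, rfl⟩ := Slot.name_inj h
      rw [h1, Prod.mk.injEq] at h1'
      rw [h1'.1, h1'.2]
    · exact absurd h Slot.name_ne_img
    · exact absurd h Slot.name_ne_ro
    · exact absurd h.symm Slot.name_ne_img
    · rw [NamedBit.img.injEq] at h
      rw [← h3, ← h3', Slot.addr_injective h.1, h.2]
    · cases h
    · exact absurd h.symm Slot.name_ne_ro
    · cases h
    · cases h; rfl
  · rcases programName_ro_cases (j := j) (ID := ID) hs hl i x with
      ⟨d, h1, h2⟩ | ⟨rfl, d, h1, h3, h2⟩ | h2 <;> rw [h2] at h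
    · exact absurd h Slot.name_ne_msk
    · cases h
    · cases h
  · rcases programName_ro_cases (j := j) (ID := ID) hs hl i x with
      ⟨d, h1, h2⟩ | ⟨rfl, d, h1, h3, h2⟩ | h2 <;> rw [h2] at h
    · exact absurd h Slot.name_ne_coin
    · cases h
    · cases h
  · rcases programName_ro_cases (j := j) (ID := ID) hs hl i' x' with
      ⟨d, h1, h2⟩ | ⟨rfl, d, h1, h3, h2⟩ | h2 <;> rw [h2] at h
    · exact absurd h.symm Slot.name_ne_msk
    · cases h
    · cases h
  · cases h; rfl
  · cases h
  · rcases programName_ro_cases (j := j) (ID := ID) hs hl i' x' with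
      ⟨d, h1, h2⟩ | ⟨rfl, d, h1, h3, h2⟩ | h2 <;> rw [h2] at h
    · exact absurd h.symm Slot.name_ne_coin
    · cases h
    · cases h
  · cases h
  · cases h; rfl

/-- The sample point of the forward security experiment with programmed random oracles. -/
noncomputable def program (P : Params) (j : ℕ) (ID : Str) (ω : Named.Sample P) : Scheme.Sample P :=
  ω ∘ programName P j ID (Named.masterKey ω, Slot.value j ω)

/-- The random oracles are consistent with the programmed values. -/
structure Programmed (P : Params) (j : ℕ) (ID : Str) (ω : Named.Sample P) (H : Hash) : Prop where
  question : ∀ d i x, Slot.question ID (Named.masterKey ω) (Slot.value j ω) d = (i, x) →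
    H i x = d.value j ω
  value : ∀ d : Slot P, ¬ d.IsTarget j → H 2 (d.value j ω) = Named.img ω d.addr
  other : ∀ i x, (∀ d, Slot.question ID (Named.masterKey ω) (Slot.value j ω) d ≠ (i, x)) →
    (i = 2 → ∀ d : Slot P, ¬ d.IsTarget j → d.value j ω ≠ x) → H i x = HORS.hash (Named.hors ω) i x

theorem program_programmed {ω : Named.Sample P} (hs : (Slot.value j ω).Injective) :
    Programmed P j ID ω (Scheme.hash (program P j ID ω)) where
  question d i x h := by
    have := programName_question (j := j) (ID := ID)
      (g := (Named.masterKey ω, Slot.value j ω)) hs (by simp) h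
    simp only [Scheme.hash, program, Function.comp, this, Slot.value]
  value d hd := by
    have := programName_value (j := j) (ID := ID)
      (g := (Named.masterKey ω, Slot.value j ω)) hs hd
    simp only [Scheme.hash, program, Function.comp, this, Named.img]
  other i x h h' := by
    have := programName_other (j := j) (ID := ID)
      (g := (Named.masterKey ω, Slot.value j ω)) h h'
    simp only [Scheme.hash, program, Function.comp, this]
    rfl

theorem Programmed.signerKey {ω : Named.Sample P} {H : Hash} (h : Programmed P j ID ω H) {n : ℕ}
    (hn : n < P.J) :
    Scheme.signerKey H (Named.masterKey ω) ID n = Named.cell ω (P.code n) := by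
  induction n with
  | zero => exact h.question (.inl ⟨0, hn⟩) 0 _ rfl
  | succ n ih =>
    rw [Scheme.signerKey, Function.iterate_succ_apply']
    change H 1 (Scheme.signerKey H (Named.masterKey ω) ID n) = _
    rw [ih (by omega)]
    exact h.question (.inl ⟨n + 1, hn⟩) 1 _ rfl

theorem Programmed.secrets {ω : Named.Sample P} {H : Hash} (h : Programmed P j ID ω H)
    (n : Fin P.J) (i : Fin P.T) :
    Scheme.secrets P H (Named.cell ω (P.code n)) i = Slot.value j ω (.inr (n, i)) :=
  h.question (.inr (n, i)) 1 _ rfl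

/-- The master key, the private keys and the secret strings. -/
def slotData (P : Params) (ID : Str) (ρ : Scheme.Sample P) : Str × (Slot P → Str) :=
  (Scheme.masterKey ρ, fun d => match d with
    | .inl n => Scheme.signerKey (Scheme.hash ρ) (Scheme.masterKey ρ) ID n
    | .inr (n, i) => Scheme.secrets P (Scheme.hash ρ)
        (Scheme.signerKey (Scheme.hash ρ) (Scheme.masterKey ρ) ID n) i)

theorem masterKey_program (ω : Named.Sample P) :
    Scheme.masterKey (program P j ID ω) = Named.masterKey ω := rfl

/-- Following the key chain through the programmed oracles returns the prescribed strings. The data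
that determine the renaming are thereby recovered from the renamed sample point. -/
theorem slotData_program {ω : Named.Sample P} (hs : (Slot.value j ω).Injective) :
    slotData P ID (program P j ID ω) = (Named.masterKey ω, Slot.value j ω) := by
  have h := program_programmed (ID := ID) hs
  refine Prod.ext rfl (funext fun d => ?_)
  rcases d with n | ⟨n, i⟩
  · simp only [slotData, masterKey_program, h.signerKey n.2]
    rfl
  · simp only [slotData, masterKey_program, h.signerKey n.2, h.secrets n i]

theorem slotData_isLocallyConstant : IsLocallyConstant (slotData P ID) := by
  refine (Scheme.isLocallyConstant_masterKey P).prodMk ?_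
  rw [IsLocallyConstant.iff_eventually_eq]
  intro ρ
  have : ∀ d : Slot P, ∀ᶠ ρ' in nhds ρ, (slotData P ID ρ').2 d = (slotData P ID ρ).2 d := by
    rintro (n | ⟨n, i⟩)
    · exact (Scheme.isLocallyConstant_signerKey P ID n).eventually_eq ρ
    · exact (isLocallyConstant_secrets (Scheme.isLocallyConstant_hash P)
        (Scheme.isLocallyConstant_signerKey P ID n) i).eventually_eq ρ
  filter_upwards [Filter.eventually_all.2 this] with ρ' h
  exact funext h

/-- The forward security experiment is the one with programmed random oracles, unless the private
keys and the secret strings are not distinct. -/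
theorem winsAt_le_program (IDs : List Str) (A : Prog Scheme.Query) :
    fairBits (Scheme.Bits P.κ) {ρ | WinsAt P IDs ID A j ρ} ≤ fairBits (NamedBit P.κ)
      {ω | (Slot.value j ω).Injective → WinsAt P IDs ID A j (program P j ID ω)} := by
  have hm := measurableSet_winsAt P IDs ID A j
  -- `fairBits_relabel` bounds probabilities over named bits by those of the experiment, which is
  -- the wrong direction for the winning event. It is applied to the opposite event: the strings are
  -- distinct and the adversary does not win at `j`.
  have h1 : fairBits (NamedBit P.κ)
      {ω | (Slot.value j ω).Injective → WinsAt P IDs ID A j (program P j ID ω)}ᶜ ≤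
        fairBits (Scheme.Bits P.κ) {ρ | WinsAt P IDs ID A j ρ}ᶜ := by
    refine fairBits_relabel (programName P j ID) (fun ω => (Named.masterKey ω, Slot.value j ω))
      (slotData P ID) (fun g => IsLocallyConstant.measurableSet slotData_isLocallyConstant (· = g))
      _ _ ?_ ?_ ?_
    · intro ω hω
      simp only [Set.mem_compl_iff, Set.mem_ofPred_eq, Classical.not_imp] at hω
      exact programName_injective hω.1 (by simp)
    · intro ω hω
      simp only [Set.mem_compl_iff, Set.mem_ofPred_eq, Classical.not_imp] at hω
      exact hω.2
    · intro ω hω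
      simp only [Set.mem_compl_iff, Set.mem_ofPred_eq, Classical.not_imp] at hω
      exact slotData_program hω.1
  rw [prob_compl_eq_one_sub hm] at h1
  set U := {ω | (Slot.value j ω).Injective → WinsAt P IDs ID A j (program P j ID ω)}
  -- Subadditivity of the outer measure is enough, so no measurability of `U` is required.
  have h2 : 1 ≤ fairBits (NamedBit P.κ) U + fairBits (NamedBit P.κ) Uᶜ := by
    rw [← measure_univ (μ := fairBits (NamedBit P.κ)), ← Set.union_compl_self U]
    exact measure_union_le _ _
  have h3 : fairBits (Scheme.Bits P.κ) {ρ | WinsAt P IDs ID A j ρ} ≤ 1 := prob_le_one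
  set w := fairBits (Scheme.Bits P.κ) {ρ | WinsAt P IDs ID A j ρ}
  have h4 : w + (1 - w) ≤ fairBits (NamedBit P.κ) U + (1 - w) := by
    rw [add_tsub_cancel_of_le h3]
    exact h2.trans (add_le_add_right h1 _)
  exact (ENNReal.add_le_add_iff_right (ne_top_of_le_ne_top ENNReal.one_ne_top tsub_le_self)).1 h4

end

/-! ### Consistency of the simulator with the programmed random oracles -/

/-- The strings that are asked before the entry with address `a` is sampled. -/
def asked (a : Str) : List Event → List Str
  | [] => []
  | .ask x :: h => if .samp a ∈ h then asked a h else x :: asked a h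
  | _ :: h => asked a h

theorem asked_subset {a : Str} {h h' : List Event} (hs : h <:+ h') : asked a h ⊆ asked a h' := by
  obtain ⟨l, rfl⟩ := hs
  induction l with
  | nil => exact fun _ h => h
  | cons ev l ih =>
    cases ev with
    | ask x =>
      rw [List.cons_append, asked]
      split_ifs
      · exact ih
      · exact List.subset_cons_of_subset _ ih
    | samp | flip => exact ih

theorem length_asked_le (a : Str) (h : List Event) : (asked a h).length ≤ askCount h := by
  induction h with
  | nil => simp [asked]
  | cons ev h ih =>
    cases ev with
    | ask x =>
      rw [asked]
      split_ifs <;> simp [askCount, List.countP_cons, Event.isAsk] at ih ⊢ <;> omega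
    | samp | flip => simpa [asked, askCount, Event.isAsk] using ih

/-- A string of the tables was asked before it was sampled. -/
def Guessed {P : Params} (j : ℕ) (ω : Named.Sample P) (h : List Event) : Prop :=
  ∃ d : Slot P, ¬ d.IsTarget j ∧ Named.cell ω d.addr ∈ asked d.addr h

/-- The master key was used in an oracle call. -/
def MasterAsked {P : Params} (ID : Str) (ω : Named.Sample P) (l : List (HORS.Query × Str)) : Prop :=
  ∃ q ∈ l, q.2 = Named.masterKey ω ++ ID

/-- The table entries for strings and their images agree with the named bits. -/
structure CellsConsistent {P : Params} (j : ℕ) (ω : Named.Sample P) (T : Tab) (h : List Event) :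
    Prop where
  cell : ∀ a, T.cell a ≠ [] → T.cell a = Named.cell ω a ∧
    ∃ d : Slot P, ¬ d.IsTarget j ∧ d.addr = a ∧ ∀ n, d = .inl n → j ≤ n
  h2 : ∀ x v, v ≠ [] → (T.h2 x = v ↔ ∃ a, T.cell a ≠ [] ∧ Named.cell ω a = x ∧ Named.img ω a = v)
  samp : ∀ a, Event.samp a ∈ h ↔ T.cell a ≠ []

/-- The tables agree with the named bits. -/
structure Consistent {P : Params} (j : ℕ) (ω : Named.Sample P) (T : Tab) (h : List Event) : Prop
    extends CellsConsistent j ω T h where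
  sk : ∀ x c, c ≠ [] → (T.sk x = c ↔ ∃ n : Fin P.J, T.cell (P.code n) ≠ [] ∧
    Named.cell ω (P.code n) = x ∧ P.code (n + 1) = c)

/-- The scalar part of the tables agrees with the calls of the adversary. -/
def Counted (P : Params) (T : Tab) (f : List (Scheme.Query × Str)) : Prop :=
  (T.closed = false ∧ (∀ q ∈ f, q.1 ≠ .brk) ∧ Scheme.sigCount f < P.J ∧
    T.cnt = P.code (Scheme.sigCount f)) ∨
  (T.closed = true ∧ ((∃ q ∈ f, q.1 = .brk) ∨ P.J ≤ Scheme.sigCount f))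

def NamedSample {P : Params} (ω : Named.Sample P) (a s v : Str) : Prop :=
  s = Named.cell ω a ∧ v = Named.img ω a

def NamedAnswer {P : Params} (ω : Named.Sample P) (l : List (HORS.Query × Str)) (q : HORS.Query)
    (x y : Str) : Prop :=
  y = HORS.oracle (Named.hors ω) l q x

section

variable {P : Params} {j : ℕ} {ω : Named.Sample P} {T : Tab} {w : Record}

theorem Named.cell_ne_nil (ω : Named.Sample P) (a : Str) : Named.cell ω a ≠ [] :=
  ne_nil_of_length (P := P) (by simp [Named.cell])

theorem Named.img_ne_nil (ω : Named.Sample P) (a : Str) : Named.img ω a ≠ [] :=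
  ne_nil_of_length (P := P) (by simp [Named.img])

theorem Slot.cell_inj (hs : (Slot.value j ω).Injective) {d d' : Slot P} (hd : ¬ d.IsTarget j)
    (hd' : ¬ d'.IsTarget j) (h : Named.cell ω d.addr = Named.cell ω d'.addr) : d = d' := by
  rw [← value_of_not_isTarget hd, ← value_of_not_isTarget hd'] at h
  exact hs h

/-- Programming `H 2` at a new string overwrites no other image, since the strings of different
slots are different. -/
theorem CellsConsistent.put (hs : (Slot.value j ω).Injective) (hT : CellsConsistent j ω T w.hist)
    {d : Slot P} (hd : ¬ d.IsTarget j) (hdj : ∀ n, d = .inl n → j ≤ n) (ha : T.cell d.addr = []) :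
    CellsConsistent j ω (T.put d.addr (Named.cell ω d.addr) (Named.img ω d.addr))
      (.samp d.addr :: w.hist) where
  cell a h := by
    simp only [Tab.put, Function.update_apply] at h ⊢
    split_ifs at h ⊢ with h'
    · exact ⟨by rw [h'], d, hd, h'.symm, hdj⟩
    · exact hT.cell a h
  h2 x v hv := by
    simp only [Tab.put, Function.update_apply]
    split_ifs with h
    · constructor
      · rintro rfl
        exact ⟨d.addr, by simp [Named.cell_ne_nil], h.symm, rfl⟩
      · rintro ⟨a, h1, h2, rfl⟩
        by_cases h3 : a = d.addr
        · rw [h3]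
        · rw [if_neg h3] at h1
          obtain ⟨-, d', hd', rfl, -⟩ := hT.cell a h1
          rw [Slot.cell_inj hs hd' hd (h2.trans h)]
    · rw [hT.h2 x v hv]
      refine exists_congr fun a => ?_
      by_cases h3 : a = d.addr
      · subst h3
        simp only [ha, ne_eq, not_true_eq_false, false_and, false_iff, not_and]
        intro _ h4
        exact absurd h4.symm h
      · simp only [if_neg h3]
  samp a := by
    simp only [Tab.put, Function.update_apply, List.mem_cons, Event.samp.injEq, hT.samp a]
    split_ifs with h <;> simp [h, Named.cell_ne_nil]

/-- The tables after an entry has been ensured. -/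
structure EnsuredAt (j : ℕ) (ω : Named.Sample P) (T : Tab) (w : Record) (a : Str) (T' : Tab)
    (w' : Record) : Prop where
  cells : CellsConsistent j ω T' w'.hist
  cell : T'.cell = Function.update T.cell a (Named.cell ω a)
  sk : T'.sk = T.sk
  cnt : T'.cnt = T.cnt
  closed : T'.closed = T.closed

theorem ensure_named (hs : (Slot.value j ω).Injective) (hT : CellsConsistent j ω T w.hist)
    {d : Slot P} (hd : ¬ d.IsTarget j) (hdj : ∀ n, d = .inl n → j ≤ n) :
    (ensure T d.addr).Spec (NamedSample ω) (NamedAnswer ω) w (EnsuredAt j ω T w d.addr) := by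
  unfold ensure
  split_ifs with ha
  · rintro s v ⟨rfl, rfl⟩
    exact ⟨hT.put hs hd hdj ha, rfl, rfl, rfl, rfl⟩
  · refine ⟨hT, ?_, rfl, rfl, rfl⟩
    rw [← (hT.cell _ ha).1, Function.update_eq_self]

theorem ensure_secret_named (hs : (Slot.value j ω).Injective) (hT : Consistent j ω T w.hist)
    {n : Fin P.J} (hn : (n : ℕ) + 1 ≠ j) (i : Fin P.T) :
    (ensure T (P.code (n + 1) ++ enc P.τ i)).Spec (NamedSample ω) (NamedAnswer ω) w fun T' w' =>
      Consistent j ω T' w'.hist ∧ T'.cell (P.code (n + 1) ++ enc P.τ i) =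
        Named.cell ω (P.code (n + 1) ++ enc P.τ i) ∧ T'.cnt = T.cnt ∧ T'.closed = T.closed := by
  refine (ensure_named (d := .inr (n, i)) hs hT.toCellsConsistent hn (by simp)).mono
    fun T' w' h => ?_
  have hcell : T'.cell = Function.update T.cell (P.code (n + 1) ++ enc P.τ i)
    (Named.cell ω (P.code (n + 1) ++ enc P.τ i)) := h.cell
  refine ⟨⟨h.cells, fun x c hc => ?_⟩, ?_, h.cnt, h.closed⟩
  · rw [h.sk, hT.sk x c hc]
    have hne : ∀ m : Fin P.J, P.code m ≠ P.code (n + 1) ++ enc P.τ i := fun m h => by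
      have hτ := P.τ_pos
      have := congrArg List.length h
      simp at this; omega
    refine exists_congr fun m => ?_
    rw [hcell, Function.update_of_ne (hne m)]
  · rw [hcell, Function.update_self]

/-- The address `P.code n` holds `sk_{n+1}`, so `j ≤ n` says that only keys after epoch `j` become
known. The epoch is determined by the key because the strings are distinct. -/
theorem nextKey_named (hs : (Slot.value j ω).Injective) (hT : Consistent j ω T w.hist)
    {n : Fin P.J} (hn : j ≤ n) :
    (nextKey T (P.code n)).Spec (NamedSample ω) (NamedAnswer ω) w fun r w' =>
      Consistent j ω r.2 w'.hist ∧ r.1 = Named.cell ω (P.code n) ∧ r.2.cnt = T.cnt ∧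
        r.2.closed = T.closed := by
  refine Handler.Spec.bind ((ensure_named (d := .inl n) hs hT.toCellsConsistent
    (by simp [Slot.IsTarget]) (fun m hm => by cases hm; exact hn)).mono fun T' w' h => ?_)
  have hcell : T'.cell = Function.update T.cell (P.code n) (Named.cell ω (P.code n)) := h.cell
  have hself : T'.cell (P.code n) = Named.cell ω (P.code n) := by rw [hcell, Function.update_self]
  refine ⟨⟨⟨h.cells.cell, h.cells.h2, h.cells.samp⟩, fun x c hc => ?_⟩, hself, h.cnt, h.closed⟩
  have hinj : ∀ m : Fin P.J, Named.cell ω (P.code m) = Named.cell ω (P.code n) → m = n :=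
    fun m h => Sum.inl.inj (Slot.cell_inj hs (d := .inl m) (d' := .inl n)
      (by simp [Slot.IsTarget]) (by simp [Slot.IsTarget]) h)
  rw [hself, P.incr_code n.2]
  simp only [Function.update_apply]
  split_ifs with hx
  · constructor
    · rintro rfl
      exact ⟨n, by rw [hself]; exact Named.cell_ne_nil _ _, hx.symm, rfl⟩
    · rintro ⟨m, -, h2, rfl⟩
      rw [hinj m (h2.trans hx)]
  · rw [h.sk, hT.sk x c hc]
    refine exists_congr fun m => ?_
    by_cases hm : m = n
    · subst hm
      constructor <;> rintro ⟨-, h2, -⟩ <;> exact absurd h2.symm hx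
    · have : P.code m ≠ P.code n := fun h => hm (Fin.ext (P.code_inj m.2.le n.2.le h))
      rw [hcell, Function.update_of_ne this]

theorem ensureAll_named (hs : (Slot.value j ω).Injective) {out : Tab → Str → Str}
    {val : Str → Str} (hout : ∀ T h a, Consistent j ω T h → T.cell a = Named.cell ω a →
      out T a = val a) (l : List Str)
    (hl : ∀ a ∈ l, ∃ n : Fin P.J, (n : ℕ) + 1 ≠ j ∧ ∃ i : Fin P.T, a = P.code (n + 1) ++ enc P.τ i)
    (acc : Str) (hT : Consistent j ω T w.hist) :
    (ensureAll out l acc T).Spec (NamedSample ω) (NamedAnswer ω) w fun r w' =>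
      Consistent j ω r.2 w'.hist ∧ r.1 = acc ++ (l.map val).flatten ∧ r.2.cnt = T.cnt ∧
        r.2.closed = T.closed := by
  induction l generalizing acc T w with
  | nil => exact ⟨hT, by simp, rfl, rfl⟩
  | cons a l ih =>
    obtain ⟨n, hn, i, rfl⟩ := hl a List.mem_cons_self
    refine Handler.Spec.bind ((ensure_secret_named hs hT hn i).mono fun T' w' h => ?_)
    refine (ih (fun a ha => hl a (List.mem_cons_of_mem _ ha)) _ h.1).mono fun r w'' h' => ?_
    refine ⟨h'.1, ?_, h'.2.2.1.trans h.2.2.1, h'.2.2.2.trans h.2.2.2⟩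
    rw [h'.2.1, hout T' _ _ h.1 h.2.1]
    simp

/-! ### The programmed random oracles -/

variable {ID : Str} {H : Hash}

theorem Programmed.hash_zero (h : Programmed P j ID ω H) {x : Str}
    (hx : x ≠ Named.masterKey ω ++ ID) : H 0 x = HORS.hash (Named.hors ω) 0 x := by
  refine h.other 0 x ?_ (by simp)
  rintro (⟨_ | n, hn⟩ | ⟨n, i⟩) hd <;> simp [Slot.question] at hd
  exact hx hd.symm

theorem Programmed.hash_two (h : Programmed P j ID ω H) {x : Str}
    (hx : ∀ d : Slot P, ¬ d.IsTarget j → d.value j ω ≠ x) :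
    H 2 x = HORS.hash (Named.hors ω) 2 x :=
  h.other 2 x (fun d => d.question_ne x) fun _ => hx

/-- The programmed questions to `H 1` are a key that has a successor among the slots, and a key
followed by `τ` bits. The last key `sk_J` on its own is not programmed, which explains the exception
for `P.J`. -/
theorem Programmed.hash_one (h : Programmed P j ID ω H) {x : Str}
    (hx : ∀ n : Fin P.J, Named.cell ω (P.code n) = x.take P.κ →
      (x.drop P.κ = [] → (n : ℕ) + 1 = P.J) ∧ (x.drop P.κ).length ≠ P.τ) :
    H 1 x = HORS.hash (Named.hors ω) 1 x := by
  have hl : ∀ n, (Named.cell ω (P.code n)).length = P.κ := fun n => by simp [Named.cell]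
  refine h.other 1 x ?_ (by simp)
  rintro (⟨_ | n, hn⟩ | ⟨n, i⟩) hd <;> simp only [Slot.question, Prod.mk.injEq, true_and] at hd
  · simp at hd
  · change Named.cell ω (P.code n) = x at hd
    have := (hx ⟨n, by omega⟩ (by rw [← hd, List.take_of_length_le (hl n).le])).1
      (by rw [← hd, List.drop_of_length_le (hl n).le])
    simp at this; omega
  · change Named.cell ω (P.code n) ++ _ = x at hd
    have := (hx n (by rw [← hd, List.take_left' (hl n)])).2
    rw [← hd, List.drop_left' (hl n)] at this
    simp at this

theorem Programmed.hash_one_key (h : Programmed P j ID ω H) {n : ℕ} (hn : n + 1 < P.J) :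
    H 1 (Named.cell ω (P.code n)) = Named.cell ω (P.code (n + 1)) :=
  h.question (.inl ⟨n + 1, hn⟩) 1 _ rfl

/-- Iterates compose: jumping by blocks of `J₂` updates and then stepping singly reaches the key
that the signer reaches step by step. -/
theorem iterate_precomputedKey (P : Params) (H : Hash) (m ID : Str) (j₁ j₂ : ℕ) :
    (H 1)^[j₂] (Scheme.precomputedKey P H m ID j₁) = Scheme.signerKey H m ID (P.J₂ * j₁ + j₂) := by
  have : Scheme.precomputedKey P H m ID j₁ = Scheme.signerKey H m ID (P.J₂ * j₁) := by
    induction j₁ with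
    | zero => rfl
    | succ j₁ ih =>
      rw [Scheme.precomputedKey, ih, Scheme.signerKey, Scheme.signerKey, Nat.mul_succ,
        Nat.add_comm, Function.iterate_add_apply]
      rfl
  rw [this, Scheme.signerKey, Scheme.signerKey, Nat.add_comm, Function.iterate_add_apply]
  rfl

theorem comConstr_eq (P : Params) (H : Hash) (m ID : Str) (i : ℕ) :
    Scheme.comConstr P H m ID i = (List.range P.T).map fun l =>
      H 2 (Scheme.secrets P H (Scheme.signerKey H m ID (i - 1)) l) := by
  simp only [Scheme.comConstr, iterate_precomputedKey, Nat.div_add_mod]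

/-- The secret strings of epoch `j` are those of the HORS key. They differ from every string at
which `H 2` is programmed, so their images are the unprogrammed ones. -/
theorem Programmed.comConstr_target (h : Programmed P j ID ω H)
    (hs : (Slot.value j ω).Injective) (hj' : 0 < j) (hj : j ≤ P.J) :
    Scheme.comConstr P H (Named.masterKey ω) ID j =
      HORS.publicKey P (HORS.hash (Named.hors ω)) (HORS.secretKey (Named.hors ω)) := by
  rw [comConstr_eq, h.signerKey (by omega : j - 1 < P.J)]
  refine List.map_congr_left fun i hi => ?_
  have hi' := List.mem_range.1 hi
  have hjj : j - 1 + 1 = j := Nat.sub_add_cancel hj'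
  have := h.secrets ⟨j - 1, by omega⟩ ⟨i, hi'⟩
  simp only at this
  rw [this, h.hash_two, Slot.value_target hjj]
  intro d hd hdv
  rw [hs hdv] at hd
  exact hd hjj

theorem Programmed.comConstr_other (h : Programmed P j ID ω H) {n : Fin P.J}
    (hn : (n : ℕ) + 1 ≠ j) :
    Scheme.comConstr P H (Named.masterKey ω) ID (n + 1) = (List.range P.T).map fun i =>
      Named.img ω (P.code (n + 1) ++ enc P.τ i) := by
  rw [comConstr_eq, Nat.add_sub_cancel, h.signerKey n.2]
  refine List.map_congr_left fun i hi => ?_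
  have := h.secrets n ⟨i, List.mem_range.1 hi⟩
  simp only at this
  rw [this]
  exact h.value (.inr (n, ⟨i, List.mem_range.1 hi⟩)) hn

end

/-! ### The simulator and the forward security experiment -/

section

variable {P : Params} {j : ℕ} {ω : Named.Sample P} {T : Tab} {w : Record} {ID : Str}
  {f : List (Scheme.Query × Str)}

theorem Handler.Spec.log_suffix {α : Type} {V : Str → Str → Str → Prop}
    {W : List (HORS.Query × Str) → HORS.Query → Str → Str → Prop} {h : Handler α} {w : Record}
    {Q : α → Record → Prop} (hh : h.Spec V W w Q) :
    h.Spec V W w fun r w' => Q r w' ∧ w.log <:+ w'.log := by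
  induction h generalizing w with
  | ret r => exact ⟨hh, List.suffix_rfl⟩
  | samp a g ih => exact fun s v hV => ih _ _ (hh s v hV)
  | call q x g ih =>
    exact fun y hW => (ih _ (hh y hW)).mono fun r w' h =>
      ⟨h.1, (List.suffix_cons _ _).trans h.2⟩

def brkCount (f : List (Scheme.Query × Str)) : ℕ := f.countP fun q => q.1 = .brk

theorem sigCount_cons (q : Scheme.Query) (x : Str) (f : List (Scheme.Query × Str)) :
    Scheme.sigCount ((q, x) :: f) = Scheme.sigCount f + if q = .sig then 1 else 0 := by
  simp [Scheme.sigCount, List.countP_cons]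

theorem Counted.cons (h : Counted P T f) {q : Scheme.Query} (hq : q ≠ .sig) (hq' : q ≠ .brk)
    (x : Str) {T' : Tab} (hcnt : T'.cnt = T.cnt) (hcl : T'.closed = T.closed) :
    Counted P T' ((q, x) :: f) := by
  have hs : Scheme.sigCount ((q, x) :: f) = Scheme.sigCount f := by simp [sigCount_cons, hq]
  unfold Counted
  rw [hs, hcnt, hcl]
  rcases h with ⟨h1, h2, h3, h4⟩ | ⟨h1, h2⟩
  · exact .inl ⟨h1, by simpa [hq'] using h2, h3, h4⟩
  · refine .inr ⟨h1, h2.imp ?_ id⟩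
    rintro ⟨q', h3, h4⟩
    exact ⟨q', List.mem_cons_of_mem _ h3, h4⟩

theorem Counted.cons_of_closed (h : Counted P T f) (hc : T.closed = true) (q : Scheme.Query)
    (x : Str) : Counted P T ((q, x) :: f) := by
  rcases h with ⟨h1, -⟩ | ⟨h1, h2⟩
  · rw [hc] at h1; cases h1
  · refine .inr ⟨h1, h2.imp ?_ fun h => h.trans (by rw [sigCount_cons]; omega)⟩
    rintro ⟨q', h3, h4⟩
    exact ⟨q', List.mem_cons_of_mem _ h3, h4⟩

/-- The result of a query is the answer of the experiment, and the states remain consistent. -/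
def Faithful (j : ℕ) (ID : Str) (ω : Named.Sample P) (q : Scheme.Query) (x : Str)
    (f : List (Scheme.Query × Str)) (r : Str × Tab) (w' : Record) : Prop :=
  MasterAsked ID ω w'.log ∨ (r.1 = Scheme.oracle ID (program P j ID ω) f q x ∧
    Consistent j ω r.2 w'.hist ∧ Counted P r.2 ((q, x) :: f))

/-- The exceptional question is the one whose `H 0` value is the first private key. A call with this
question is counted as a failure, whichever oracle receives it. -/
theorem faithful_forward (hT : Consistent j ω T w.hist) (hC : Counted P T f) (i : Fin 3) (x : Str)
    (h : x ≠ Named.masterKey ω ++ ID →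
      Scheme.hash (program P j ID ω) i x = HORS.hash (Named.hors ω) i x) :
    (forward (.ro i) x T).Spec (NamedSample ω) (NamedAnswer ω) w
      (Faithful j ID ω (.ro i) x f) := by
  rintro y rfl
  by_cases hx : x = Named.masterKey ω ++ ID
  · exact .inl ⟨_, List.mem_cons_self, hx⟩
  · exact .inr ⟨(h hx).symm, hT, hC.cons (by simp) (by simp) x rfl rfl⟩

/-- By `hx` no string is asked while it is still unsampled. A hidden key or string in a question is
then already in the tables and is recognised; a question not recognised is not programmed in the
experiment either. The secret strings of epoch `j` need no such protection, since `H 2` is not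
programmed at them. -/
theorem faithful_ro (hs : (Slot.value j ω).Injective) (hT : Consistent j ω T w.hist)
    (hC : Counted P T f) (i : Fin 3) (x : Str)
    (hx : ∀ y, Event.ask y ∈ asks P (.ro i) x → ∀ d : Slot P, ¬ d.IsTarget j →
      T.cell d.addr = [] → Named.cell ω d.addr ≠ y) :
    (handleRo P x T i).Spec (NamedSample ω) (NamedAnswer ω) w
      (Faithful j ID ω (.ro i) x f) := by
  have hH := program_programmed (ID := ID) hs
  match i with
  | 0 => exact faithful_forward hT hC 0 x hH.hash_zero
  | 2 =>
    rw [handleRo]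
    split_ifs with h1
    · refine faithful_forward hT hC 2 x fun _ => hH.hash_two fun d hd hdx => ?_
      rw [Slot.value_of_not_isTarget hd] at hdx
      by_cases hc : T.cell d.addr = []
      · exact hx x (by simp [asks]) d hd hc hdx
      · have := (hT.h2 x _ (Named.img_ne_nil ω d.addr)).2 ⟨d.addr, hc, hdx, rfl⟩
        rw [h1] at this
        exact Named.img_ne_nil ω d.addr this.symm
    · obtain ⟨a, h2, rfl, h4⟩ := (hT.h2 x _ h1).1 rfl
      obtain ⟨-, d, hd, rfl, -⟩ := hT.cell a h2
      refine .inr ⟨?_, hT, hC.cons (by simp) (by simp) _ rfl rfl⟩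
      change T.h2 _ = Scheme.hash _ 2 _
      rw [← h4, ← hH.value d hd, Slot.value_of_not_isTarget hd]
  | 1 =>
    have hcl : ∀ n : ℕ, (Named.cell ω (P.code n)).length = P.κ := by simp [Named.cell]
    have hcode : ∀ n : Fin P.J, P.code ((n : ℕ) + 1) ≠ [] := fun n =>
      P.code_ne_nil n.2 (Nat.succ_pos n)
    have known : ∀ n : Fin P.J, Named.cell ω (P.code n) = x.take P.κ →
        T.sk (x.take P.κ) = P.code (n + 1) := by
      intro n hn
      refine (hT.sk _ _ (hcode n)).2 ⟨n, fun hc => ?_, hn, rfl⟩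
      exact hx (x.take P.κ) (by simp [asks]) (.inl n) (by simp [Slot.IsTarget]) hc hn
    rw [handleRo]
    split_ifs with h1 h2 h3 h4
    · refine faithful_forward hT hC 1 x fun _ => hH.hash_one fun n hn => ?_
      exact absurd ((known n hn).symm.trans h1) (hcode n)
    -- A recognised key is `sk_{n+1}` with `j ≤ n`: its secret strings belong to an epoch other than
    -- `j`, and its successor lies past `j` again.
    all_goals
      obtain ⟨n, hc, hn, hn'⟩ := (hT.sk _ _ h1).1 rfl
      obtain ⟨-, d, hd, hda, hdj⟩ := hT.cell _ hc
      have hdn : d = .inl n := Slot.addr_injective hda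
      have hjn := hdj n hdn
    · refine faithful_forward hT hC 1 x fun _ => hH.hash_one fun m hm => ⟨fun _ => ?_, ?_⟩
      · exact P.code_inj m.2 le_rfl ((known m hm).symm.trans h3)
      · rw [h2]; exact P.τ_pos.ne
    · rw [← hn'] at h3 ⊢
      have hlt : (n : ℕ) + 1 < P.J := lt_of_le_of_ne n.2 fun h => h3 (by rw [h])
      have hx' : x = Named.cell ω (P.code n) := by
        rw [hn, ← List.append_nil (x.take P.κ), ← h2, List.take_append_drop]
      refine (nextKey_named (n := ⟨n + 1, hlt⟩) hs hT (by simp; omega)).mono fun r w' h => ?_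
      refine .inr ⟨?_, h.1, hC.cons (by simp) (by simp) _ h.2.2.1 h.2.2.2⟩
      rw [h.2.1]
      change _ = Scheme.hash _ 1 x
      rw [hx', hH.hash_one_key hlt]
    · rw [← hn']
      have hv : x.drop P.κ = enc P.τ (val (x.drop P.κ)) := by rw [← h4, enc_val]
      have hlt : val (x.drop P.κ) < P.T := by rw [Params.T, ← h4]; exact val_lt _
      have hnj : (n : ℕ) + 1 ≠ j := by omega
      rw [hv]
      refine Handler.Spec.bind ((ensure_secret_named hs hT hnj ⟨_, hlt⟩).mono fun T' w' h => ?_)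
      refine .inr ⟨?_, h.1, hC.cons (by simp) (by simp) _ h.2.2.1 h.2.2.2⟩
      change T'.cell _ = Scheme.hash _ 1 x
      refine h.2.1.trans ?_
      have := hH.secrets n ⟨_, hlt⟩
      rw [Slot.value_of_not_isTarget (d := .inr (n, _)) hnj] at this
      refine this.symm.trans ?_
      rw [Scheme.secrets, hn, ← hv, List.take_append_drop]
    · refine faithful_forward hT hC 1 x fun _ => hH.hash_one fun m hm => ⟨?_, h4⟩
      exact fun h => absurd h h2

theorem blocks_length_mem {n k : ℕ} {x b : Str} (hx : k * n ≤ x.length) (hb : b ∈ blocks n k x) :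
    b.length = n := by
  simp only [blocks, List.mem_map, List.mem_range] at hb
  obtain ⟨l, hl, rfl⟩ := hb
  have : (l + 1) * n ≤ k * n := Nat.mul_le_mul_right _ hl
  rw [Nat.succ_mul] at this
  simp; omega

theorem hash_length (ω : HORS.Sample P) (i : Fin 3) (x : Str) : (HORS.hash ω i x).length = P.κ := by
  simp [HORS.hash]

theorem val_block_lt {b x : Str} (hx : x.length = P.κ) (hb : b ∈ blocks P.τ P.k x) :
    val b < P.T := by
  rw [Params.T, ← blocks_length_mem (P.k_mul_τ_le.trans hx.ge) hb]
  exact val_lt _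

theorem Counted.advance (hf : ∀ q ∈ f, q.1 ≠ .brk) (hlt : Scheme.sigCount f < P.J)
    (hcnt : T.cnt = P.code (Scheme.sigCount f)) (x : Str) {T' : Tab}
    (h1 : T'.cnt = (T.advance P).cnt) (h2 : T'.closed = (T.advance P).closed) :
    Counted P T' ((.sig, x) :: f) := by
  have hinc : incr T.cnt = P.code (Scheme.sigCount f + 1) := by rw [hcnt, P.incr_code hlt]
  rw [Counted, h1, h2, sigCount_cons]
  simp only [Tab.advance, hinc, if_true, decide_eq_false_iff_not, decide_eq_true_eq]
  by_cases h : Scheme.sigCount f + 1 = P.J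
  · exact .inr ⟨by rw [h], .inr h.ge⟩
  · refine .inl ⟨fun h' => h (P.code_inj hlt le_rfl h'), ?_, by omega, trivial⟩
    simpa using hf

theorem Consistent.advance {h : List Event} (hT : Consistent j ω T h) :
    Consistent j ω (T.advance P) h :=
  ⟨⟨hT.cell, hT.h2, hT.samp⟩, hT.sk⟩

/-- In epoch `j` the secret strings are the HORS secret key, so the HORS oracle returns the right
signature; in any other epoch they are table entries. Both cases select indices by the unprogrammed
`H 0`, which is correct unless `M` is the master key followed by `ID`. -/
theorem faithful_sig (hs : (Slot.value j ω).Injective) (hj : j ≤ P.J)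
    (hT : Consistent j ω T w.hist) (hC : Counted P T f) (M : Str) :
    (handleSig P j M T).Spec (NamedSample ω) (NamedAnswer ω) w (Faithful j ID ω .sig M f) := by
  have hH := program_programmed (ID := ID) hs
  rw [handleSig]
  have hC' := hC
  rcases hC with ⟨h1, h2, h3, h4⟩ | ⟨h1, h2⟩
  · rw [if_neg (by simp [h1])]
    have hinc : incr T.cnt = P.code (Scheme.sigCount f + 1) := by rw [h4, P.incr_code h3]
    have horc : Scheme.oracle ID (program P j ID ω) f .sig M =
        ((msgIndices P (Scheme.hash (program P j ID ω)) M).map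
          (Scheme.secrets P (Scheme.hash (program P j ID ω))
            (Named.cell ω (P.code (Scheme.sigCount f))))).flatten := by
      rw [Scheme.oracle, if_pos ⟨h3, h2⟩]
      simp only [Scheme.sign, masterKey_program]
      rw [hH.signerKey h3]
    rw [hinc]
    split_ifs with h5
    · have hj' := P.code_inj h3 hj h5
      rintro y rfl
      by_cases hM : M = Named.masterKey ω ++ ID
      · exact .inl ⟨_, List.mem_cons_self, hM⟩
      refine .inr ⟨?_, hT.advance, .advance h2 h3 h4 M rfl rfl⟩
      rw [horc]
      simp only [HORS.oracle, HORS.sign, msgIndices, hH.hash_zero hM]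
      refine congrArg List.flatten (List.map_congr_left fun i hi => ?_)
      obtain ⟨b, hb, rfl⟩ := List.mem_map.1 hi
      have hlt := val_block_lt (hash_length _ _ _) hb
      have := hH.secrets ⟨_, h3⟩ ⟨_, hlt⟩
      rw [Slot.value_target hj'] at this
      exact this.symm
    · have hj' : Scheme.sigCount f + 1 ≠ j := fun h => h5 (by rw [h])
      rintro y rfl
      have hcnt : (T.advance P).cnt = P.code (Scheme.sigCount f + 1) := hinc
      refine Handler.Spec.mono (h := signCells P (T.advance P) _)
        (ensureAll_named (w := ⟨w.hist, (.ro 0, M) :: w.log⟩) hs (out := fun T a => T.cell a)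
          (val := Named.cell ω) (fun T h a _ h' => h') _ ?_ [] hT.advance).log_suffix ?_
      · intro a ha
        obtain ⟨b, hb, rfl⟩ := List.mem_map.1 ha
        refine ⟨⟨_, h3⟩, hj', ⟨val b, val_block_lt (hash_length _ _ _) hb⟩, ?_⟩
        simp only [hcnt]
        have hbl := blocks_length_mem (P.k_mul_τ_le.trans (hash_length _ _ _).ge) hb
        conv_lhs => rw [← enc_val b, hbl]
      · rintro r w' ⟨h, hlog⟩
        by_cases hM : M = Named.masterKey ω ++ ID
        · exact .inl ⟨_, hlog.subset List.mem_cons_self, hM⟩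
        refine .inr ⟨?_, h.1, .advance h2 h3 h4 M h.2.2.1 h.2.2.2⟩
        rw [h.2.1, horc, List.nil_append, msgIndices, hH.hash_zero hM, List.map_map, List.map_map,
          hcnt]
        refine congrArg List.flatten (List.map_congr_left fun b hb => ?_)
        have hlt := val_block_lt (hash_length _ _ _) hb
        have := hH.secrets ⟨_, h3⟩ ⟨_, hlt⟩
        rw [Slot.value_of_not_isTarget (d := .inr (⟨_, h3⟩, _)) hj'] at this
        refine Eq.trans ?_ this.symm
        simp only [Function.comp, Slot.addr]
        have hbl := blocks_length_mem (P.k_mul_τ_le.trans (hash_length _ _ _).ge) hb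
        conv_lhs => rw [← enc_val b, hbl]
  · rw [if_pos h1]
    refine .inr ⟨?_, hT, hC'.cons_of_closed h1 _ _⟩
    rw [Scheme.oracle, if_neg]
    rintro ⟨h3, h4⟩
    rcases h2 with ⟨q, hq, hq'⟩ | h2
    · exact h4 q hq hq'
    · omega

theorem faithful_com (hs : (Slot.value j ω).Injective) (hj' : 0 < j) (hj : j ≤ P.J)
    (hT : Consistent j ω T w.hist) (hC : Counted P T f) (q : Str) :
    (handleCom P j (HORS.keyString (Named.hors ω)) q T).Spec (NamedSample ω) (NamedAnswer ω) w
      (Faithful j ID ω .com q f) := by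
  have hH := program_programmed (ID := ID) hs
  rw [handleCom]
  split_ifs with h1 h2
  · have := P.code_inj h1.2 hj h2
    refine .inr ⟨?_, hT, hC.cons (by simp) (by simp) _ rfl rfl⟩
    rw [Scheme.oracle, if_pos h1, masterKey_program, this, hH.comConstr_target hs hj' hj]
    rfl
  · obtain ⟨n, hn⟩ : ∃ n : Fin P.J, val q = n + 1 :=
      ⟨⟨val q - 1, by omega⟩, by simp; omega⟩
    have hnj : (n : ℕ) + 1 ≠ j := fun h => h2 (by rw [hn, h])
    rw [hn]
    refine Handler.Spec.mono (h := comCells P T _) (ensureAll_named hs (val := Named.img ω) ?_ _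
      ?_ [] hT) fun r w' h => ?_
    · intro T' h a hT' ha
      refine (hT'.h2 _ _ (Named.img_ne_nil ω a)).2 ⟨a, ?_, ha.symm, rfl⟩
      rw [ha]; exact Named.cell_ne_nil _ _
    · intro a ha
      obtain ⟨i, hi, rfl⟩ := List.mem_map.1 ha
      exact ⟨n, hnj, ⟨i, List.mem_range.1 hi⟩, rfl⟩
    · refine .inr ⟨?_, h.1, hC.cons (by simp) (by simp) _ h.2.2.1 h.2.2.2⟩
      rw [h.2.1, Scheme.oracle, if_pos h1, masterKey_program, hn, hH.comConstr_other hnj]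
      simp [Function.comp_def]
  · refine .inr ⟨?_, hT, hC.cons (by simp) (by simp) _ rfl rfl⟩
    rw [Scheme.oracle, if_neg h1]

/-- A break-in after fewer than `j` signatures exposes epoch `j`, and nothing has to be simulated
any more; otherwise the revealed key is past epoch `j` and can be sampled. A second break-in, which
the simulator always refuses, is kept as a separate alternative and excluded later by the budget. -/
theorem faithful_brk (hs : (Slot.value j ω).Injective) (hT : Consistent j ω T w.hist)
    (hC : Counted P T f) (x : Str) :
    Scheme.Exposed ((.brk, x) :: f) j ∨ 2 ≤ brkCount ((.brk, x) :: f) ∨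
    (handleBrk T).Spec (NamedSample ω) (NamedAnswer ω) w (Faithful j ID ω .brk x f) := by
  have hH := program_programmed (ID := ID) hs
  rw [handleBrk]
  have hC' := hC
  rcases hC with ⟨h1, h2, h3, h4⟩ | ⟨h1, h2 | h2⟩
  · by_cases hn : Scheme.sigCount f < j
    · exact .inl ⟨[], x, f, rfl, hn⟩
    · right; right
      rw [if_neg (by simp [h1]), h4]
      refine Handler.Spec.bind ((nextKey_named (n := ⟨_, h3⟩) hs hT (by simpa using hn)).mono
        fun r w' h => ?_)
      refine .inr ⟨?_, ⟨⟨h.1.cell, h.1.h2, h.1.samp⟩, h.1.sk⟩, .inr ⟨rfl, .inl ?_⟩⟩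
      · rw [h.2.1, Scheme.oracle, if_pos h3, masterKey_program, hH.signerKey h3]
      · exact ⟨_, List.mem_cons_self, rfl⟩
  · right; left
    have : 0 < brkCount f := by
      simpa [brkCount, List.countP_pos_iff] using h2
    simp [brkCount] at this ⊢
    omega
  · right; right
    rw [if_pos h1]
    refine .inr ⟨?_, hT, hC'.cons_of_closed h1 _ _⟩
    rw [Scheme.oracle, if_neg (by omega)]

end

/-! ### Coupling with the real experiment, and transfer of the forgery -/

section

variable {P : Params} {j : ℕ} {ω : Named.Sample P} {ID : Str} {A : Prog Scheme.Query}

theorem asks_eq {q : Scheme.Query} {x y : Str} (h : Event.ask y ∈ asks P q x) :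
    asks P q x = [.ask y] := by
  unfold asks at h ⊢
  split at h <;> simp_all

theorem samp_mem_asks (q : Scheme.Query) (x a : Str) (h : List Event) :
    Event.samp a ∈ asks P q x ++ h ↔ Event.samp a ∈ h := by
  unfold asks
  split <;> simp

theorem Handler.log_suffix_run {α : Type} (src : Source) (orc : Oracle HORS.Query) (h : Handler α)
    (w : Record) : w.log <:+ (h.run src orc w).2.log := by
  induction h generalizing w with
  | ret r => exact List.suffix_rfl
  | samp a f ih => exact ih _ _ ⟨.samp a :: w.hist, w.log⟩
  | call q x f ih =>
    exact (List.suffix_cons (q, x) w.log).trans (ih (orc w.log q x) ⟨w.hist, (q, x) :: w.log⟩)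

theorem simEnv_log_suffix {pk : Str} {src : Source} {orc : Oracle HORS.Query}
    {p : Prog Scheme.Query} {c c' : Config Scheme.Query} {e e' : Sim} {n : ℕ}
    (h : EnvExec (simEnv P j pk src orc) p c e c' e' n) : e.rcd.log <:+ e'.rcd.log := by
  refine EnvExec.rel (R := fun _ e _ e' => e.rcd.log <:+ e'.rcd.log) (fun _ _ => List.suffix_rfl)
    ?_ (fun _ _ _ => List.suffix_rfl) (fun _ _ _ => List.suffix_rfl) ?_ h
  · intro c e c' e' c'' e'' h h'; exact h.trans h'
  · intro q x y c e
    exact Handler.log_suffix_run src orc (handle P j pk q (c.reg x) e.tab)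
      ⟨asks P q (c.reg x) ++ e.rcd.hist, e.rcd.log⟩

theorem oracleEnv_suffix {Q : Type} {coin : ℕ → Bool} {orc : Oracle Q} {p : Prog Q}
    {c c' : Config Q} {f f' : List (Q × Str)} {n : ℕ}
    (h : EnvExec (oracleEnv coin orc) p c f c' f' n) : f <:+ f' := by
  refine EnvExec.rel (R := fun _ f _ f' => f <:+ f') (fun _ _ => List.suffix_rfl)
    ?_ (fun _ _ _ => List.suffix_rfl) (fun _ _ _ => List.suffix_rfl) ?_ h
  · intro c e c' e' c'' e'' h h'; exact h.trans h'
  · intro q x y c e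
    exact List.suffix_cons _ _

/-- The simulation fails, or it is allowed to fail. -/
def Failed (j : ℕ) (ID : Str) (ω : Named.Sample P) (e : Sim) (f : List (Scheme.Query × Str)) :
    Prop :=
  Guessed j ω e.rcd.hist ∨ MasterAsked ID ω e.rcd.log ∨ Scheme.Exposed f j ∨ 2 ≤ brkCount f

theorem Guessed.mono {h h' : List Event} (hg : Guessed j ω h) (hs : h <:+ h') :
    Guessed j ω h' := by
  obtain ⟨d, hd, hd'⟩ := hg
  exact ⟨d, hd, asked_subset hs hd'⟩

theorem Failed.mono {e e' : Sim} {f f' : List (Scheme.Query × Str)} (h : Failed j ID ω e f)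
    (hh : e.rcd.hist <:+ e'.rcd.hist) (hl : e.rcd.log <:+ e'.rcd.log) (hf : f <:+ f') :
    Failed j ID ω e' f' := by
  rcases h with h | ⟨q, h, h'⟩ | ⟨l, x, l', rfl, h⟩ | h
  · exact .inl (h.mono hh)
  · exact .inr (.inl ⟨q, hl.subset h, h'⟩)
  · obtain ⟨l₀, rfl⟩ := hf
    exact .inr (.inr (.inl ⟨l₀ ++ l, x, l', by simp, h⟩))
  · exact .inr (.inr (.inr (h.trans (hf.sublist.countP_le))))

theorem simEnv_faithful (hs : (Slot.value j ω).Injective) (hj' : 0 < j) (hj : j ≤ P.J)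
    (q : Scheme.Query) (x : Str) (e : Sim) (f : List (Scheme.Query × Str))
    (hT : Consistent j ω e.tab e.rcd.hist) (hC : Counted P e.tab f) :
    let r := (simEnv P j (HORS.keyString (Named.hors ω)) (Named.source ω)
      (HORS.oracle (Named.hors ω))).query q x e
    (r.1 = Scheme.oracle ID (program P j ID ω) f q x ∧ Consistent j ω r.2.tab r.2.rcd.hist ∧
      Counted P r.2.tab ((q, x) :: f)) ∨ Failed j ID ω r.2 ((q, x) :: f) := by
  intro r
  -- The question enters the history before the answer is computed, so a string that is sampled only
  -- in answering a question in which it occurs counts as guessed.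
  by_cases hg : Guessed j ω (asks P q x ++ e.rcd.hist)
  · exact .inr (.inl (hg.mono (Handler.suffix_run (Named.source ω) (HORS.oracle (Named.hors ω)) _
      ⟨asks P q x ++ e.rcd.hist, e.rcd.log⟩)))
  set w : Record := ⟨asks P q x ++ e.rcd.hist, e.rcd.log⟩ with hw
  have hT' : Consistent j ω e.tab w.hist :=
    ⟨⟨hT.cell, hT.h2, fun a => (samp_mem_asks q x a _).trans (hT.samp a)⟩, hT.sk⟩
  have main : Scheme.Exposed ((q, x) :: f) j ∨ 2 ≤ brkCount ((q, x) :: f) ∨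
      (handle P j (HORS.keyString (Named.hors ω)) q x e.tab).Spec (NamedSample ω) (NamedAnswer ω) w
        (Faithful j ID ω q x f) := by
    cases q with
    | ro i =>
      refine .inr (.inr (faithful_ro hs hT' hC i x fun y hy d hd hc hdy => hg ⟨d, hd, ?_⟩))
      rw [asks_eq hy, List.singleton_append, asked, if_neg]
      · rw [hdy]; exact List.mem_cons_self
      · rw [hT.samp, not_not]; exact hc
    | sig => exact .inr (.inr (faithful_sig hs hj hT' hC x))
    | com => exact .inr (.inr (faithful_com hs hj' hj hT' hC x))
    | brk => exact faithful_brk hs hT' hC x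
  rcases main with h | h | h
  · exact .inr (.inr (.inr (.inl h)))
  · exact .inr (.inr (.inr (.inr h)))
  · rcases h.run (src := Named.source ω) (orc := HORS.oracle (Named.hors ω))
      (fun _ _ => ⟨rfl, rfl⟩) (fun _ _ _ => rfl) with h | h
    · exact .inr (.inr (.inl h))
    · exact .inl h

/-- The coupling keeps the tables consistent with the named bits and with the calls of the
adversary. The ways of failing refer to histories and logs, which only grow, so a failure persists
as `EnvExec.couple` requires. -/
theorem simulation (hs : (Slot.value j ω).Injective) (hj' : 0 < j) (hj : j ≤ P.J)
    {c₁ c₂ : Config Scheme.Query} {e₁ : Sim} {n₁ n₂ : ℕ}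
    (h₁ : EnvExec (simEnv P j (HORS.keyString (Named.hors ω)) (Named.source ω)
      (HORS.oracle (Named.hors ω))) A (Config.start _ []) (Sim.start P) c₁ e₁ n₁)
    (h₂ : Exec (fun i => program P j ID ω (.coin i)) (Scheme.oracle ID (program P j ID ω)) A
      (Config.start _ []) c₂ n₂) : c₁ = c₂ ∨ Failed j ID ω e₁ c₂.log := by
  refine (EnvExec.couple (R := fun e f => Consistent j ω e.tab e.rcd.hist ∧ Counted P e.tab f)
    (D := Failed j ID ω) ?_ ?_ ?_ ?_ h₁ h₂.envExec ?_).imp (fun h => h.1) id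
  · rintro i e f ⟨hT, hC⟩
    exact .inl ⟨rfl, ⟨⟨hT.cell, hT.h2, fun a => by simp [simEnv, hT.samp a]⟩, hT.sk⟩, hC⟩
  · rintro q x e f ⟨hT, hC⟩
    exact simEnv_faithful hs hj' hj q x e f hT hC
  · exact fun h h' => h'.mono (simEnv_suffix h) (simEnv_log_suffix h) List.suffix_rfl
  · exact fun h h' => h'.mono List.suffix_rfl List.suffix_rfl (oracleEnv_suffix h)
  · refine ⟨⟨⟨by simp [Sim.start], ?_, by simp [Sim.start]⟩, ?_⟩, .inl ⟨rfl, ?_, ?_, ?_⟩⟩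
    · intro x v hv; simp [Sim.start, hv.symm]
    · intro x v hv; simp [Sim.start, hv.symm]
    · simp [Config.start]
    · simp [Config.start, Scheme.sigCount]; omega
    · simp [Config.start, Scheme.sigCount, Sim.start]

theorem Scheme.length_oracle (ID : Str) (ρ : Scheme.Sample P) (l : List (Scheme.Query × Str))
    (q : Scheme.Query) (x : Str) : Scheme.AnswerLength P q (Scheme.oracle ID ρ l q x).length := by
  have hl : ∀ i y, (Scheme.hash ρ i y).length = P.κ := by simp [Scheme.hash]
  cases q with
  | ro i => simp [Scheme.oracle, hl, Scheme.AnswerLength]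
  | sig =>
    rw [Scheme.oracle, Scheme.AnswerLength]
    split_ifs
    · left
      rw [HORS.length_flatten (n := P.κ)]
      · simp [Scheme.sign, msgIndices, blocks]
      · simp [Scheme.sign, Scheme.secrets, hl]
    · exact .inr rfl
  | com =>
    rw [Scheme.oracle, Scheme.AnswerLength]
    split_ifs
    · left
      rw [HORS.length_flatten (n := P.κ)]
      · simp [Scheme.comConstr]
      · simp [Scheme.comConstr, hl]
    · exact .inr rfl
  | brk =>
    rw [Scheme.oracle, Scheme.AnswerLength]
    split_ifs
    · left
      rw [Scheme.signerKey]
      generalize Scheme.sigCount l = n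
      cases n with
      | zero => exact hl _ _
      | succ n => rw [Function.iterate_succ_apply']; exact hl _ _
    · exact .inr rfl

/-- The images of the strings in the tables are not in the public key. -/
def ImagesSeparate (j : ℕ) (ω : Named.Sample P) : Prop :=
  ∀ d : Slot P, ¬ d.IsTarget j → ∀ i < P.T,
    Named.img ω d.addr ≠ HORS.hash (Named.hors ω) 2 (HORS.secretKey (Named.hors ω) i)

/-- Once the final configurations agree, the forged message is new for HORS as well, because the
reduction requests signatures only for messages that the adversary submitted. What remains is to
replace the programmed hash functions by those of HORS in the verification. -/
theorem namedWins_of_winsAt {IDs : List Str} {t qs qh : ℕ} (hj' : 0 < j) (hj : j ≤ P.J)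
    (hA : Scheme.Admissible P t qs qh 1 A) (hs : (Slot.value j ω).Injective)
    (hi : ImagesSeparate j ω) (hg : ¬ Guessed j ω (namedRun P j A ω).2.rcd.hist)
    (hm : ¬ MasterAsked ID ω (namedRun P j A ω).2.rcd.log)
    (hM : (namedRun P j A ω).1.reg 0 ≠ Named.masterKey ω ++ ID)
    (h : WinsAt P IDs ID A j (program P j ID ω)) : NamedWins P j A ω := by
  obtain ⟨c, n, hex, h1, h2, h3, -, h4⟩ := h
  obtain ⟨m, hex', hv, -⟩ := namedRun_exec (hj'.trans_le hj) hj' hj hA ω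
  have hH := program_programmed (ID := ID) hs
  have hc : (namedRun P j A ω).1 = c := by
    rcases simulation hs hj' hj hex' hex with h | h | h | h | h
    · exact h
    · exact absurd h hg
    · exact absurd h hm
    · exact absurd h h2
    -- The budget of one break-in holds for some halting run, hence for this one by determinism.
    · obtain ⟨c', n', hex₂, -, hb⟩ := hA (fun i => program P j ID ω (.coin i))
        (Scheme.oracle ID (program P j ID ω)) (Scheme.length_oracle ID _)
      rw [(hex₂.det hex).1] at hb
      have := hb.2.2
      simp only [brkCount] at h
      omega
  have hlog := hv.sig_mem
  rw [hc] at hM hlog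
  rw [NamedWins, hc]
  refine ⟨fun h => h1 (hlog _ h), h3, ?_⟩
  have h5 := h4.2.2.2
  simp only [masterKey_program, hH.comConstr_target hs hj' hj] at h5
  have hidx : msgIndices P (Scheme.hash (program P j ID ω)) (c.reg 0) =
      msgIndices P (HORS.hash (Named.hors ω)) (c.reg 0) := by
    simp only [msgIndices, hH.hash_zero hM]
  rw [hidx] at h5
  rw [HORS.Ver, ← h5]
  -- If `H 2` were programmed at a string of the forgery, its image would be an entry of the public
  -- key, which `ImagesSeparate` forbids. So both versions of `H 2` agree on the forgery.
  refine List.map_congr_left fun s hs' => (hH.hash_two fun d hd hds => ?_).symm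
  have h6 := List.mem_map_of_mem (f := Scheme.hash (program P j ID ω) 2) hs'
  rw [h5, ← hds, hH.value d hd] at h6
  obtain ⟨i, hi1, hi2⟩ := List.mem_map.1 h6
  obtain ⟨b, hb, rfl⟩ := List.mem_map.1 hi1
  have hlt := val_block_lt (hash_length _ _ _) hb
  refine hi d hd _ hlt ?_
  rw [← hi2]
  simp [HORS.publicKey, List.getD_eq_getElem?_getD, hlt]

end

/-! ### Probabilities of failures of the simulation -/

theorem fairBits_exists_le {ι α : Type} [Fintype α] {E : α → (ι → Bool) → Prop} {m n : ℕ}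
    (h : ∀ a, fairBits ι {ω | E a ω} ≤ (m : ℝ≥0∞) / 2 ^ n) :
    fairBits ι {ω | ∃ a, E a ω} ≤ ((Fintype.card α * m : ℕ) : ℝ≥0∞) / 2 ^ n := by
  have h1 : {ω | ∃ a, E a ω} = ⋃ a, {ω | E a ω} := by ext ω; simp
  rw [h1]
  refine (measure_iUnion_fintype_le _ _).trans ((Finset.sum_le_sum fun a _ => h a).trans ?_)
  rw [Finset.sum_const, Finset.card_univ, nsmul_eq_mul, Nat.cast_mul, mul_div_assoc]

theorem fairBits_or_le {ι : Type} {E E' : (ι → Bool) → Prop} {m m' n : ℕ}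
    (h : fairBits ι {ω | E ω} ≤ (m : ℝ≥0∞) / 2 ^ n)
    (h' : fairBits ι {ω | E' ω} ≤ (m' : ℝ≥0∞) / 2 ^ n) :
    fairBits ι {ω | E ω ∨ E' ω} ≤ ((m + m' : ℕ) : ℝ≥0∞) / 2 ^ n := by
  rw [Nat.cast_add, ENNReal.add_div]
  exact (measure_union_le {ω | E ω} {ω | E' ω}).trans (add_le_add h h')

section

variable {P : Params} {j : ℕ} {ID : Str} {A : Prog Scheme.Query}

theorem Slot.value_isLocallyConstant (d : Slot P) : IsLocallyConstant (d.value j) :=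
  isLocallyConstant_ofFn _

/-- A union bound over ordered pairs of slots. Different slots use disjoint sets of bits, so one
string is uniform given the other. -/
theorem fairBits_not_injective_le (P : Params) (j : ℕ) :
    fairBits (NamedBit P.κ) {ω | ¬ (Slot.value (P := P) j ω).Injective} ≤
      ((Fintype.card (Slot P × Slot P) * 1 : ℕ) : ℝ≥0∞) / 2 ^ P.κ := by
  have h1 : {ω | ¬ (Slot.value (P := P) j ω).Injective} =
      {ω | ∃ d : Slot P × Slot P, d.1 ≠ d.2 ∧ d.1.value j ω ∈ [d.2.value j ω]} := by
    ext ω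
    simp only [Function.Injective, Set.mem_ofPred_eq, not_forall, Prod.exists, List.mem_singleton]
    refine exists_congr fun d => exists_congr fun d' => ?_
    rw [exists_prop, and_comm]
  rw [h1]
  refine fairBits_exists_le fun d => ?_
  by_cases hd : d.1 = d.2
  · simp [hd]
  simp only [ne_eq, hd, not_false_eq_true, true_and]
  refine fairBits_block_mem_le (d.1.name j) (fun b b' h => (Slot.name_inj h).2)
    (fun ω => [d.2.value j ω]) 1 (fun ω => le_rfl) ?_ ?_
  · intro ω ω' h
    simp only [Slot.value]
    congr 2
    funext b
    exact h _ fun b' hb' => hd (Slot.name_inj hb').1.symm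
  · exact IsLocallyConstant.measurableSet ((d.1.value_isLocallyConstant (j := j)).prodMk
      (d.2.value_isLocallyConstant (j := j))) fun s => s.1 ∈ [s.2]

theorem continuous_hors : Continuous (Named.hors : Named.Sample P → HORS.Sample P) := by
  unfold Named.hors Function.comp; fun_prop

/-- Image bits occur neither in the random oracles nor in the secret key of HORS, so each image hits
each fixed entry with probability `2 ^ (-κ)`. -/
theorem fairBits_not_imagesSeparate_le (P : Params) (j : ℕ) :
    fairBits (NamedBit P.κ) {ω | ¬ ImagesSeparate j ω} ≤
      ((Fintype.card (Slot P × Fin P.T) * 1 : ℕ) : ℝ≥0∞) / 2 ^ P.κ := by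
  have h1 : {ω : Named.Sample P | ¬ ImagesSeparate j ω} ⊆
      {ω | ∃ d : Slot P × Fin P.T, Named.img ω d.1.addr ∈
        [HORS.hash (Named.hors ω) 2 (HORS.secretKey (Named.hors ω) d.2)]} := by
    intro ω hω
    simp only [ImagesSeparate, Set.mem_ofPred_eq, not_forall, not_not] at hω
    obtain ⟨d, _, i, hi, h⟩ := hω
    exact ⟨(d, ⟨i, hi⟩), by simp [h]⟩
  refine (measure_mono h1).trans (fairBits_exists_le fun d => ?_)
  refine fairBits_block_mem_le (fun b => NamedBit.img d.1.addr b) (fun b b' h => by simpa using h)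
    (fun ω => [HORS.hash (Named.hors ω) 2 (HORS.secretKey (Named.hors ω) d.2)]) 1
    (fun ω => le_rfl) ?_ ?_
  · intro ω ω' h
    have : Named.hors ω = Named.hors ω' := by
      funext x; exact h _ fun b => by cases x <;> simp [Named.horsBit]
    rw [this]
  · refine IsLocallyConstant.measurableSet (f := fun ω : Named.Sample P => (Named.img ω d.1.addr,
      HORS.hash (Named.hors ω) 2 (HORS.secretKey (Named.hors ω) d.2)))
      ((isLocallyConstant_ofFn _).prodMk ?_) fun s => s.1 ∈ [s.2]
    exact (isLocallyConstant_hash (HORS.isLocallyConstant_hash P) 2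
      (isLocallyConstant_ofFn _)).comp_continuous continuous_hors

/-- The list is frozen at the moment when the entry is sampled. -/
theorem asked_of_suffix {a : Str} {l h : List Event} (hs : (.samp a :: l) <:+ h) :
    asked a h = asked a l := by
  obtain ⟨l', rfl⟩ := hs
  induction l' with
  | nil => rfl
  | cons ev l' ih =>
    cases ev with
    | ask x => rw [List.cons_append, asked, if_pos (by simp), ih]
    | samp | flip => exact ih

variable {t qs qh qb : ℕ}

/-- What is asked before an entry is sampled does not depend on its bits. Runs on two sample points
that differ in these bits only either coincide or share the history up to the sampling of this
entry, and by then the list is frozen. It has at most `qh` members. -/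
theorem fairBits_guessed_le (hJ : 0 < P.J) (hj' : 0 < j) (hj : j ≤ P.J)
    (hA : Scheme.Admissible P t qs qh qb A) :
    fairBits (NamedBit P.κ) {ω | Guessed j ω (namedRun P j A ω).2.rcd.hist} ≤
      ((Fintype.card (Slot P) * qh : ℕ) : ℝ≥0∞) / 2 ^ P.κ := by
  have h1 : {ω : Named.Sample P | Guessed j ω (namedRun P j A ω).2.rcd.hist} ⊆
      {ω | ∃ d : Slot P, Named.cell ω d.addr ∈
        asked d.addr (namedRun P j A ω).2.rcd.hist} := by
    rintro ω ⟨d, -, h⟩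
    exact ⟨d, h⟩
  refine (measure_mono h1).trans (fairBits_exists_le fun d => ?_)
  refine fairBits_block_mem_le (fun b => NamedBit.cell d.addr b) (fun b b' h => by simpa using h)
    (fun ω => asked d.addr (namedRun P j A ω).2.rcd.hist) qh ?_ ?_ ?_
  · intro ω
    obtain ⟨n, -, hv, hb⟩ := namedRun_exec hJ hj' hj hA ω
    exact (length_asked_le _ _).trans (hv.ask.trans hb.2.1)
  · intro ω ω' h
    have hh : Named.hors ω = Named.hors ω' := by
      funext x; exact h _ fun b => by cases x <;> simp [Named.horsBit]
    obtain ⟨n, hex, -⟩ := namedRun_exec hJ hj' hj hA ω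
    obtain ⟨n', hex', -⟩ := namedRun_exec hJ hj' hj hA ω'
    rw [← hh] at hex'
    rcases simEnv_diverge hex hex' with ⟨-, -, h'⟩ | ⟨ev, l, h1, h2, h3⟩
    · rw [h']
    · have hev : ev = .samp d.addr := by
        cases ev with
        | ask => exact h3.elim
        | flip i => exact absurd (h (.coin i) fun b => by simp) h3
        | samp a =>
          by_contra hne
          refine h3 (Prod.ext ?_ ?_) <;> simp only [Named.source, Named.cell, Named.img]
          · congr 1; funext b; exact h _ fun b' hb => hne (by simp_all)
          · congr 1; funext b; exact h _ fun b' => by simp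
      subst hev
      rw [asked_of_suffix h1, asked_of_suffix h2]
  · exact IsLocallyConstant.measurableSet (f := fun ω : Named.Sample P => (Named.cell ω d.addr,
      namedRun P j A ω)) ((isLocallyConstant_ofFn _).prodMk
        (namedRun_isLocallyConstant hJ hj' hj hA)) fun s => s.1 ∈ asked d.addr s.2.2.rcd.hist

theorem length_log (l : List (HORS.Query × Str)) : l.length = roCount l + sigCount l := by
  induction l with
  | nil => rfl
  | cons q l ih =>
    obtain ⟨q, x⟩ := q
    cases q <;> simp [roCount, sigCount] at ih ⊢ <;> omega

/-- The master key was used in an oracle call or in the forged message. -/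
def MasterUsed (P : Params) (j : ℕ) (ID : Str) (A : Prog Scheme.Query) (ω : Named.Sample P) :
    Prop :=
  MasterAsked ID ω (namedRun P j A ω).2.rcd.log ∨
    (namedRun P j A ω).1.reg 0 = Named.masterKey ω ++ ID

/-- The simulator never reads the master key, so its run is independent of it. The candidates are
the prefixes of length `κ` of the logged questions and of the forged message. -/
theorem fairBits_masterUsed_le (hJ : 0 < P.J) (hj' : 0 < j) (hj : j ≤ P.J)
    (hA : Scheme.Admissible P t qs qh qb A) :
    fairBits (NamedBit P.κ) {ω | MasterUsed P j ID A ω} ≤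
      ((qh + qs + 2 : ℕ) : ℝ≥0∞) / 2 ^ P.κ := by
  let used : Config Scheme.Query × Sim → List Str := fun r =>
    r.1.reg 0 |>.take P.κ |> (· :: r.2.rcd.log.map fun q => q.2.take P.κ)
  have h1 : {ω : Named.Sample P | MasterUsed P j ID A ω} ⊆
      {ω | Named.masterKey ω ∈ used (namedRun P j A ω)} := by
    intro ω hω
    have hl : (Named.masterKey ω).length = P.κ := by simp [Named.masterKey]
    rcases hω with ⟨q, hq, h⟩ | h
    · exact List.mem_cons_of_mem _ (List.mem_map.2 ⟨q, hq, by rw [h, List.take_left' hl]⟩)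
    · refine List.mem_cons.2 (.inl ?_)
      rw [h, List.take_left' hl]
  refine (measure_mono h1).trans ?_
  refine fairBits_block_mem_le (fun b => NamedBit.msk b) (fun b b' h => by simpa using h)
    (fun ω => used (namedRun P j A ω)) (qh + qs + 2) ?_ ?_ ?_
  · intro ω
    obtain ⟨n, -, hv, hb⟩ := namedRun_exec hJ hj' hj hA ω
    obtain ⟨i, _, _, hi⟩ := hv.sim.sig
    -- The count `qh + qs + 2`: at most `qh + qs` random oracle calls, one HORS signing call, and
    -- the forged message.
    have h2 := hv.roCount_le
    have h3 := hb.1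
    have h4 := hb.2.1
    have h5 := length_log (namedRun P j A ω).2.rcd.log
    simp only [used, List.length_cons, List.length_map]
    split_ifs at hi <;> omega
  · intro ω ω' h
    have hh : Named.hors ω = Named.hors ω' := by
      funext x; exact h _ fun b => by cases x <;> simp [Named.horsBit]
    have hsrc : Named.source ω = Named.source ω' := by
      unfold Named.source Named.cell Named.img
      congr 1
      · funext l a
        congr 2 <;> funext b <;> exact h _ fun b' => by simp
      · funext l i; exact h _ fun b' => by simp
    simp only [namedRun, hh, hsrc]
  · exact IsLocallyConstant.measurableSet (f := fun ω : Named.Sample P => (Named.masterKey ω,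
      namedRun P j A ω)) ((isLocallyConstant_ofFn _).prodMk
        (namedRun_isLocallyConstant hJ hj' hj hA)) fun s => s.1 ∈ used s.2

theorem winsAt_le_advantage {IDs : List Str} (hs : P.J.size ≤ P.κ) (hj' : 0 < j) (hj : j ≤ P.J)
    (hA : Scheme.Admissible P t qs qh 1 A) :
    fairBits (Scheme.Bits P.κ) {ρ | WinsAt P IDs ID A j ρ} ≤
      HORS.advantage P (reduction P j A) +
        ((9 * (qs + qh + P.J * P.T + P.k) ^ 2 : ℕ) : ℝ≥0∞) / 2 ^ P.κ := by
  have hJ : 0 < P.J := hj'.trans_le hj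
  have hsub : {ω | (Slot.value j ω).Injective → WinsAt P IDs ID A j (program P j ID ω)} ⊆
      {ω | NamedWins P j A ω} ∪ {ω | (¬ (Slot.value (P := P) j ω).Injective ∨
        ¬ ImagesSeparate j ω) ∨ Guessed j ω (namedRun P j A ω).2.rcd.hist ∨
        MasterUsed P j ID A ω} := by
    intro ω hω
    by_contra h
    simp only [Set.mem_union, Set.mem_ofPred_eq, not_or, not_not, MasterUsed] at h
    obtain ⟨h1, ⟨h2, h3⟩, h4, h5, h6⟩ := h
    exact h1 (namedWins_of_winsAt hj' hj hA h2 h3 h4 h5 h6 (hω h2))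
  refine (winsAt_le_program IDs A).trans ((measure_mono hsub).trans ((measure_union_le _ _).trans
    (add_le_add (namedWins_le_advantage hJ hj' hj hA hs) ?_)))
  refine (fairBits_or_le (fairBits_or_le (fairBits_not_injective_le P j)
    (fairBits_not_imagesSeparate_le P j)) (fairBits_or_le (fairBits_guessed_le hJ hj' hj hA)
    (fairBits_masterUsed_le hJ hj' hj hA))).trans (ENNReal.div_le_div_right ?_ _)
  rw [Nat.cast_le]
  simp only [Fintype.card_prod, Fintype.card_sum, Fintype.card_fin, mul_one]
  have hT : 1 ≤ P.T := Nat.one_le_two_pow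
  have hk := P.k_pos
  -- There are `J + J T ≤ 2 N` slots. Collisions of strings contribute at most `4 N²`, collisions of
  -- images `2 N²`, guesses `2 N²`, and uses of the master key `N²`, where the extra `2` in their
  -- number is covered by `1 ≤ J T` and `1 ≤ k`. This makes `9 N²`.
  set N := qs + qh + P.J * P.T + P.k with hN
  have h1 : P.J ≤ P.J * P.T := Nat.le_mul_of_pos_right _ hT
  have h2 : P.T ≤ P.J * P.T := Nat.le_mul_of_pos_left _ hJ
  have h3 : P.J + P.J * P.T ≤ 2 * N := by omega
  have h4 : qh + qs + 2 ≤ N * N := (by omega : qh + qs + 2 ≤ N).trans (Nat.le_mul_self N)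
  have h5 := Nat.mul_le_mul h3 h3
  have h6 := Nat.mul_le_mul h3 (by omega : P.T ≤ N)
  have h7 := Nat.mul_le_mul h3 (by omega : qh ≤ N)
  nlinarith

end

/-- A winning forgery lies in one of `J` epochs, so the winning probability is at most the sum over
`j` of the bounds for `WinsAt`. The witness is the reduction for the epoch with the largest
advantage, a fixed choice instead of a random guess. `Prog.skip` serves in the degenerate cases. -/
theorem forward_security_le (P : Params) (IDs : List Str) (t qs qh : ℕ) (ID : Str)
    (A : Prog Scheme.Query) (hA : Scheme.Admissible P t qs qh 1 A) :
    ∃ F : Prog HORS.Query,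
      HORS.Admissible P (260 * (t + P.k * P.hashTime)) (min qs 1) (qh + qs + 1) F ∧
      Scheme.advantage P IDs ID A ≤ P.J * (HORS.advantage P F +
        (260 : ℕ) * (qs + qh + P.J * P.T + P.k) ^ 2 / 2 ^ P.κ) := by
  have hskip : HORS.Admissible P (260 * (t + P.k * P.hashTime)) (min qs 1) (qh + qs + 1) .skip := by
    intro pk _ coin orc _
    refine ⟨_, _, .skip _, ?_, by simp [HORS.Budget, Config.start]⟩
    have : 0 < P.k * P.hashTime := Nat.mul_pos P.k_pos (by unfold Params.hashTime; omega)
    simp only [Prog.size]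
    omega
  have hcast : (260 : ℕ) * ((qs : ℝ≥0∞) + qh + P.J * P.T + P.k) ^ 2 =
      ((260 * (qs + qh + P.J * P.T + P.k) ^ 2 : ℕ) : ℝ≥0∞) := by push_cast; rfl
  rw [hcast]
  rcases Nat.eq_zero_or_pos P.J with hJ | hJ
  · refine ⟨.skip, hskip, ?_⟩
    have : {ω | Scheme.Wins P IDs ID A ω} = ∅ := by
      refine Set.eq_empty_of_forall_notMem fun ω hω => ?_
      obtain ⟨j, h1, h2, -⟩ := hω.winsAt
      omega
    rw [Scheme.advantage, this, measure_empty]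
    exact zero_le
  -- The programs need epoch codes of at most `κ` bits. If `J` is longer than that, then `2 ^ κ ≤
  -- J`, the error term is at least one, and there is nothing to prove.
  rcases Nat.lt_or_ge P.κ P.J.size with hs | hs
  · refine ⟨.skip, hskip, ?_⟩
    rw [Nat.lt_size] at hs
    have hT : 1 ≤ P.T := Nat.one_le_two_pow
    have h1 : P.J ≤ P.J * P.T := Nat.le_mul_of_pos_right _ hT
    have h2 : 2 ^ P.κ ≤ 260 * (qs + qh + P.J * P.T + P.k) ^ 2 := by
      have : 2 ^ P.κ ≤ qs + qh + P.J * P.T + P.k := by omega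
      nlinarith
    calc Scheme.advantage P IDs ID A ≤ 1 := prob_le_one
      _ ≤ ((260 * (qs + qh + P.J * P.T + P.k) ^ 2 : ℕ) : ℝ≥0∞) / 2 ^ P.κ := by
          rw [ENNReal.le_div_iff_mul_le (by simp) (by simp), one_mul]
          exact_mod_cast h2
      _ ≤ HORS.advantage P .skip + _ := le_add_self
      _ ≤ _ := le_mul_of_one_le_left' (by exact_mod_cast hJ)
  · obtain ⟨i, hi, hmax⟩ := Finset.exists_max_image (Finset.Icc 1 P.J)
      (fun j => HORS.advantage P (reduction P j A)) ⟨1, Finset.mem_Icc.2 ⟨le_rfl, hJ⟩⟩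
    rw [Finset.mem_Icc] at hi
    refine ⟨reduction P i A, reduction_admissible hs hJ hi.1 hi.2 hA, ?_⟩
    have h1 : {ω | Scheme.Wins P IDs ID A ω} ⊆
        ⋃ j ∈ Finset.Icc 1 P.J, {ω | WinsAt P IDs ID A j ω} := by
      intro ω hω
      obtain ⟨j, h1, h2, h3⟩ := hω.winsAt
      exact Set.mem_biUnion (Finset.mem_coe.2 (Finset.mem_Icc.2 ⟨h1, h2⟩)) h3
    refine (measure_mono h1).trans ((measure_biUnion_finset_le _ _).trans
      ((Finset.sum_le_card_nsmul _ _ (HORS.advantage P (reduction P i A) +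
        ((260 * (qs + qh + P.J * P.T + P.k) ^ 2 : ℕ) : ℝ≥0∞) / 2 ^ P.κ) fun j hj => ?_).trans ?_))
    · have hj' := Finset.mem_Icc.1 hj
      refine (winsAt_le_advantage hs hj'.1 hj'.2 hA).trans (add_le_add (hmax j hj)
        (ENNReal.div_le_div_right (Nat.cast_le.2 ?_) _))
      omega
    · rw [Nat.card_Icc, Nat.add_sub_cancel, nsmul_eq_mul]

end PQHases


theorem theorem5p1 :
    ∃ C : ℕ, ∀ (P : PQHases.Params) (IDs : List PQHases.Str) (t qs qh : ℕ),
      (∀ ID ∈ IDs, ∀ A : PQHases.Prog PQHases.Scheme.Query,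
        PQHases.Scheme.Admissible P t qs qh 1 A →
        ∃ F : PQHases.Prog PQHases.HORS.Query,
          PQHases.HORS.Admissible P (C * (t + P.k * P.hashTime)) (min qs 1) (qh + qs + 1) F ∧
          PQHases.Scheme.advantage P IDs ID A ≤
            P.J * (PQHases.HORS.advantage P F +
              C * (qs + qh + P.J * P.T + P.k) ^ 2 / 2 ^ P.κ)) ∧
      PQHases.Scheme.Adv P IDs t qs qh 1 ≤
        P.J * (PQHases.HORS.Adv P (C * (t + P.k * P.hashTime)) (min qs 1) (qh + qs + 1) +
          C * (qs + qh + P.J * P.T + P.k) ^ 2 / 2 ^ P.κ) := by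
  -- The constant comes from the running time of the reduction; the error term alone would need `9`.
  refine ⟨260, fun P IDs t qs qh => ⟨fun ID _ A hA =>
    PQHases.forward_security_le P IDs t qs qh ID A hA, ?_⟩⟩
  refine iSup₂_le fun ID _ => iSup₂_le fun A hA => ?_
  obtain ⟨F, hF, h⟩ := PQHases.forward_security_le P IDs t qs qh ID A hA
  refine h.trans ?_
  gcongr
  exact le_iSup₂ (f := fun F _ => PQHases.HORS.advantage P F) F hF
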